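/- Let $n\ge 1$ and let $M_1,M_2$ be smooth ($C^\infty$, Hausdorff, second countable, not necessarily connected or compact) $n$-manifolds with boundary. For $j=1,2$ let $C_j$ be a union of connected components of $\partial M_j$, and let $\alpha\colon C_1\to C_2$ be a $C^\infty$ diffeomorphism. Choose collars: open neighbourhoods $U_j$ of $C_j$ in $M_j$ and $C^\infty$ diffeomorphisms $\eta_1\colon U_1\to C_1\times[0,1)$ and $\eta_2\colon U_2\to C_2\times(-1,0]$ with $\eta_j(x)=(x,0)$ for $x\in C_j$. Let $N=(M_1\sqcup M_2)/(x\sim\alpha(x),\ x\in C_1)$ with projection $\pi$, equipped with the smooth structure that away from the glued boundary is that of $M_1$ or $M_2$, and for which the homeomorphism $\eta\colon\pi(U_1\cup U_2)\to C_2\times(-1,1)$ obtained by putting together $(\alpha\times\mathrm{id})\circ\eta_1$ and $\eta_2$ is a diffeomorphism. Let $\mathcal A$ be the set of pairs $(f_1,f_2)\in\mathrm{Homeo}(M_1)\times\mathrm{Homeo}(M_2)$ with $f_1(C_1)=C_1$ and $\alpha\circ f_1|_{C_1}=f_2|_{C_2}\circ\alpha$; for such a pair let $\mathfrak g(f_1,f_2)\colon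 N\to N$ be the homeomorphism induced by $f_1$ and $f_2$. Theorem. There exist homeomorphisms $\Psi_1$ of $M_1$ and $\Psi_2$ of $M_2$ with the following properties. 1. For $\phi(y)=e^{-1/y}$ $(y>0)$, $\phi(0)=0$: in the collar coordinates $\eta_1$, on some open neighbourhood of $C_1$, $\Psi_1$ is the map $(x,y)\mapsto(x,\phi(\phi(y)))$; in the collar coordinates $\eta_2$, on some open neighbourhood of $C_2$, $\Psi_2$ is the map $(x,y)\mapsto(x,-\phi(\phi(-y)))$. 2. For $i=1,2$ and every $f_i\in\mathrm{Diff}^\infty(M_i)$, one has $\Psi_i^{-1}f_i\Psi_i\in\mathrm{Diff}^\infty(M_i)$. 3. If $f_1\in\mathrm{Diff}^\infty(M_1)$, $f_2\in\mathrm{Diff}^\infty(M_2)$ and $(f_1,f_2)\in\mathcal A$, then $(\Psi_1^{-1}f_1\Psi_1,\Psi_2^{-1}f_2\Psi_2)\in\mathcal A$ and $\mathfrak g(\Psi_1^{-1}f_1\Psi_1,\Psi_2^{-1}f_2\Psi_2)\in\mathrm{Diff}^\infty(N)$. -/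

import Mathlib

open scoped Manifold ContDiff Topology
open Set

universe u v

/-- A diffeomorphism between arbitrary subsets `s ⊆ M` and `t ⊆ M'`: mutually inverse bijections
`s → t` and `t → s`, both of class `C^∞` in the sense of `ContMDiffOn`. The values of the two
functions outside of `s` and `t` are irrelevant. When `s` and `t` are embedded submanifolds
(possibly with boundary), such as a union of boundary components `C`, an open set, or a product
`C × [0, 1)`, this is a diffeomorphism in the usual sense. -/
structure SubsetDiffeo {E : Type*} [NormedAddCommGroup E] [NormedSpace ℝ E]
    {H : Type*} [TopologicalSpace H] (I : ModelWithCorners ℝ E H)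
    {E' : Type*} [NormedAddCommGroup E'] [NormedSpace ℝ E']
    {H' : Type*} [TopologicalSpace H'] (I' : ModelWithCorners ℝ E' H')
    {M : Type*} [TopologicalSpace M] [ChartedSpace H M]
    {M' : Type*} [TopologicalSpace M'] [ChartedSpace H' M']
    (s : Set M) (t : Set M') where
  toFun : M → M'
  invFun : M' → M
  mapsTo : MapsTo toFun s t
  mapsTo_inv : MapsTo invFun t s
  left_inv : ∀ x ∈ s, invFun (toFun x) = x
  right_inv : ∀ y ∈ t, toFun (invFun y) = y
  contMDiffOn_toFun : ContMDiffOn I I' ∞ toFun s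
  contMDiffOn_invFun : ContMDiffOn I' I ∞ invFun t

/-- `C` is a union of connected components of the boundary of `M`. -/
def IsUnionOfBoundaryComponents (n : ℕ) [NeZero n] {M : Type*} [TopologicalSpace M]
    [ChartedSpace (EuclideanHalfSpace n) M] (C : Set M) : Prop :=
  C ⊆ (𝓡∂ n).boundary M ∧ ∀ x ∈ C, connectedComponentIn ((𝓡∂ n).boundary M) x ⊆ C

/-- The data used to glue two smooth `n`-manifolds `M₁`, `M₂` with boundary: unions `C₁`, `C₂` of
boundary components, a diffeomorphism `α : C₁ → C₂`, and product neighbourhoods (collars)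
`η₁ : U₁ → C₁ × [0, 1)` and `η₂ : U₂ → C₂ × (-1, 0]` of `C₁` and `C₂`. -/
structure GluingData (n : ℕ) [NeZero n]
    (M₁ : Type u) [TopologicalSpace M₁] [ChartedSpace (EuclideanHalfSpace n) M₁]
    (M₂ : Type v) [TopologicalSpace M₂] [ChartedSpace (EuclideanHalfSpace n) M₂] where
  C₁ : Set M₁
  C₂ : Set M₂
  isUnion₁ : IsUnionOfBoundaryComponents n C₁
  isUnion₂ : IsUnionOfBoundaryComponents n C₂
  α : SubsetDiffeo (𝓡∂ n) (𝓡∂ n) C₁ C₂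
  U₁ : Set M₁
  U₂ : Set M₂
  isOpen_U₁ : IsOpen U₁
  isOpen_U₂ : IsOpen U₂
  C₁_subset : C₁ ⊆ U₁
  C₂_subset : C₂ ⊆ U₂
  η₁ : SubsetDiffeo (𝓡∂ n) ((𝓡∂ n).prod 𝓘(ℝ, ℝ)) U₁ (C₁ ×ˢ Ico (0 : ℝ) 1)
  η₂ : SubsetDiffeo (𝓡∂ n) ((𝓡∂ n).prod 𝓘(ℝ, ℝ)) U₂ (C₂ ×ˢ Ioc (-1 : ℝ) 0)
  η₁_apply : ∀ x ∈ C₁, η₁.toFun x = (x, 0)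
  η₂_apply : ∀ x ∈ C₂, η₂.toFun x = (x, 0)

/-- A helper: a space covered by open sets that are homeomorphic to open subsets of a smooth
manifold `X`, with smooth transition maps, is a smooth manifold. -/
theorem exists_smoothStructure_of_cover {n : ℕ} [NeZero n] {X N : Type*} [TopologicalSpace X]
    [ChartedSpace (EuclideanHalfSpace n) X] [IsManifold (𝓡∂ n) ∞ X] [TopologicalSpace N]
    (P : Set (OpenPartialHomeomorph N X)) (hP : ∀ x, ∃ p ∈ P, x ∈ p.source)
    (hc : ∀ p ∈ P, ∀ q ∈ P, ContMDiffOn (𝓡∂ n) (𝓡∂ n) ∞ (q ∘ p.symm) (p.symm ≫ₕ q).source) :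
    ∃ (_ : ChartedSpace (EuclideanHalfSpace n) N) (_ : IsManifold (𝓡∂ n) ∞ N),
      ∀ p ∈ P, ContMDiffOn (𝓡∂ n) (𝓡∂ n) ∞ p p.source ∧
        ContMDiffOn (𝓡∂ n) (𝓡∂ n) ∞ p.symm p.target := by
  choose pc hpcP hpc using hP
  let cs : ChartedSpace (EuclideanHalfSpace n) N :=
    { atlas := {f | ∃ p ∈ P, ∃ e ∈ atlas (EuclideanHalfSpace n) X, f = p ≫ₕ e}
      chartAt := fun x => pc x ≫ₕ chartAt _ (pc x x)
      mem_chart_source := fun x => by simp [hpc x]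
      chart_mem_atlas := fun x => ⟨pc x, hpcP x, _, chart_mem_atlas _ _, rfl⟩ }
  have hm : IsManifold (𝓡∂ n) ∞ N := by
    apply isManifold_of_contDiffOn
    rintro _ _ ⟨p, hp, e, he, rfl⟩ ⟨q, hq, f, hf, rfl⟩
    rw [← contMDiffOn_iff_contDiffOn]
    have he' := IsManifold.subset_maximalAtlas (I := 𝓡∂ n) (n := ∞) he
    have hf' := IsManifold.subset_maximalAtlas (I := 𝓡∂ n) (n := ∞) hf
    have h3 := (𝓡∂ n).contMDiffOn_symm (n := ∞)
    apply ContMDiff.comp_contMDiffOn (𝓡∂ n).contMDiff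
    refine ContMDiffOn.comp (t := ((p ≫ₕ e).symm ≫ₕ (q ≫ₕ f)).source) ?_
      (h3.mono inter_subset_right) inter_subset_left
    intro y hy
    simp only [OpenPartialHomeomorph.trans_source, OpenPartialHomeomorph.symm_source,
      OpenPartialHomeomorph.trans_target, mem_inter_iff, mem_preimage,
      OpenPartialHomeomorph.coe_trans_symm, Function.comp_apply] at hy
    obtain ⟨⟨hy1, hy2⟩, hy3, hy4⟩ := hy
    have h5 : ContMDiffAt (𝓡∂ n) (𝓡∂ n) ∞ (q ∘ p.symm) (e.symm y) :=
      (hc p hp q hq).contMDiffAt ((p.symm ≫ₕ q).open_source.mem_nhds (by simp [hy2, hy3]))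
    exact ((contMDiffAt_of_mem_maximalAtlas hf' hy4).comp y
      (h5.comp y (contMDiffAt_symm_of_mem_maximalAtlas he' hy1))).contMDiffWithinAt
  refine ⟨cs, hm, fun p hp => ?_⟩
  have key (e) (he : e ∈ atlas (EuclideanHalfSpace n) X) :
      p ≫ₕ e ∈ IsManifold.maximalAtlas (𝓡∂ n) ∞ N :=
    IsManifold.subset_maximalAtlas (I := 𝓡∂ n) (n := ∞) ⟨p, hp, e, he, rfl⟩
  constructor
  · intro x hx
    have hx' : x ∈ (p ≫ₕ chartAt (EuclideanHalfSpace n) (p x)).source := by simp [hx]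
    refine ContMDiffAt.contMDiffWithinAt ?_
    have h1 := contMDiffAt_of_mem_maximalAtlas (key _ (chart_mem_atlas _ (p x))) hx'
    have h2 := contMDiffAt_symm_of_mem_maximalAtlas (I := 𝓡∂ n) (n := ∞)
      (IsManifold.chart_mem_maximalAtlas (p x)) (mem_chart_target (EuclideanHalfSpace n) (p x))
    refine (ContMDiffAt.comp x h2 h1).congr_of_eventuallyEq ?_
    filter_upwards [(p ≫ₕ chartAt (EuclideanHalfSpace n) (p x)).open_source.mem_nhds hx'] with z hz
    simp only [OpenPartialHomeomorph.trans_source, mem_inter_iff, mem_preimage] at hz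
    simp [hz.2]
  · intro y hy
    have h1 := contMDiffAt_of_mem_maximalAtlas (I := 𝓡∂ n) (n := ∞)
      (IsManifold.chart_mem_maximalAtlas y) (mem_chart_source (EuclideanHalfSpace n) y)
    have h2 := contMDiffAt_symm_of_mem_maximalAtlas (key _ (chart_mem_atlas _ y))
      (x := chartAt (EuclideanHalfSpace n) y y) (by simp [hy])
    refine ContMDiffAt.contMDiffWithinAt ?_
    refine (ContMDiffAt.comp y h2 h1).congr_of_eventuallyEq ?_
    filter_upwards [(chartAt (EuclideanHalfSpace n) y).open_source.mem_nhds
      (mem_chart_source _ y)] with z hz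
    simp [hz]

/-- A helper: unions of boundary components are closed. -/
theorem IsUnionOfBoundaryComponents.isClosed {n : ℕ} [NeZero n] {M : Type*} [TopologicalSpace M]
    [ChartedSpace (EuclideanHalfSpace n) M] [IsManifold (𝓡∂ n) ∞ M] {C : Set M}
    (hC : IsUnionOfBoundaryComponents n C) : IsClosed C := by
  rw [← closure_subset_iff_isClosed]
  intro x hx
  have hxb : x ∈ (𝓡∂ n).boundary M :=
    ((𝓡∂ n).isClosed_boundary (n := ∞) (by simp)).closure_subset_iff.2 hC.1 hx
  set e := extChartAt (𝓡∂ n) x with he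
  have hb : ∀ y ∈ e.source, y ∈ (𝓡∂ n).boundary M ↔ (e y) 0 = 0 := by
    intro y hy
    have h1 := (𝓡∂ n).isInteriorPoint_iff_of_mem_atlas (n := ∞) (by simp)
      (chart_mem_atlas (EuclideanHalfSpace n) x) (x := y) (by simpa [he] using hy)
    have h2 : (𝓡∂ n).IsInteriorPoint y ↔ 0 < (e y) 0 := by
      rw [h1]
      constructor
      · intro h
        have h3 := interior_mono (OpenPartialHomeomorph.extend_target_subset_range _) h
        rwa [interior_range_modelWithCornersEuclideanHalfSpace] at h3
      · intro h
        refine OpenPartialHomeomorph.mem_interior_extend_target _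
          ((chartAt (EuclideanHalfSpace n) x).map_source (by simpa [he] using hy)) ?_
        rw [interior_range_modelWithCornersEuclideanHalfSpace]
        exact h
    have h4 : 0 ≤ (e y) 0 := by
      have : e y ∈ range (𝓡∂ n) := extChartAt_target_subset_range x (e.map_source hy)
      rwa [range_modelWithCornersEuclideanHalfSpace] at this
    have h5 : y ∈ (𝓡∂ n).boundary M ↔ ¬ (𝓡∂ n).IsInteriorPoint y :=
      (𝓡∂ n).isBoundaryPoint_iff_not_isInteriorPoint y
    rw [h5, h2, not_lt]
    exact ⟨fun h => le_antisymm h h4, fun h => h.le⟩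
  have ht : e.target ∈ 𝓝[range (𝓡∂ n)] (e x) := extChartAt_target_mem_nhdsWithin x
  obtain ⟨r, hr, hball⟩ := Metric.mem_nhdsWithin_iff.1 ht
  let S : Set (EuclideanSpace ℝ (Fin n)) := Metric.ball (e x) r ∩ {y | y 0 = 0}
  have hS : Convex ℝ S := by
    refine (convex_ball _ _).inter ?_
    intro a ha b hb s t _ _ _
    simp only [mem_ofPred_eq] at ha hb
    simp [ha, hb]
  have hSt : S ⊆ e.target := by
    intro y hy
    refine hball ⟨hy.1, ?_⟩
    rw [range_modelWithCornersEuclideanHalfSpace]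
    exact le_of_eq hy.2.symm
  have hT : IsPreconnected (e.symm '' S) :=
    hS.isPreconnected.image _ ((continuousOn_extChartAt_symm x).mono hSt)
  have hTb : e.symm '' S ⊆ (𝓡∂ n).boundary M := by
    rintro _ ⟨y, hy, rfl⟩
    rw [hb _ (e.map_target (hSt hy)), e.right_inv (hSt hy)]
    exact hy.2
  have hmem (z) (hz : z ∈ e.source) (hzb : z ∈ (𝓡∂ n).boundary M)
      (hzr : e z ∈ Metric.ball (e x) r) : z ∈ e.symm '' S :=
    ⟨e z, ⟨hzr, (hb z hz).1 hzb⟩, e.left_inv hz⟩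
  have hW : e.source ∩ e ⁻¹' Metric.ball (e x) r ∈ 𝓝 x :=
    Filter.inter_mem (extChartAt_source_mem_nhds x)
      ((continuousAt_extChartAt x).preimage_mem_nhds (Metric.ball_mem_nhds _ hr))
  obtain ⟨y, ⟨hy1, hy2⟩, hyC⟩ := mem_closure_iff_nhds.1 hx _ hW
  have hyT := hmem y hy1 (hC.1 hyC) hy2
  have hxT := hmem x (mem_extChartAt_source x) hxb (Metric.mem_ball_self hr)
  exact hC.2 y hyC (hT.subset_connectedComponentIn hyT hTb hxT)

namespace GluingData

section

variable {n : ℕ} [NeZero n]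
  {M₁ : Type u} [TopologicalSpace M₁] [ChartedSpace (EuclideanHalfSpace n) M₁]
  {M₂ : Type v} [TopologicalSpace M₂] [ChartedSpace (EuclideanHalfSpace n) M₂]

/-- The relation generating the gluing: `x ∼ α x` for `x ∈ C₁`. -/
inductive Rel (G : GluingData n M₁ M₂) : M₁ ⊕ M₂ → M₁ ⊕ M₂ → Prop
  | glue (x : M₁) (hx : x ∈ G.C₁) : Rel G (Sum.inl x) (Sum.inr (G.α.toFun x))

/-- The glued space `N = M₁ ⊔ M₂ / ∼`. -/
def Glued (G : GluingData n M₁ M₂) : Type (max u v) := Quot G.Rel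

/-- The quotient topology. -/
instance instTopologicalSpaceGlued (G : GluingData n M₁ M₂) : TopologicalSpace G.Glued :=
  inferInstanceAs (TopologicalSpace (Quot G.Rel))

/-- The projection `π : M₁ ⊔ M₂ → N`. -/
def proj (G : GluingData n M₁ M₂) : M₁ ⊕ M₂ → G.Glued := Quot.mk G.Rel

/-- The set `π (U₁ ∪ U₂)`. -/
def collarSet (G : GluingData n M₁ M₂) : Set G.Glued :=
  G.proj '' (Sum.inl '' G.U₁ ∪ Sum.inr '' G.U₂)

/-- The map `η : π (U₁ ∪ U₂) → C₂ × (-1, 1)` put together from `(α × id) ∘ η₁` and `η₂`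
(with irrelevant values outside of `π (U₁ ∪ U₂)`). -/
def collarMap (G : GluingData n M₁ M₂) : G.Glued → M₂ × ℝ :=
  Quot.lift
    (Sum.elim (fun x => (G.α.toFun (G.η₁.toFun x).1, (G.η₁.toFun x).2)) G.η₂.toFun) <| by
    rintro _ _ ⟨x, hx⟩
    simp [G.η₁_apply x hx, G.η₂_apply _ (G.α.mapsTo hx)]

/-- The smooth structure of the glued space: away from the glued boundaries it is that of `M₁` or
`M₂`, and `η : π (U₁ ∪ U₂) → C₂ × (-1, 1)` is a diffeomorphism. These conditions determine the
smooth structure uniquely. -/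
structure IsGluedStructure (G : GluingData n M₁ M₂)
    (_ : ChartedSpace (EuclideanHalfSpace n) G.Glued) : Prop where
  isManifold : IsManifold (𝓡∂ n) ∞ G.Glued
  isLocalDiffeomorphOn_inl :
    IsLocalDiffeomorphOn (𝓡∂ n) (𝓡∂ n) ∞ (fun x : M₁ => G.proj (Sum.inl x)) G.C₁ᶜ
  isLocalDiffeomorphOn_inr :
    IsLocalDiffeomorphOn (𝓡∂ n) (𝓡∂ n) ∞ (fun x : M₂ => G.proj (Sum.inr x)) G.C₂ᶜ
  collar : ∃ e : SubsetDiffeo (𝓡∂ n) ((𝓡∂ n).prod 𝓘(ℝ, ℝ))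
      G.collarSet (G.C₂ ×ˢ Ioo (-1 : ℝ) 1), EqOn e.toFun G.collarMap G.collarSet

/-! Helper facts for the existence of the smooth structure. -/

open Classical in
/-- A helper: the section of the projection which prefers points of `M₂`. -/
noncomputable def sec (G : GluingData n M₁ M₂) : G.Glued → M₁ ⊕ M₂ :=
  Quot.lift (Sum.elim (fun x => if x ∈ G.C₁ then Sum.inr (G.α.toFun x) else Sum.inl x) Sum.inr) <| by
    rintro _ _ ⟨x, hx⟩
    simp [hx]

theorem proj_inl (G : GluingData n M₁ M₂) {x : M₁} (hx : x ∈ G.C₁) :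
    G.proj (Sum.inl x) = G.proj (Sum.inr (G.α.toFun x)) := Quot.sound ⟨x, hx⟩

theorem sec_inl (G : GluingData n M₁ M₂) {x : M₁} (hx : x ∉ G.C₁) :
    G.sec (G.proj (Sum.inl x)) = Sum.inl x := by
  simp [sec, proj, hx]

theorem sec_inr (G : GluingData n M₁ M₂) (x : M₂) :
    G.sec (G.proj (Sum.inr x)) = Sum.inr x := rfl

theorem proj_sec (G : GluingData n M₁ M₂) (p : G.Glued) : G.proj (G.sec p) = p := by
  induction p using Quot.ind with
  | mk p =>
    obtain x | x := p
    · by_cases hx : x ∈ G.C₁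
      · have h : G.sec (G.proj (Sum.inl x)) = Sum.inr (G.α.toFun x) := by simp [sec, proj, hx]
        exact (congrArg G.proj h).trans (G.proj_inl hx).symm
      · exact congrArg G.proj (G.sec_inl hx)
    · rfl

theorem isQuotientMap_proj (G : GluingData n M₁ M₂) : Topology.IsQuotientMap G.proj := isQuotientMap_quot_mk

theorem mem_C₁_iff (G : GluingData n M₁ M₂) {x : M₁} (hx : x ∈ G.U₁) :
    x ∈ G.C₁ ↔ (G.η₁.toFun x).2 = 0 := by
  refine ⟨fun h => by rw [G.η₁_apply x h], fun h => ?_⟩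
  have h1 := (G.η₁.mapsTo hx).1
  have h2 : G.η₁.toFun x = G.η₁.toFun (G.η₁.toFun x).1 := by
    rw [G.η₁_apply _ h1]
    exact Prod.ext rfl h
  have h3 := congrArg G.η₁.invFun h2
  rw [G.η₁.left_inv _ hx, G.η₁.left_inv _ (G.C₁_subset h1)] at h3
  rw [h3]
  exact h1

theorem mem_C₂_iff (G : GluingData n M₁ M₂) {x : M₂} (hx : x ∈ G.U₂) :
    x ∈ G.C₂ ↔ (G.η₂.toFun x).2 = 0 := by
  refine ⟨fun h => by rw [G.η₂_apply x h], fun h => ?_⟩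
  have h1 := (G.η₂.mapsTo hx).1
  have h2 : G.η₂.toFun x = G.η₂.toFun (G.η₂.toFun x).1 := by
    rw [G.η₂_apply _ h1]
    exact Prod.ext rfl h
  have h3 := congrArg G.η₂.invFun h2
  rw [G.η₂.left_inv _ hx, G.η₂.left_inv _ (G.C₂_subset h1)] at h3
  rw [h3]
  exact h1

theorem inl_mem_collarSet (G : GluingData n M₁ M₂) {x : M₁} :
    G.proj (Sum.inl x) ∈ G.collarSet ↔ x ∈ G.U₁ := by
  constructor
  · rintro ⟨_, ⟨y, hy, rfl⟩ | ⟨y, hy, rfl⟩, h⟩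
    · by_cases hx : x ∈ G.C₁
      · exact G.C₁_subset hx
      by_cases hy' : y ∈ G.C₁
      · have := congrArg G.sec h
        rw [G.proj_inl hy', G.sec_inl hx, G.sec_inr] at this
        cases this
      · have := congrArg G.sec h
        rw [G.sec_inl hy', G.sec_inl hx] at this
        cases this
        exact hy
    · by_cases hx : x ∈ G.C₁
      · exact G.C₁_subset hx
      have := congrArg G.sec h
      rw [G.sec_inl hx, G.sec_inr] at this
      cases this
  · exact fun hx => ⟨_, Or.inl ⟨x, hx, rfl⟩, rfl⟩

theorem inr_mem_collarSet (G : GluingData n M₁ M₂) {x : M₂} :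
    G.proj (Sum.inr x) ∈ G.collarSet ↔ x ∈ G.U₂ := by
  constructor
  · rintro ⟨_, ⟨y, hy, rfl⟩ | ⟨y, hy, rfl⟩, h⟩
    · have := congrArg G.sec h
      by_cases hy' : y ∈ G.C₁
      · rw [G.proj_inl hy', G.sec_inr, G.sec_inr] at this
        cases this
        exact G.C₂_subset (G.α.mapsTo hy')
      · rw [G.sec_inl hy', G.sec_inr] at this
        cases this
    · have := congrArg G.sec h
      rw [G.sec_inr, G.sec_inr] at this
      cases this
      exact hy
  · exact fun hx => ⟨_, Or.inr ⟨x, hx, rfl⟩, rfl⟩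

theorem isOpen_collarSet (G : GluingData n M₁ M₂) : IsOpen G.collarSet := by
  rw [← G.isQuotientMap_proj.isOpen_preimage]
  have : G.proj ⁻¹' G.collarSet = Sum.inl '' G.U₁ ∪ Sum.inr '' G.U₂ := by
    ext (x | x)
    · simp [G.inl_mem_collarSet]
    · simp [G.inr_mem_collarSet]
  rw [this]
  exact (isOpenMap_inl _ G.isOpen_U₁).union (isOpenMap_inr _ G.isOpen_U₂)

theorem collarMap_inl (G : GluingData n M₁ M₂) (x : M₁) :
    G.collarMap (G.proj (Sum.inl x)) =
      (G.α.toFun (G.η₁.toFun x).1, (G.η₁.toFun x).2) := rfl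

theorem collarMap_inr (G : GluingData n M₁ M₂) (x : M₂) :
    G.collarMap (G.proj (Sum.inr x)) = G.η₂.toFun x := rfl

open Classical in
/-- A helper: the inverse of `η`. -/
noncomputable def collarInv (G : GluingData n M₁ M₂) (z : M₂ × ℝ) : G.Glued :=
  if 0 ≤ z.2 then G.proj (Sum.inl (G.η₁.invFun (G.α.invFun z.1, z.2)))
  else G.proj (Sum.inr (G.η₂.invFun z))

theorem collarInv_of_nonneg (G : GluingData n M₁ M₂) {z : M₂ × ℝ} (hz : 0 ≤ z.2) :
    G.collarInv z = G.proj (Sum.inl (G.η₁.invFun (G.α.invFun z.1, z.2))) := by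
  simp [collarInv, hz]

theorem collarInv_of_nonpos (G : GluingData n M₁ M₂) {z : M₂ × ℝ} (hz : z.2 ≤ 0)
    (hzC : z.1 ∈ G.C₂) : G.collarInv z = G.proj (Sum.inr (G.η₂.invFun z)) := by
  obtain hz | hz := hz.lt_or_eq
  · simp [collarInv, hz]
  · obtain ⟨c, t⟩ := z
    obtain rfl : t = 0 := hz
    have h1 := G.η₁.left_inv _ (G.C₁_subset (G.α.mapsTo_inv hzC))
    have h2 := G.η₂.left_inv _ (G.C₂_subset hzC)
    rw [G.η₁_apply _ (G.α.mapsTo_inv hzC)] at h1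
    rw [G.η₂_apply _ hzC] at h2
    rw [G.collarInv_of_nonneg le_rfl, h1, h2, G.proj_inl (G.α.mapsTo_inv hzC), G.α.right_inv _ hzC]

/-- A helper: `η` as a bijection `π (U₁ ∪ U₂) → C₂ × (-1, 1)`. -/
noncomputable def collarEquiv (G : GluingData n M₁ M₂) : PartialEquiv G.Glued (M₂ × ℝ) where
  toFun := G.collarMap
  invFun := G.collarInv
  source := G.collarSet
  target := G.C₂ ×ˢ Ioo (-1 : ℝ) 1
  map_source' := by
    rintro _ ⟨_, ⟨x, hx, rfl⟩ | ⟨x, hx, rfl⟩, rfl⟩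
    · have := G.η₁.mapsTo hx
      exact ⟨G.α.mapsTo this.1, by rw [collarMap_inl]; linarith [this.2.1], this.2.2⟩
    · have := G.η₂.mapsTo hx
      exact ⟨this.1, this.2.1, by rw [collarMap_inr]; linarith [this.2.2]⟩
  map_target' := by
    rintro z ⟨hz1, hz2⟩
    obtain h | h := le_total 0 z.2
    · rw [G.collarInv_of_nonneg h, G.inl_mem_collarSet]
      exact G.η₁.mapsTo_inv ⟨G.α.mapsTo_inv hz1, h, hz2.2⟩
    · rw [G.collarInv_of_nonpos h hz1, G.inr_mem_collarSet]
      exact G.η₂.mapsTo_inv ⟨hz1, hz2.1, h⟩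
  left_inv' := by
    rintro _ ⟨_, ⟨x, hx, rfl⟩ | ⟨x, hx, rfl⟩, rfl⟩
    · have := G.η₁.mapsTo hx
      rw [G.collarInv_of_nonneg this.2.1, G.collarMap_inl, G.α.left_inv _ this.1]
      exact congrArg (fun y => G.proj (Sum.inl y)) (G.η₁.left_inv _ hx)
    · have := G.η₂.mapsTo hx
      exact (G.collarInv_of_nonpos this.2.2 this.1).trans (congrArg (fun y => G.proj (Sum.inr y)) (G.η₂.left_inv _ hx))
  right_inv' := by
    rintro ⟨c, t⟩ ⟨hz1, hz2⟩
    simp only at hz1 hz2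
    obtain h | h := le_total 0 t
    · rw [G.collarInv_of_nonneg h, G.collarMap_inl,
        G.η₁.right_inv _ ⟨G.α.mapsTo_inv hz1, h, hz2.2⟩, G.α.right_inv _ hz1]
    · rw [G.collarInv_of_nonpos h hz1, G.collarMap_inr, G.η₂.right_inv _ ⟨hz1, hz2.1, h⟩]

/-- A helper: smoothness at a point of the first summand of a disjoint union. -/
theorem contMDiffAt_inl {X : Type*} [TopologicalSpace X] [ChartedSpace (EuclideanHalfSpace n) X]
    {f : M₁ ⊕ M₂ → X} {x : M₁}
    (h : ContMDiffAt (𝓡∂ n) (𝓡∂ n) ∞ (fun y => f (Sum.inl y)) x) :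
    ContMDiffAt (𝓡∂ n) (𝓡∂ n) ∞ f (Sum.inl x) := by
  have h1 : ContMDiff (𝓡∂ n) (𝓡∂ n) ∞ (Sum.elim id (fun _ => x) : M₁ ⊕ M₂ → M₁) :=
    contMDiff_id.sumElim contMDiff_const
  have h2 := ContMDiffAt.comp (Sum.inl x : M₁ ⊕ M₂) (g := fun y => f (Sum.inl y))
    (f := Sum.elim id (fun _ => x)) h h1.contMDiffAt
  refine h2.congr_of_eventuallyEq ?_
  filter_upwards [isOpen_range_inl.mem_nhds ⟨x, rfl⟩]
  rintro _ ⟨y, rfl⟩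
  rfl

/-- A helper: smoothness at a point of the second summand of a disjoint union. -/
theorem contMDiffAt_inr {X : Type*} [TopologicalSpace X] [ChartedSpace (EuclideanHalfSpace n) X]
    {f : M₁ ⊕ M₂ → X} {x : M₂}
    (h : ContMDiffAt (𝓡∂ n) (𝓡∂ n) ∞ (fun y => f (Sum.inr y)) x) :
    ContMDiffAt (𝓡∂ n) (𝓡∂ n) ∞ f (Sum.inr x) := by
  have h1 : ContMDiff (𝓡∂ n) (𝓡∂ n) ∞ (Sum.elim (fun _ => x) id : M₁ ⊕ M₂ → M₂) :=
    contMDiff_const.sumElim contMDiff_id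
  have h2 := ContMDiffAt.comp (Sum.inr x : M₁ ⊕ M₂) (g := fun y => f (Sum.inr y))
    (f := Sum.elim (fun _ => x) id) h h1.contMDiffAt
  refine h2.congr_of_eventuallyEq ?_
  filter_upwards [isOpen_range_inr.mem_nhds ⟨x, rfl⟩]
  rintro _ ⟨y, rfl⟩
  rfl

theorem contMDiffOn_collarMap_inl (G : GluingData n M₁ M₂) :
    ContMDiffOn (𝓡∂ n) ((𝓡∂ n).prod 𝓘(ℝ, ℝ)) ∞
      (fun x => (G.α.toFun (G.η₁.toFun x).1, (G.η₁.toFun x).2)) G.U₁ := by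
  have h1 := G.η₁.contMDiffOn_toFun
  refine ContMDiffOn.prodMk ?_ (contMDiff_snd.comp_contMDiffOn h1)
  exact G.α.contMDiffOn_toFun.comp (contMDiff_fst.comp_contMDiffOn h1)
    (fun x hx => (G.η₁.mapsTo hx).1)

theorem contMDiffOn_collarInv_inl (G : GluingData n M₁ M₂) :
    ContMDiffOn ((𝓡∂ n).prod 𝓘(ℝ, ℝ)) (𝓡∂ n) ∞
      (fun z : M₂ × ℝ => G.η₁.invFun (G.α.invFun z.1, z.2)) (G.C₂ ×ˢ Ico (0 : ℝ) 1) := by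
  refine G.η₁.contMDiffOn_invFun.comp (f := fun z : M₂ × ℝ => (G.α.invFun z.1, z.2)) ?_
    (fun z hz => ⟨G.α.mapsTo_inv hz.1, hz.2⟩)
  refine ContMDiffOn.prodMk ?_ contMDiff_snd.contMDiffOn
  exact G.α.contMDiffOn_invFun.comp contMDiff_fst.contMDiffOn (fun z hz => hz.1)

theorem continuousOn_collarMap (G : GluingData n M₁ M₂) :
    ContinuousOn G.collarMap G.collarSet := by
  rw [G.isQuotientMap_proj.continuousOn_isOpen_iff G.isOpen_collarSet]
  rintro (x | x) hx
  · refine ContinuousAt.continuousWithinAt ?_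
    rw [← Topology.IsOpenEmbedding.inl.continuousAt_iff]
    exact G.contMDiffOn_collarMap_inl.continuousOn.continuousAt
      (G.isOpen_U₁.mem_nhds (G.inl_mem_collarSet.1 hx))
  · refine ContinuousAt.continuousWithinAt ?_
    rw [← Topology.IsOpenEmbedding.inr.continuousAt_iff]
    exact G.η₂.contMDiffOn_toFun.continuousOn.continuousAt
      (G.isOpen_U₂.mem_nhds (G.inr_mem_collarSet.1 hx))

theorem continuous_proj (G : GluingData n M₁ M₂) : Continuous G.proj := continuous_quot_mk

theorem continuousOn_collarInv (G : GluingData n M₁ M₂) :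
    ContinuousOn G.collarInv (G.C₂ ×ˢ Ioo (-1 : ℝ) 1) := by
  have hA : ContinuousOn G.collarInv (G.C₂ ×ˢ Ico (0 : ℝ) 1) :=
    ((G.continuous_proj.comp continuous_inl).comp_continuousOn
      G.contMDiffOn_collarInv_inl.continuousOn).congr (fun z hz => G.collarInv_of_nonneg hz.2.1)
  have hB : ContinuousOn G.collarInv (G.C₂ ×ˢ Ioc (-1 : ℝ) 0) :=
    ((G.continuous_proj.comp continuous_inr).comp_continuousOn
      G.η₂.contMDiffOn_invFun.continuousOn).congr
      (fun z hz => G.collarInv_of_nonpos hz.2.2 hz.1)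
  have hU : G.C₂ ×ˢ Ioo (-1 : ℝ) 1 ⊆ G.C₂ ×ˢ Ico (0 : ℝ) 1 ∪ G.C₂ ×ˢ Ioc (-1 : ℝ) 0 := by
    rintro z ⟨h1, h2⟩
    obtain h | h := le_total 0 z.2
    · exact Or.inl ⟨h1, h, h2.2⟩
    · exact Or.inr ⟨h1, h2.1, h⟩
  rintro z ⟨hz1, hz2⟩
  refine ContinuousWithinAt.mono (ContinuousWithinAt.union ?_ ?_) hU
  · obtain h | h := le_or_gt 0 z.2
    · exact hA z ⟨hz1, h, hz2.2⟩
    · refine continuousWithinAt_of_notMem_closure fun hc => ?_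
      have : z ∈ {w : M₂ × ℝ | 0 ≤ w.2} :=
        closure_minimal (fun w hw => hw.2.1) (isClosed_le continuous_const continuous_snd) hc
      exact absurd this (not_le.2 h)
  · obtain h | h := le_or_gt z.2 0
    · exact hB z ⟨hz1, hz2.1, h⟩
    · refine continuousWithinAt_of_notMem_closure fun hc => ?_
      have : z ∈ {w : M₂ × ℝ | w.2 ≤ 0} :=
        closure_minimal (fun w hw => hw.2.2) (isClosed_le continuous_snd continuous_const) hc
      exact absurd this (not_le.2 h)

/-- A helper: the points of `M₁ ⊔ M₂` outside of the glued boundaries. -/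
def awayFromGluing (G : GluingData n M₁ M₂) : Set (M₁ ⊕ M₂) :=
  Sum.inl '' G.C₁ᶜ ∪ Sum.inr '' G.C₂ᶜ

theorem inl_mem_away (G : GluingData n M₁ M₂) {x : M₁} :
    Sum.inl x ∈ G.awayFromGluing ↔ x ∉ G.C₁ := by simp [awayFromGluing]

theorem inr_mem_away (G : GluingData n M₁ M₂) {x : M₂} :
    Sum.inr x ∈ G.awayFromGluing ↔ x ∉ G.C₂ := by simp [awayFromGluing]

theorem sec_proj (G : GluingData n M₁ M₂) {p : M₁ ⊕ M₂} (hp : p ∈ G.awayFromGluing) :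
    G.sec (G.proj p) = p := by
  obtain x | x := p
  · exact G.sec_inl (G.inl_mem_away.1 hp)
  · rfl

theorem preimage_image_away (G : GluingData n M₁ M₂) :
    G.proj ⁻¹' (G.proj '' G.awayFromGluing) = G.awayFromGluing := by
  refine Subset.antisymm ?_ (subset_preimage_image _ _)
  rintro p ⟨q, hq, h⟩
  have h1 := congrArg G.sec h
  rw [G.sec_proj hq] at h1
  obtain x | x := p
  · by_cases hx : x ∈ G.C₁
    · rw [G.proj_inl hx, G.sec_inr] at h1
      rw [h1] at hq
      exact absurd (G.α.mapsTo hx) (G.inr_mem_away.1 hq)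
    · exact G.inl_mem_away.2 hx
  · rw [G.sec_inr] at h1
    rwa [h1] at hq

/-- A helper: the set `η₂⁻¹ (C₂ × (-1, 0))`. -/
def innerCollar (G : GluingData n M₁ M₂) : Set M₂ := {x | x ∈ G.U₂ ∧ (G.η₂.toFun x).2 < 0}

theorem isOpen_innerCollar (G : GluingData n M₁ M₂) : IsOpen G.innerCollar :=
  (continuous_snd.comp_continuousOn G.η₂.contMDiffOn_toFun.continuousOn).isOpen_inter_preimage
    G.isOpen_U₂ isOpen_Iio

/-- A helper: the map `(c, t) ↦ η₂⁻¹ (c, (t - 1) / 2)` from `C₂ × (-1, 1)` to the inner collar. -/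
noncomputable def push (G : GluingData n M₁ M₂) (z : M₂ × ℝ) : M₂ :=
  G.η₂.invFun (z.1, (z.2 - 1) / 2)

/-- A helper: the inverse of `push`. -/
noncomputable def pull (G : GluingData n M₁ M₂) (x : M₂) : M₂ × ℝ :=
  ((G.η₂.toFun x).1, 2 * (G.η₂.toFun x).2 + 1)

theorem shift_mem (G : GluingData n M₁ M₂) {z : M₂ × ℝ} (hz : z ∈ G.C₂ ×ˢ Ioo (-1 : ℝ) 1) :
    (z.1, (z.2 - 1) / 2) ∈ G.C₂ ×ˢ Ioc (-1 : ℝ) 0 :=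
  ⟨hz.1, by have := hz.2.1; simp only; linarith, by have := hz.2.2; simp only; linarith⟩

theorem push_mem (G : GluingData n M₁ M₂) {z : M₂ × ℝ} (hz : z ∈ G.C₂ ×ˢ Ioo (-1 : ℝ) 1) :
    G.push z ∈ G.innerCollar := by
  refine ⟨G.η₂.mapsTo_inv (G.shift_mem hz), ?_⟩
  rw [push, G.η₂.right_inv _ (G.shift_mem hz)]
  have := hz.2.2
  simp only
  linarith

theorem pull_mem (G : GluingData n M₁ M₂) {x : M₂} (hx : x ∈ G.innerCollar) :
    G.pull x ∈ G.C₂ ×ˢ Ioo (-1 : ℝ) 1 := by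
  have h1 := G.η₂.mapsTo hx.1
  have h2 := hx.2
  have h3 := h1.2.1
  exact ⟨h1.1, by simp only [pull]; linarith, by simp only [pull]; linarith⟩

theorem pull_push (G : GluingData n M₁ M₂) {z : M₂ × ℝ} (hz : z ∈ G.C₂ ×ˢ Ioo (-1 : ℝ) 1) :
    G.pull (G.push z) = z := by
  rw [pull, push, G.η₂.right_inv _ (G.shift_mem hz)]
  ext
  · rfl
  · simp only
    ring

theorem push_pull (G : GluingData n M₁ M₂) {x : M₂} (hx : x ∈ G.innerCollar) :
    G.push (G.pull x) = x := by
  have : ((G.pull x).1, ((G.pull x).2 - 1) / 2) = G.η₂.toFun x := by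
    ext
    · rfl
    · simp only [pull]
      ring
  rw [push, this, G.η₂.left_inv _ hx.1]

theorem contMDiffOn_push (G : GluingData n M₁ M₂) :
    ContMDiffOn ((𝓡∂ n).prod 𝓘(ℝ, ℝ)) (𝓡∂ n) ∞ G.push (G.C₂ ×ˢ Ioo (-1 : ℝ) 1) := by
  refine G.η₂.contMDiffOn_invFun.comp (f := fun z : M₂ × ℝ => (z.1, (z.2 - 1) / 2)) ?_
    (fun z hz => G.shift_mem hz)
  have h : ContDiff ℝ ∞ (fun t : ℝ => (t - 1) / 2) := by fun_prop
  exact (contMDiff_fst.prodMk (h.contMDiff.comp contMDiff_snd)).contMDiffOn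

theorem contMDiffOn_pull (G : GluingData n M₁ M₂) :
    ContMDiffOn (𝓡∂ n) ((𝓡∂ n).prod 𝓘(ℝ, ℝ)) ∞ G.pull G.U₂ := by
  have h : ContDiff ℝ ∞ (fun t : ℝ => 2 * t + 1) := by fun_prop
  have h1 : ContMDiff ((𝓡∂ n).prod 𝓘(ℝ, ℝ)) ((𝓡∂ n).prod 𝓘(ℝ, ℝ)) ∞
      (fun z : M₂ × ℝ => (z.1, 2 * z.2 + 1)) :=
    contMDiff_fst.prodMk (h.contMDiff.comp contMDiff_snd)
  exact h1.comp_contMDiffOn G.η₂.contMDiffOn_toFun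

/-- A helper: the identification of `π (U₁ ∪ U₂)` with an open subset of `M₂` through `η`. -/
noncomputable def collarChart (G : GluingData n M₁ M₂) :
    OpenPartialHomeomorph G.Glued (M₁ ⊕ M₂) where
  toFun := fun p => Sum.inr (G.push (G.collarMap p))
  invFun := Sum.elim (fun x => G.proj (Sum.inl x)) (fun x => G.collarInv (G.pull x))
  source := G.collarSet
  target := Sum.inr '' G.innerCollar
  map_source' := fun p hp => ⟨_, G.push_mem (G.collarEquiv.map_source hp), rfl⟩
  map_target' := by
    rintro _ ⟨x, hx, rfl⟩
    exact G.collarEquiv.map_target (G.pull_mem hx)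
  left_inv' := fun p hp => by
    have : G.pull (G.push (G.collarMap p)) = G.collarMap p :=
      G.pull_push (G.collarEquiv.map_source hp)
    rw [Sum.elim_inr, this]
    exact G.collarEquiv.left_inv hp
  right_inv' := by
    rintro _ ⟨x, hx, rfl⟩
    have : G.collarMap (G.collarInv (G.pull x)) = G.pull x :=
      G.collarEquiv.right_inv (G.pull_mem hx)
    rw [Sum.elim_inr, this, G.push_pull hx]
  open_source := G.isOpen_collarSet
  open_target := isOpenMap_inr _ G.isOpen_innerCollar
  continuousOn_toFun := continuous_inr.comp_continuousOn
    (G.contMDiffOn_push.continuousOn.comp G.continuousOn_collarMap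
      (fun _ hp => G.collarEquiv.map_source hp))
  continuousOn_invFun := by
    rintro _ ⟨x, hx, rfl⟩
    refine ContinuousAt.continuousWithinAt ?_
    rw [← Topology.IsOpenEmbedding.inr.continuousAt_iff]
    exact (G.continuousOn_collarInv.comp (G.contMDiffOn_pull.continuousOn.mono fun _ h => h.1)
      (fun _ h => G.pull_mem h)).continuousAt (G.isOpen_innerCollar.mem_nhds hx)

theorem contMDiffOn_away_collar (G : GluingData n M₁ M₂) :
    ContMDiffOn (𝓡∂ n) (𝓡∂ n) ∞ (fun p => Sum.inr (G.push (G.collarMap (G.proj p))) :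
      M₁ ⊕ M₂ → M₁ ⊕ M₂) (G.proj ⁻¹' G.collarSet) := by
  rintro (x | x) hx
  · refine (contMDiffAt_inl ?_).contMDiffWithinAt
    have hx := G.inl_mem_collarSet.1 hx
    refine ContMDiffOn.contMDiffAt ?_ (G.isOpen_U₁.mem_nhds hx)
    exact ContMDiff.inr.comp_contMDiffOn (G.contMDiffOn_push.comp G.contMDiffOn_collarMap_inl
      (fun y hy => G.collarEquiv.map_source (G.inl_mem_collarSet.2 hy)))
  · refine (contMDiffAt_inr ?_).contMDiffWithinAt
    have hx := G.inr_mem_collarSet.1 hx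
    refine ContMDiffOn.contMDiffAt ?_ (G.isOpen_U₂.mem_nhds hx)
    exact ContMDiff.inr.comp_contMDiffOn (G.contMDiffOn_push.comp G.η₂.contMDiffOn_toFun
      (fun y hy => G.collarEquiv.map_source (G.inr_mem_collarSet.2 hy)))

section

variable [IsManifold (𝓡∂ n) ∞ M₁] [IsManifold (𝓡∂ n) ∞ M₂]

theorem isOpen_away (G : GluingData n M₁ M₂) : IsOpen G.awayFromGluing :=
  (isOpenMap_inl _ G.isUnion₁.isClosed.isOpen_compl).union
    (isOpenMap_inr _ G.isUnion₂.isClosed.isOpen_compl)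

/-- A helper: the identification of the complement of the glued boundaries in `N` with an open
subset of `M₁ ⊔ M₂`. -/
noncomputable def awayChart (G : GluingData n M₁ M₂) :
    OpenPartialHomeomorph G.Glued (M₁ ⊕ M₂) where
  toFun := G.sec
  invFun := G.proj
  source := G.proj '' G.awayFromGluing
  target := G.awayFromGluing
  map_source' := by
    rintro _ ⟨p, hp, rfl⟩
    rwa [G.sec_proj hp]
  map_target' := fun p hp => ⟨p, hp, rfl⟩
  left_inv' := fun p _ => G.proj_sec p
  right_inv' := fun p hp => G.sec_proj hp
  open_source := by
    rw [← G.isQuotientMap_proj.isOpen_preimage, G.preimage_image_away]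
    exact G.isOpen_away
  open_target := G.isOpen_away
  continuousOn_toFun := by
    rw [G.isQuotientMap_proj.continuousOn_isOpen_iff, G.preimage_image_away]
    · exact continuousOn_id.congr fun p hp => G.sec_proj hp
    · rw [← G.isQuotientMap_proj.isOpen_preimage, G.preimage_image_away]
      exact G.isOpen_away
  continuousOn_invFun := G.continuous_proj.continuousOn

theorem contMDiffOn_collar_away (G : GluingData n M₁ M₂) :
    ContMDiffOn (𝓡∂ n) (𝓡∂ n) ∞ (G.awayChart ∘ G.collarChart.symm)
      (G.collarChart.symm ≫ₕ G.awayChart).source := by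
  rintro _ ⟨⟨x, hx, rfl⟩, hxs⟩
  refine (contMDiffAt_inr ?_).contMDiffWithinAt
  have hxs : G.collarInv (G.pull x) ∈ G.proj '' G.awayFromGluing := hxs
  have hp := G.pull_mem hx
  have hcont : ContinuousAt (fun y => (G.pull y).2) x :=
    (continuous_snd.comp_continuousOn G.contMDiffOn_pull.continuousOn).continuousAt
      (G.isOpen_U₂.mem_nhds hx.1)
  have hpull : ContMDiffAt (𝓡∂ n) ((𝓡∂ n).prod 𝓘(ℝ, ℝ)) ∞ G.pull x :=
    G.contMDiffOn_pull.contMDiffAt (G.isOpen_U₂.mem_nhds hx.1)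
  have hW := G.isOpen_innerCollar.mem_nhds hx
  obtain h | h | h := lt_trichotomy (G.pull x).2 0
  · have hV : G.innerCollar ∩ {y | (G.pull y).2 < 0} ∈ 𝓝 x :=
      Filter.inter_mem hW (hcont.eventually_lt continuousAt_const h)
    have hs : ContMDiffOn (𝓡∂ n) (𝓡∂ n) ∞
        (fun y => (Sum.inr (G.η₂.invFun (G.pull y)) : M₁ ⊕ M₂))
        (G.innerCollar ∩ {y | (G.pull y).2 < 0}) :=
      ContMDiff.inr.comp_contMDiffOn (G.η₂.contMDiffOn_invFun.comp
        (G.contMDiffOn_pull.mono fun y hy => hy.1.1)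
        (fun y hy => ⟨(G.pull_mem hy.1).1, (G.pull_mem hy.1).2.1, le_of_lt hy.2⟩))
    refine (hs.congr ?_).contMDiffAt hV
    intro y hy
    change G.sec (G.collarInv (G.pull y)) = _
    rw [G.collarInv_of_nonpos (le_of_lt hy.2) (G.pull_mem hy.1).1, G.sec_inr]
  · exfalso
    have h1 : G.collarInv (G.pull x) = G.proj (Sum.inr (G.pull x).1) := by
      rw [G.collarInv_of_nonpos h.le hp.1]
      have : G.pull x = G.η₂.toFun (G.pull x).1 := by
        rw [G.η₂_apply _ hp.1]
        exact Prod.ext rfl h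
      conv_lhs => rw [this, G.η₂.left_inv _ (G.C₂_subset hp.1)]
    rw [h1] at hxs
    have h2 : Sum.inr (G.pull x).1 ∈ G.proj ⁻¹' (G.proj '' G.awayFromGluing) := hxs
    rw [G.preimage_image_away, G.inr_mem_away] at h2
    exact h2 hp.1
  · have hV : G.innerCollar ∩ {y | 0 < (G.pull y).2} ∈ 𝓝 x :=
      Filter.inter_mem hW (continuousAt_const.eventually_lt hcont h)
    have hs : ContMDiffOn (𝓡∂ n) (𝓡∂ n) ∞
        (fun y => (Sum.inl (G.η₁.invFun (G.α.invFun (G.pull y).1, (G.pull y).2)) : M₁ ⊕ M₂))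
        (G.innerCollar ∩ {y | 0 < (G.pull y).2}) :=
      ContMDiff.inl.comp_contMDiffOn (G.contMDiffOn_collarInv_inl.comp
        (G.contMDiffOn_pull.mono fun y hy => hy.1.1)
        (fun y hy => ⟨(G.pull_mem hy.1).1, le_of_lt hy.2, (G.pull_mem hy.1).2.2⟩))
    refine (hs.congr ?_).contMDiffAt hV
    intro y hy
    change G.sec (G.collarInv (G.pull y)) = _
    have hm : (G.α.invFun (G.pull y).1, (G.pull y).2) ∈ G.C₁ ×ˢ Ico (0 : ℝ) 1 :=
      ⟨G.α.mapsTo_inv (G.pull_mem hy.1).1, le_of_lt hy.2, (G.pull_mem hy.1).2.2⟩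
    rw [G.collarInv_of_nonneg (le_of_lt hy.2), G.sec_inl]
    rw [G.mem_C₁_iff (G.η₁.mapsTo_inv hm), G.η₁.right_inv _ hm]
    exact ne_of_gt hy.2

/-- The smooth structure of the glued space exists. -/
theorem exists_isGluedStructure (G : GluingData n M₁ M₂) :
    ∃ cs : ChartedSpace (EuclideanHalfSpace n) G.Glued, G.IsGluedStructure cs := by
  obtain ⟨cs, hm, h⟩ := exists_smoothStructure_of_cover (n := n) {G.awayChart, G.collarChart}
    (by
      intro p
      by_cases hp : p ∈ G.collarSet
      · exact ⟨G.collarChart, by simp, hp⟩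
      · refine ⟨G.awayChart, by simp, G.sec p, ?_, G.proj_sec p⟩
        rw [← G.proj_sec p] at hp
        generalize G.sec p = q at hp
        obtain x | x := q
        · exact G.inl_mem_away.2 fun hx => hp (G.inl_mem_collarSet.2 (G.C₁_subset hx))
        · exact G.inr_mem_away.2 fun hx => hp (G.inr_mem_collarSet.2 (G.C₂_subset hx)))
    (by
      have hself (p : OpenPartialHomeomorph G.Glued (M₁ ⊕ M₂)) :
          ContMDiffOn (𝓡∂ n) (𝓡∂ n) ∞ (p ∘ p.symm) (p.symm ≫ₕ p).source :=
        contMDiffOn_id.congr fun x hx => p.right_inv hx.1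
      rintro p (rfl | rfl) q (rfl | rfl)
      · exact hself _
      · exact G.contMDiffOn_away_collar.mono fun x hx => hx.2
      · exact G.contMDiffOn_collar_away
      · exact hself _)
  obtain ⟨hA1, hA2⟩ := h G.awayChart (by simp)
  obtain ⟨hC1, hC2⟩ := h G.collarChart (by simp)
  refine ⟨cs, hm, fun x => ?_, fun x => ?_, ?_⟩
  · have hinj (y : M₁) (hy : y ∈ G.C₁ᶜ) : Sum.elim id G.α.invFun (G.sec (G.proj (Sum.inl y))) = y := by
      rw [G.sec_inl hy]
      rfl
    refine ⟨{ toFun := fun y => G.proj (Sum.inl y)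
              invFun := fun p => Sum.elim id G.α.invFun (G.sec p)
              source := G.C₁ᶜ
              target := G.awayChart.symm '' (Sum.inl '' G.C₁ᶜ)
              map_source' := fun y hy => ⟨_, ⟨y, hy, rfl⟩, rfl⟩
              map_target' := by
                rintro _ ⟨_, ⟨y, hy, rfl⟩, rfl⟩
                exact (hinj y hy).symm ▸ hy
              left_inv' := hinj
              right_inv' := by
                rintro _ ⟨_, ⟨y, hy, rfl⟩, rfl⟩
                exact congrArg (fun z => G.proj (Sum.inl z)) (hinj y hy)
              open_source := G.isUnion₁.isClosed.isOpen_compl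
              open_target := ?_
              contMDiffOn_toFun := ?_
              contMDiffOn_invFun := ?_ }, x.2, fun _ _ => rfl⟩
    · exact G.awayChart.symm.isOpen_image_of_subset_source
        (isOpenMap_inl _ G.isUnion₁.isClosed.isOpen_compl)
        (by rintro _ ⟨y, hy, rfl⟩; exact G.inl_mem_away.2 hy)
    · exact hA2.comp ContMDiff.inl.contMDiffOn fun y hy => G.inl_mem_away.2 hy
    · rintro _ ⟨_, ⟨y, hy, rfl⟩, rfl⟩
      refine ContMDiffAt.contMDiffWithinAt ?_
      have h1 : ContMDiffAt (𝓡∂ n) (𝓡∂ n) ∞ G.awayChart (G.proj (Sum.inl y)) :=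
        hA1.contMDiffAt (G.awayChart.open_source.mem_nhds ⟨_, G.inl_mem_away.2 hy, rfl⟩)
      have h2 : ContMDiffAt (𝓡∂ n) (𝓡∂ n) ∞ (Sum.elim id G.α.invFun)
          (G.awayChart (G.proj (Sum.inl y))) := by
        have : G.awayChart (G.proj (Sum.inl y)) = Sum.inl y := G.sec_inl hy
        rw [this]
        exact contMDiffAt_inl contMDiffAt_id
      exact ContMDiffAt.comp _ h2 h1
  · have hinj (y : M₂) : Sum.elim G.α.toFun id (G.sec (G.proj (Sum.inr y))) = y := rfl
    refine ⟨{ toFun := fun y => G.proj (Sum.inr y)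
              invFun := fun p => Sum.elim G.α.toFun id (G.sec p)
              source := G.C₂ᶜ
              target := G.awayChart.symm '' (Sum.inr '' G.C₂ᶜ)
              map_source' := fun y hy => ⟨_, ⟨y, hy, rfl⟩, rfl⟩
              map_target' := by
                rintro _ ⟨_, ⟨y, hy, rfl⟩, rfl⟩
                exact hy
              left_inv' := fun y _ => hinj y
              right_inv' := by
                rintro _ ⟨_, ⟨y, hy, rfl⟩, rfl⟩
                rfl
              open_source := G.isUnion₂.isClosed.isOpen_compl
              open_target := ?_
              contMDiffOn_toFun := ?_
              contMDiffOn_invFun := ?_ }, x.2, fun _ _ => rfl⟩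
    · exact G.awayChart.symm.isOpen_image_of_subset_source
        (isOpenMap_inr _ G.isUnion₂.isClosed.isOpen_compl)
        (by rintro _ ⟨y, hy, rfl⟩; exact G.inr_mem_away.2 hy)
    · exact hA2.comp ContMDiff.inr.contMDiffOn fun y hy => G.inr_mem_away.2 hy
    · rintro _ ⟨_, ⟨y, hy, rfl⟩, rfl⟩
      refine ContMDiffAt.contMDiffWithinAt ?_
      have h1 : ContMDiffAt (𝓡∂ n) (𝓡∂ n) ∞ G.awayChart (G.proj (Sum.inr y)) :=
        hA1.contMDiffAt (G.awayChart.open_source.mem_nhds ⟨_, G.inr_mem_away.2 hy, rfl⟩)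
      have h2 : ContMDiffAt (𝓡∂ n) (𝓡∂ n) ∞ (Sum.elim G.α.toFun id)
          (G.awayChart (G.proj (Sum.inr y))) := contMDiffAt_inr contMDiffAt_id
      exact ContMDiffAt.comp _ h2 h1
  · refine ⟨{ toFun := G.collarMap
              invFun := G.collarInv
              mapsTo := fun _ hp => G.collarEquiv.map_source hp
              mapsTo_inv := fun _ hz => G.collarEquiv.map_target hz
              left_inv := fun _ hp => G.collarEquiv.left_inv hp
              right_inv := fun _ hz => G.collarEquiv.right_inv hz
              contMDiffOn_toFun := ?_
              contMDiffOn_invFun := ?_ }, fun _ _ => rfl⟩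
    · have h2 : ContMDiffOn (𝓡∂ n) (𝓡∂ n) ∞ (Sum.elim G.α.toFun id : M₁ ⊕ M₂ → M₂)
          (Sum.inr '' G.innerCollar) := by
        rintro _ ⟨y, hy, rfl⟩
        exact (contMDiffAt_inr contMDiffAt_id).contMDiffWithinAt
      refine ((G.contMDiffOn_pull.comp h2 ?_).comp hC1 ?_).congr ?_
      · rintro _ ⟨y, hy, rfl⟩
        exact hy.1
      · exact fun p hp => G.collarChart.map_source hp
      · exact fun p hp => (G.pull_push (G.collarEquiv.map_source hp)).symm
    · refine (hC2.comp (ContMDiff.inr.comp_contMDiffOn G.contMDiffOn_push) ?_).congr ?_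
      · exact fun z hz => ⟨_, G.push_mem hz, rfl⟩
      · exact fun z hz => congrArg G.collarInv (G.pull_push hz).symm

/-- The glued space `N` as a smooth manifold: its charts. -/
noncomputable instance instChartedSpaceGlued (G : GluingData n M₁ M₂) :
    ChartedSpace (EuclideanHalfSpace n) G.Glued :=
  G.exists_isGluedStructure.choose

theorem isGluedStructure (G : GluingData n M₁ M₂) :
    G.IsGluedStructure G.instChartedSpaceGlued :=
  G.exists_isGluedStructure.choose_spec

instance instIsManifoldGlued (G : GluingData n M₁ M₂) : IsManifold (𝓡∂ n) ∞ G.Glued :=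
  G.isGluedStructure.isManifold

end

/-- The set `𝒜` of pairs of homeomorphisms that agree on the glued boundaries. -/
structure IsCompatible (G : GluingData n M₁ M₂) (f₁ : M₁ ≃ₜ M₁) (f₂ : M₂ ≃ₜ M₂) : Prop where
  image_C₁ : f₁ '' G.C₁ = G.C₁
  comm : ∀ x ∈ G.C₁, G.α.toFun (f₁ x) = f₂ (G.α.toFun x)

/-- The glued map `𝔤(f₁, f₂) : N → N`. -/
def gluedMap (G : GluingData n M₁ M₂) (f₁ : M₁ ≃ₜ M₁) (f₂ : M₂ ≃ₜ M₂)
    (h : G.IsCompatible f₁ f₂) : G.Glued → G.Glued :=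
  Quot.map (Sum.map f₁ f₂) <| by
    rintro _ _ ⟨x, hx⟩
    have := Rel.glue (G := G) (f₁ x) (h.image_C₁ ▸ mem_image_of_mem f₁ hx)
    rwa [h.comm x hx] at this

/-- `Ψ₁` is the crushing map `(x, y) ↦ (x, φ (φ y))` in the collar coordinates `η₁`, near `C₁`,
where `φ y = exp (-1 / y)` and `φ 0 = 0`. -/
def IsCrushing₁ (G : GluingData n M₁ M₂) (Ψ₁ : M₁ ≃ₜ M₁) : Prop :=
  ∃ V : Set M₁, IsOpen V ∧ G.C₁ ⊆ V ∧ V ⊆ G.U₁ ∧ ∀ x ∈ V, Ψ₁ x ∈ G.U₁ ∧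
    G.η₁.toFun (Ψ₁ x) =
      ((G.η₁.toFun x).1, expNegInvGlue (expNegInvGlue (G.η₁.toFun x).2))

/-- `Ψ₂` is the crushing map `(x, y) ↦ (x, -φ (φ (-y)))` in the collar coordinates `η₂`, near `C₂`
(the collar of `C₂` is `C₂ × (-1, 0]`). -/
def IsCrushing₂ (G : GluingData n M₁ M₂) (Ψ₂ : M₂ ≃ₜ M₂) : Prop :=
  ∃ V : Set M₂, IsOpen V ∧ G.C₂ ⊆ V ∧ V ⊆ G.U₂ ∧ ∀ x ∈ V, Ψ₂ x ∈ G.U₂ ∧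
    G.η₂.toFun (Ψ₂ x) =
      ((G.η₂.toFun x).1, -expNegInvGlue (expNegInvGlue (-(G.η₂.toFun x).2)))

end

end GluingData

/-- The conjugate `Ψ⁻¹ f Ψ` of a homeomorphism. -/
def conjHomeo {X : Type*} [TopologicalSpace X] (Ψ f : X ≃ₜ X) : X ≃ₜ X :=
  (Ψ.trans f).trans Ψ.symm

/-- A self-map of a smooth `n`-manifold with boundary is a `C^∞` diffeomorphism. -/
def IsSmoothDiffeo (n : ℕ) [NeZero n] {X : Type*} [TopologicalSpace X]
    [ChartedSpace (EuclideanHalfSpace n) X] (f : X → X) : Prop :=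
  ∃ F : X ≃ₘ⟮𝓡∂ n, 𝓡∂ n⟯ X, ⇑F = f

/-! In collar coordinates a diffeomorphism `f` that preserves `C` is (x, y) ↦ (r(x, y), h(x, y))
with h(x, 0) = 0, so by Hadamard's lemma h = y·g with g > 0. Conjugation by (x, y) ↦ (x, φ(φ(y)))
turns the tangential component into r(x, φ(φ(y))), which equals r(x, 0) to infinite order at y = 0.
The normal component becomes the solution R of φ(φ(R)) = φ(φ(y))·g, where g is taken at (x,
φ(φ(y))). Two logarithms give R = y / (1 + y log(1 − φ(y) log g)), and since φ is flat at 0, R = y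
to infinite order. A single φ would give y / (1 − y log g), in general tangent to the identity only
to first order.

Hence the conjugate is smooth, and its extension across `C` by the product of the restriction of `f`
with the identity is smooth too. For a compatible pair these products correspond under `α`, so the
glued map is smooth.

Property 2 concerns every diffeomorphism of `M`, and such a map may carry `C` to other boundary
components. The crushing therefore takes place near the whole orbit `diffeoOrbit n C`, in a collar
transported from that of `C` by one diffeomorphism per component. Every diffeomorphism preserves the
orbit.

The division is `exists_eq_crush_mul`, and the formula for R is `crushSolve`. The homeomorphism
comes from `BoundaryCollar.exists_isCrushing`, the collar of the orbit from
`IsUnionOfBoundaryComponents.exists_collar_diffeoOrbit`, and the two-sided extension from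
`BoundaryCollar.IsCrushing.exists_conj_extension`. `GluingData.exists_gluedMap_collarInv` combines
the two sides. -/

/-! ### The crushing profile on the line. -/

/-- The crushing profile `φ ∘ φ`, where `φ y = exp (-1 / y)` for `y > 0` and `φ y = 0` otherwise. -/
noncomputable def crush (y : ℝ) : ℝ := expNegInvGlue (expNegInvGlue y)

theorem contDiff_crush : ContDiff ℝ ∞ crush :=
  expNegInvGlue.contDiff.comp expNegInvGlue.contDiff

theorem continuous_crush : Continuous crush := contDiff_crush.continuous

theorem crush_of_nonpos {y : ℝ} (hy : y ≤ 0) : crush y = 0 := by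
  simp [crush, expNegInvGlue.zero_of_nonpos hy]

theorem crush_zero : crush 0 = 0 := crush_of_nonpos le_rfl

theorem crush_nonneg (y : ℝ) : 0 ≤ crush y := expNegInvGlue.nonneg _

theorem crush_pos {y : ℝ} (hy : 0 < y) : 0 < crush y :=
  expNegInvGlue.pos_of_pos (expNegInvGlue.pos_of_pos hy)

theorem expNegInvGlue_of_pos {y : ℝ} (hy : 0 < y) : expNegInvGlue y = Real.exp (-y⁻¹) := by
  simp [expNegInvGlue, not_le.2 hy]

/-- Equivalent to 1/y ≤ exp(1/y). The resulting bound `crush y ≤ y` makes the interpolation between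
`crush` and the identity increasing, and keeps heights inside the collar. -/
theorem expNegInvGlue_le_self {y : ℝ} (hy : 0 ≤ y) : expNegInvGlue y ≤ y := by
  obtain rfl | hy := hy.eq_or_lt
  · simp [expNegInvGlue.zero]
  · rw [expNegInvGlue_of_pos hy, Real.exp_neg]
    have h1 : y⁻¹ ≤ Real.exp y⁻¹ := by linarith [Real.add_one_le_exp y⁻¹]
    exact inv_le_of_inv_le₀ hy h1

theorem crush_le_self {y : ℝ} (hy : 0 ≤ y) : crush y ≤ y :=
  (expNegInvGlue_le_self (expNegInvGlue.nonneg _)).trans (expNegInvGlue_le_self hy)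

theorem deriv_expNegInvGlue_pos {y : ℝ} (hy : 0 < y) : 0 < deriv expNegInvGlue y := by
  have h1 : HasDerivAt (fun x : ℝ => Real.exp (-x⁻¹)) (Real.exp (-y⁻¹) * (-(-(y ^ 2)⁻¹))) y :=
    ((hasDerivAt_inv hy.ne').neg).exp
  have h2 : expNegInvGlue =ᶠ[𝓝 y] fun x : ℝ => Real.exp (-x⁻¹) := by
    filter_upwards [lt_mem_nhds hy] with x hx using expNegInvGlue_of_pos hx
  rw [h2.deriv_eq, h1.deriv]
  have := Real.exp_pos (-y⁻¹)
  rw [neg_neg]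
  positivity

theorem differentiable_expNegInvGlue : Differentiable ℝ expNegInvGlue :=
  (expNegInvGlue.contDiff (n := 1)).differentiable (by simp)

theorem differentiable_crush : Differentiable ℝ crush :=
  differentiable_expNegInvGlue.comp differentiable_expNegInvGlue

theorem deriv_crush_pos {y : ℝ} (hy : 0 < y) : 0 < deriv crush y := by
  have h : HasDerivAt crush (deriv expNegInvGlue (expNegInvGlue y) * deriv expNegInvGlue y) y :=
    HasDerivAt.comp y (differentiable_expNegInvGlue _).hasDerivAt
      (differentiable_expNegInvGlue _).hasDerivAt
  rw [h.deriv]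
  exact mul_pos (deriv_expNegInvGlue_pos (expNegInvGlue.pos_of_pos hy)) (deriv_expNegInvGlue_pos hy)

/-! ### Cutting the profile off to the identity, and its inverse. -/

/-- A function which is `crush` for `y ≤ δ / 2` and the identity for `y ≥ δ`. -/
noncomputable def cutCrush (δ y : ℝ) : ℝ :=
  crush y + Real.smoothTransition (2 * (y / δ) - 1) * (y - crush y)

section

variable {δ y : ℝ}

theorem cutCrush_of_le_half (hδ : 0 < δ) (hy : y ≤ δ / 2) : cutCrush δ y = crush y := by
  have : y / δ ≤ 1 / 2 := by rw [div_le_iff₀ hδ]; linarith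
  rw [cutCrush, Real.smoothTransition.zero_of_nonpos (by linarith)]
  ring

theorem cutCrush_of_ge (hδ : 0 < δ) (hy : δ ≤ y) : cutCrush δ y = y := by
  have : 1 ≤ y / δ := (one_le_div hδ).2 hy
  rw [cutCrush, Real.smoothTransition.one_of_one_le (by linarith)]
  ring

theorem cutCrush_zero : cutCrush δ 0 = 0 := by simp [cutCrush, crush_zero]

/-- Joint smoothness in (δ, y) matters because the width δ of the crushed region varies along the
boundary. -/
theorem contDiffAt_cutCrush (hδ : 0 < δ) (y : ℝ) :
    ContDiffAt ℝ ∞ (fun p : ℝ × ℝ => cutCrush p.1 p.2) (δ, y) := by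
  have h1 : ContDiffAt ℝ ∞ (fun p : ℝ × ℝ => 2 * (p.2 / p.1) - 1) (δ, y) :=
    (contDiffAt_const.mul (contDiffAt_snd.div contDiffAt_fst hδ.ne')).sub contDiffAt_const
  have h2 : ContDiffAt ℝ ∞ (fun p : ℝ × ℝ => crush p.2) (δ, y) :=
    contDiff_crush.contDiffAt.comp (δ, y) contDiffAt_snd
  exact h2.add ((Real.smoothTransition.contDiffAt.comp (δ, y) h1).mul (contDiffAt_snd.sub h2))

theorem contDiff_cutCrush_right (hδ : 0 < δ) : ContDiff ℝ ∞ (cutCrush δ) :=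
  contDiff_iff_contDiffAt.2 fun y =>
    (contDiffAt_cutCrush hδ y).comp y (contDiffAt_const.prodMk contDiffAt_id)

/-- With s the value of the cut-off, the derivative is (1 − s)·crush′(y) + s, a convex combination
of positive numbers, plus a multiple of y − crush y ≥ 0 whose coefficient is nonnegative because the
cut-off increases. -/
theorem deriv_cutCrush_pos (hδ : 0 < δ) (hy : 0 < y) : 0 < deriv (cutCrush δ) y := by
  set s := Real.smoothTransition (2 * (y / δ) - 1) with hs
  set s' := deriv Real.smoothTransition (2 * (y / δ) - 1) with hs'
  have hsT : HasDerivAt Real.smoothTransition s' (2 * (y / δ) - 1) :=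
    ((Real.smoothTransition.contDiff (n := 1)).differentiable (by simp) _).hasDerivAt
  have hin : HasDerivAt (fun y : ℝ => 2 * (y / δ) - 1) (2 * (1 / δ)) y :=
    (((hasDerivAt_id y).div_const δ).const_mul 2).sub_const 1
  have hm : HasDerivAt (fun y : ℝ => Real.smoothTransition (2 * (y / δ) - 1)) (s' * (2 * (1 / δ))) y :=
    HasDerivAt.comp (h₂ := Real.smoothTransition) y hsT hin
  have hc := (differentiable_crush y).hasDerivAt
  have h : HasDerivAt (cutCrush δ) (deriv crush y + (s' * (2 * (1 / δ)) * (y - crush y) +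
      s * (1 - deriv crush y))) y :=
    hc.fun_add (hm.fun_mul ((hasDerivAt_id' y).fun_sub hc))
  rw [h.deriv]
  have h1 : 0 ≤ s' := Real.smoothTransition.monotone.deriv_nonneg
  have h2 : 0 ≤ s := Real.smoothTransition.nonneg _
  have h3 : s ≤ 1 := Real.smoothTransition.le_one _
  have h4 := deriv_crush_pos hy
  have h5 := crush_le_self hy.le
  have h6 : 0 ≤ s' * (2 * (1 / δ)) * (y - crush y) :=
    mul_nonneg (mul_nonneg h1 (by positivity)) (by linarith)
  have h7 : 0 < deriv crush y * (1 - s) + s := by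
    obtain h | h := h2.eq_or_lt
    · rw [← h]; linarith
    · have := mul_nonneg h4.le (sub_nonneg.2 h3); linarith
  linarith

theorem strictMonoOn_cutCrush (hδ : 0 < δ) : StrictMonoOn (cutCrush δ) (Ici 0) :=
  strictMonoOn_of_deriv_pos (convex_Ici 0) (contDiff_cutCrush_right hδ).continuous.continuousOn
    fun y hy => deriv_cutCrush_pos hδ (by simpa using hy)

theorem cutCrush_nonneg (hδ : 0 < δ) (hy : 0 ≤ y) : 0 ≤ cutCrush δ y := by
  simpa [cutCrush_zero] using (strictMonoOn_cutCrush hδ).monotoneOn (mem_Ici.2 le_rfl) hy hy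

theorem cutCrush_le_iff (hδ : 0 < δ) (hy : 0 ≤ y) : cutCrush δ y ≤ δ ↔ y ≤ δ := by
  have := (strictMonoOn_cutCrush hδ).le_iff_le hy (mem_Ici.2 hδ.le)
  rwa [cutCrush_of_ge hδ le_rfl] at this

theorem exists_cutCrush_eq (hδ : 0 < δ) {z : ℝ} (hz : 0 ≤ z) : ∃ y ∈ Ici (0 : ℝ), cutCrush δ y = z := by
  have h1 : z ∈ Icc (cutCrush δ 0) (cutCrush δ (max δ z)) := by
    rw [cutCrush_zero, cutCrush_of_ge hδ (le_max_left _ _)]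
    exact ⟨hz, le_max_right _ _⟩
  obtain ⟨y, hy, h⟩ := intermediate_value_Icc (hδ.le.trans (le_max_left δ z))
    (contDiff_cutCrush_right hδ).continuous.continuousOn h1
  exact ⟨y, hy.1, h⟩

/-- The inverse of `cutCrush δ` on `[0, ∞)`. -/
noncomputable def cutCrushInv (δ : ℝ) : ℝ → ℝ := Function.invFunOn (cutCrush δ) (Ici 0)

variable {z : ℝ}

theorem cutCrushInv_nonneg (hδ : 0 < δ) (hz : 0 ≤ z) : 0 ≤ cutCrushInv δ z :=
  Function.invFunOn_mem (exists_cutCrush_eq hδ hz)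

theorem cutCrush_cutCrushInv (hδ : 0 < δ) (hz : 0 ≤ z) : cutCrush δ (cutCrushInv δ z) = z :=
  Function.invFunOn_eq (exists_cutCrush_eq hδ hz)

theorem cutCrushInv_cutCrush (hδ : 0 < δ) (hy : 0 ≤ y) : cutCrushInv δ (cutCrush δ y) = y :=
  (strictMonoOn_cutCrush hδ).injOn (cutCrushInv_nonneg hδ (cutCrush_nonneg hδ hy)) hy
    (cutCrush_cutCrushInv hδ (cutCrush_nonneg hδ hy))

theorem cutCrushInv_zero (hδ : 0 < δ) : cutCrushInv δ 0 = 0 := by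
  have := cutCrushInv_cutCrush hδ (le_refl (0 : ℝ))
  rwa [cutCrush_zero] at this

theorem cutCrushInv_of_ge (hδ : 0 < δ) (hz : δ ≤ z) : cutCrushInv δ z = z := by
  have := cutCrushInv_cutCrush hδ (hδ.le.trans hz)
  rwa [cutCrush_of_ge hδ hz] at this

theorem cutCrushInv_le_iff (hδ : 0 < δ) (hz : 0 ≤ z) : cutCrushInv δ z ≤ δ ↔ z ≤ δ := by
  rw [← cutCrush_le_iff hδ (cutCrushInv_nonneg hδ hz), cutCrush_cutCrushInv hδ hz]

theorem cutCrushInv_pos (hδ : 0 < δ) (hz : 0 < z) : 0 < cutCrushInv δ z := by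
  refine (cutCrushInv_nonneg hδ hz.le).lt_of_ne fun h => ?_
  have := cutCrush_cutCrushInv hδ hz.le
  rw [← h, cutCrush_zero] at this
  exact hz.ne this

/-- The inverse function theorem for (δ, y) ↦ (δ, cutCrush δ y), whose derivative is triangular with
diagonal entries 1 and `deriv (cutCrush δ) y` > 0. Keeping δ as a coordinate yields smoothness in
both variables. The local inverse agrees with `cutCrushInv` because `cutCrush δ` is injective on [0,
∞). -/
theorem contDiffAt_cutCrushInv (hδ : 0 < δ) (hz : 0 < z) :
    ContDiffAt ℝ ∞ (fun p : ℝ × ℝ => cutCrushInv p.1 p.2) (δ, z) := by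
  set y := cutCrushInv δ z with hy
  have hy0 : 0 < y := cutCrushInv_pos hδ hz
  set Φ : ℝ × ℝ → ℝ × ℝ := fun p => (p.1, cutCrush p.1 p.2) with hΦ
  have hK := contDiffAt_cutCrush hδ y
  have hΦs : ContDiffAt ℝ ∞ Φ (δ, y) := contDiffAt_fst.prodMk hK
  have hKd := (hK.differentiableAt (by simp)).hasFDerivAt
  set A := fderiv ℝ (fun p : ℝ × ℝ => cutCrush p.1 p.2) (δ, y) with hA
  have hΦd : HasFDerivAt Φ ((ContinuousLinearMap.fst ℝ ℝ ℝ).prod A) (δ, y) :=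
    hasFDerivAt_fst.prodMk hKd
  have hA1 : A (0, 1) = deriv (cutCrush δ) y := by
    have h1 : HasDerivAt (fun t : ℝ => ((δ, t) : ℝ × ℝ)) (0, 1) y :=
      (hasDerivAt_const y δ).prodMk (hasDerivAt_id y)
    exact (HasFDerivAt.comp_hasDerivAt y hKd h1).deriv.symm
  have hA0 : A (0, 1) ≠ 0 := by rw [hA1]; exact (deriv_cutCrush_pos hδ hy0).ne'
  have hinj : Function.Injective ((ContinuousLinearMap.fst ℝ ℝ ℝ).prod A) := by
    rw [injective_iff_map_eq_zero]
    rintro ⟨a, b⟩ h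
    simp only [ContinuousLinearMap.prod_apply, ContinuousLinearMap.coe_fst', Prod.mk_eq_zero] at h
    obtain ⟨rfl, h⟩ := h
    have h2 : ((0 : ℝ), b) = b • ((0 : ℝ), (1 : ℝ)) := by simp
    rw [h2, map_smul, smul_eq_mul, mul_eq_zero] at h
    simp [h.resolve_right hA0]
  let e : (ℝ × ℝ) ≃L[ℝ] (ℝ × ℝ) := ContinuousLinearEquiv.ofBijective
    ((ContinuousLinearMap.fst ℝ ℝ ℝ).prod A) (LinearMap.ker_eq_bot.2 hinj)
    (LinearMap.range_eq_top.2 (LinearMap.surjective_of_injective (f := (((ContinuousLinearMap.fst ℝ ℝ ℝ).prod A : (ℝ × ℝ) →L[ℝ] (ℝ × ℝ)) : (ℝ × ℝ) →ₗ[ℝ] (ℝ × ℝ))) hinj))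
  have he : HasFDerivAt Φ (e : (ℝ × ℝ) →L[ℝ] (ℝ × ℝ)) (δ, y) := hΦd
  have hloc := hΦs.to_localInverse he (by simp)
  have hval : Φ (δ, y) = (δ, z) := by simp [hΦ, hy, cutCrush_cutCrushInv hδ hz.le]
  rw [hval] at hloc
  set g := hΦs.localInverse he (by simp) with hg
  have hg0 : g (δ, z) = (δ, y) := by
    rw [← hval]; exact hΦs.localInverse_apply_image he (by simp)
  have hright : ∀ᶠ q in 𝓝 (δ, z), Φ (g q) = q := by
    rw [← hval]
    exact (hΦs.hasStrictFDerivAt' he (by simp)).eventually_right_inverse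
  have hpos : ∀ᶠ q in 𝓝 (δ, z), 0 < (g q).1 ∧ 0 < (g q).2 := by
    have hc : ContinuousAt g (δ, z) := hloc.continuousAt
    refine hc.eventually (p := fun q => 0 < q.1 ∧ 0 < q.2) ?_
    rw [hg0]
    exact (continuousAt_fst.eventually (lt_mem_nhds hδ)).and (continuousAt_snd.eventually (lt_mem_nhds hy0))
  refine (contDiffAt_snd.comp _ hloc).congr_of_eventuallyEq ?_
  filter_upwards [hright, hpos] with q hq1 hq2
  have h1 : (g q).1 = q.1 := (Prod.ext_iff.1 hq1).1
  have h2 : cutCrush (g q).1 (g q).2 = q.2 := (Prod.ext_iff.1 hq1).2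
  rw [h1] at h2 hq2
  change cutCrushInv q.1 q.2 = (g q).2
  rw [← h2, cutCrushInv_cutCrush hq2.1 hq2.2.le]

/-- At z = 0 the derivative of the profile vanishes, so the inverse is only continuous there;
monotonicity suffices for this. -/
theorem continuousWithinAt_cutCrushInv (hδ : 0 < δ) (hz : 0 ≤ z) :
    ContinuousWithinAt (fun p : ℝ × ℝ => cutCrushInv p.1 p.2) (univ ×ˢ Ici 0) (δ, z) := by
  obtain rfl | hz := hz.eq_or_lt
  · rw [Metric.continuousWithinAt_iff']
    intro ε hε
    -- For widths above δ/2 the point η ≤ δ/4 lies where `cutCrush` is `crush`, so the threshold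
    -- `crush η` does not depend on the width.
    set η := min ε (δ / 4) with hη
    have hη0 : 0 < η := lt_min hε (by linarith)
    have h1 : ∀ᶠ p : ℝ × ℝ in 𝓝 (δ, 0), δ / 2 < p.1 ∧ p.2 < crush η :=
      (continuousAt_fst.eventually (lt_mem_nhds (show δ / 2 < δ by linarith))).and
        (continuousAt_snd.eventually (gt_mem_nhds (crush_pos hη0)))
    filter_upwards [nhdsWithin_le_nhds h1, self_mem_nhdsWithin] with p hp1 hp2
    have hp0 : 0 < p.1 := by linarith [hp1.1]
    have hp3 : (0 : ℝ) ≤ p.2 := hp2.2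
    have h2 := cutCrushInv_nonneg hp0 hp3
    rw [cutCrushInv_zero hδ, dist_zero_right, Real.norm_of_nonneg h2]
    refine lt_of_lt_of_le ?_ (min_le_left ε (δ / 4))
    rw [← (strictMonoOn_cutCrush hp0).lt_iff_lt h2 (mem_Ici.2 hη0.le), cutCrush_cutCrushInv hp0 hp3,
      cutCrush_of_le_half hp0 (by linarith [min_le_right ε (δ / 4)])]
    exact hp1.2
  · exact (contDiffAt_cutCrushInv hδ hz).continuousAt.continuousWithinAt

end

/-! ### Hadamard division after the substitution z = crush y. -/

theorem deriv_smoothTransition_of_notMem {s : ℝ} (hs : s ∉ Icc (0 : ℝ) 1) :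
    deriv Real.smoothTransition s = 0 := by
  rw [mem_Icc, not_and_or, not_le, not_le] at hs
  obtain hs | hs := hs
  · have : Real.smoothTransition =ᶠ[𝓝 s] fun _ => 0 := by
      filter_upwards [gt_mem_nhds hs] with x hx using Real.smoothTransition.zero_of_nonpos hx.le
    rw [this.deriv_eq, deriv_const]
  · have : Real.smoothTransition =ᶠ[𝓝 s] fun _ => 1 := by
      filter_upwards [lt_mem_nhds hs] with x hx using Real.smoothTransition.one_of_one_le hx.le
    rw [this.deriv_eq, deriv_const]

/-- The path from 0 to `crush y` stays in the one-sided domain of the function to be divided, for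
every y < ε including negative ones. -/
theorem smoothTransition_mul_crush_mem {ε y : ℝ} (hε : 0 < ε) (hy : y < ε) (s : ℝ) :
    Real.smoothTransition s * crush y ∈ Ico 0 ε := by
  have h1 := Real.smoothTransition.nonneg s
  have h2 := crush_nonneg y
  refine ⟨mul_nonneg h1 h2, ?_⟩
  have h3 : Real.smoothTransition s * crush y ≤ crush y :=
    mul_le_of_le_one_left h2 (Real.smoothTransition.le_one s)
  obtain h | h := le_total y 0
  · rw [crush_of_nonpos h] at h3 ⊢; linarith
  · linarith [crush_le_self h]

open MeasureTheory in
/-- A version of the Hadamard lemma: a function which is smooth on a one-sided neighbourhood of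
`{z = 0}` and vanishes for `z = 0` becomes divisible by `crush y` after the substitution
`z = crush y`, with a quotient which is smooth on both sides. -/
theorem exists_eq_crush_mul {E : Type*} [NormedAddCommGroup E] [NormedSpace ℝ E]
    {B : Set E} (hB : IsOpen B) {ε : ℝ} (hε : 0 < ε) {H : E × ℝ → ℝ}
    (hH : ContDiffOn ℝ ∞ H (B ×ˢ Ico 0 ε)) (h0 : ∀ u ∈ B, H (u, 0) = 0) :
    ∃ g : E × ℝ → ℝ, ContDiffOn ℝ ∞ g (B ×ˢ Iio ε) ∧
      ∀ u ∈ B, ∀ y < ε, H (u, crush y) = crush y * g (u, y) := by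
  set T : Set (E × ℝ) := B ×ˢ Ico 0 ε with hTdef
  have hT : UniqueDiffOn ℝ T := hB.uniqueDiffOn.prod (uniqueDiffOn_Ico 0 ε)
  set D : E × ℝ → ℝ := fun p => fderivWithin ℝ H T p (0, 1) with hD
  have hDs : ContDiffOn ℝ ∞ D T :=
    (hH.fderivWithin hT (m := ∞) (by simp)).clm_apply contDiffOn_const
  have hsT : ContDiff ℝ ∞ Real.smoothTransition := Real.smoothTransition.contDiff
  have hsT' : ContDiff ℝ ∞ (deriv Real.smoothTransition) :=
    (contDiff_infty_iff_deriv.1 hsT).2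
  -- The path from 0 to `crush y` is parametrized by `Real.smoothTransition s` instead of s. Then
  -- `crush y * q (u, y) s` is the derivative of H along the path, and q is smooth in s on the whole
  -- line and vanishes outside [0, 1].
  set q : E × ℝ → ℝ → ℝ := fun p s =>
    D (p.1, Real.smoothTransition s * crush p.2) * deriv Real.smoothTransition s with hq
  have hqs : ContDiffOn ℝ ∞ (↿q) ((B ×ˢ Iio ε) ×ˢ univ) := by
    have h1 : ContDiff ℝ ∞ fun r : (E × ℝ) × ℝ =>
        (r.1.1, Real.smoothTransition r.2 * crush r.1.2) :=
      contDiff_fst.fst.prodMk ((hsT.comp contDiff_snd).mul (contDiff_crush.comp contDiff_fst.snd))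
    refine ContDiffOn.mul (hDs.comp h1.contDiffOn ?_) (hsT'.comp contDiff_snd).contDiffOn
    rintro ⟨⟨u, y⟩, s⟩ ⟨⟨hu, hy⟩, -⟩
    exact ⟨hu, smoothTransition_mul_crush_mem hε hy s⟩
  have hqz (p : E × ℝ) (s : ℝ) (hs : s ∉ Icc (0 : ℝ) 1) : q p s = 0 := by
    simp [hq, deriv_smoothTransition_of_notMem hs]
  refine ⟨fun p => ∫ s, q p s, ?_, ?_⟩
  -- The integral is the value at 0 of the convolution of the constant 1 with `q p`, whose support
  -- lies in [0, 1]; such a convolution depends smoothly on the parameter p.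
  · have h1 := contDiffOn_convolution_right_with_param_comp (μ := volume) (n := (⊤ : ℕ∞))
      (ContinuousLinearMap.mul ℝ ℝ) (v := fun _ : E × ℝ => (0 : ℝ)) contDiffOn_const
      (f := fun _ : ℝ => (1 : ℝ)) (hB.prod isOpen_Iio) isCompact_Icc
      (fun p s _ hs => hqz p s hs) (locallyIntegrable_const 1) hqs
    refine h1.congr fun p _ => ?_
    simp only [MeasureTheory.convolution, ContinuousLinearMap.mul_apply', one_mul, zero_sub]
    exact (integral_neg_eq_self (q p) volume).symm
  · intro u hu y hy
    have hF (s : ℝ) : HasDerivAt (fun s => H (u, Real.smoothTransition s * crush y))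
        (crush y * q (u, y) s) s := by
      have hm : (u, Real.smoothTransition s * crush y) ∈ T :=
        ⟨hu, smoothTransition_mul_crush_mem hε hy s⟩
      have h1 := ((hH.differentiableOn (by simp)) _ hm).hasFDerivWithinAt
      have h2 : HasDerivAt (fun s => (u, Real.smoothTransition s * crush y))
          ((0 : E), deriv Real.smoothTransition s * crush y) s :=
        (hasDerivAt_const s u).prodMk
          (((hsT.differentiable (by simp)) s).hasDerivAt.mul_const _)
      have hmaps : MapsTo (fun s => (u, Real.smoothTransition s * crush y)) univ T :=
        fun t _ => ⟨hu, smoothTransition_mul_crush_mem hε hy t⟩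
      have h3 := h1.comp_hasDerivWithinAt s (h2.hasDerivWithinAt (s := univ)) hmaps
      rw [hasDerivWithinAt_univ] at h3
      have h4 : ((0 : E), deriv Real.smoothTransition s * crush y) =
          (deriv Real.smoothTransition s * crush y) • ((0 : E), (1 : ℝ)) := by simp
      have h5 : crush y * q (u, y) s = fderivWithin ℝ H T (u, Real.smoothTransition s * crush y)
          (0, deriv Real.smoothTransition s * crush y) := by
        rw [h4, map_smul, smul_eq_mul]
        simp only [hq, hD]
        ring
      rw [h5]
      exact h3
    have hqc : Continuous (q (u, y)) := by
      have := hqs.continuousOn.comp_continuous (f := fun s : ℝ => ((u, y), s)) (by fun_prop)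
        (fun s => ⟨⟨hu, hy⟩, mem_univ s⟩)
      exact this
    have h1 := intervalIntegral.integral_eq_sub_of_hasDerivAt (a := 0) (b := 1)
      (fun s _ => hF s) ((continuous_const.mul hqc).intervalIntegrable 0 1)
    rw [Real.smoothTransition.one, Real.smoothTransition.zero, one_mul, zero_mul, h0 u hu,
      sub_zero, intervalIntegral.integral_const_mul] at h1
    rw [← h1, intervalIntegral.integral_of_le zero_le_one, ← integral_Icc_eq_integral_Ioc,
      setIntegral_eq_integral_of_forall_compl_eq_zero (hqz (u, y))]

/-! ### Solving for the normal component. -/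

/-- The solution `R` of `crush R = crush y * g`. -/
noncomputable def crushSolve (y g : ℝ) : ℝ :=
  y / (1 + y * Real.log (1 - expNegInvGlue y * Real.log g))

/-- Since φ vanishes on (−∞, 0], the logarithm in the denominator is log 1 = 0. The one formula thus
already contains the extension by the identity. -/
theorem crushSolve_of_nonpos {y : ℝ} (hy : y ≤ 0) (g : ℝ) : crushSolve y g = y := by
  simp [crushSolve, expNegInvGlue.zero_of_nonpos hy]

/-- At y = 0 both the argument of the outer logarithm and the denominator are equal to 1. -/
theorem contDiffAt_crushSolve {g : ℝ} (hg : 0 < g) :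
    ContDiffAt ℝ ∞ (fun p : ℝ × ℝ => crushSolve p.1 p.2) (0, g) := by
  have h1 : ContDiffAt ℝ ∞ (fun p : ℝ × ℝ => 1 - expNegInvGlue p.1 * Real.log p.2) (0, g) :=
    contDiffAt_const.sub ((expNegInvGlue.contDiff.contDiffAt.comp (0, g) contDiffAt_fst).mul
      (contDiffAt_snd.log hg.ne'))
  refine contDiffAt_fst.div (contDiffAt_const.add (contDiffAt_fst.mul (h1.log ?_))) ?_ <;>
    simp [expNegInvGlue.zero]

/-- Put a = 1 − φ(y) log g. Removing the outer exponential from the equation gives φ(R) = φ(y)/a,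
and removing the inner one gives 1/R = 1/y + log a. Near y = 0 both a and 1 + y log a are positive,
which legitimizes the logarithms. -/
theorem eventually_crushSolve {g : ℝ} (hg : 0 < g) :
    ∀ᶠ p : ℝ × ℝ in 𝓝 (0, g), 0 ≤ p.1 → 0 ≤ crushSolve p.1 p.2 ∧
      crush (crushSolve p.1 p.2) = crush p.1 * p.2 := by
  have h1 : ContinuousAt (fun p : ℝ × ℝ => 1 - expNegInvGlue p.1 * Real.log p.2) (0, g) :=
    continuousAt_const.sub (((expNegInvGlue.contDiff (n := 0)).continuous.continuousAt.comp
      continuousAt_fst).mul (continuousAt_snd.log hg.ne'))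
  have h2 : ContinuousAt (fun p : ℝ × ℝ =>
      1 + p.1 * Real.log (1 - expNegInvGlue p.1 * Real.log p.2)) (0, g) :=
    continuousAt_const.add (continuousAt_fst.mul (h1.log (by simp [expNegInvGlue.zero])))
  have e1 := h1.eventually (p := fun t => 0 < t)
    (lt_mem_nhds (by simp [expNegInvGlue.zero]))
  have e2 := h2.eventually (p := fun t => 0 < t)
    (lt_mem_nhds (by simp))
  filter_upwards [e1, e2, continuousAt_snd.eventually (lt_mem_nhds hg)] with p p1 p2 p3 hp
  obtain ⟨y, g⟩ := p
  simp only at p1 p2 p3 hp ⊢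
  obtain rfl | hy := hp.eq_or_lt
  · simp [crushSolve, crush_zero]
  set a := 1 - expNegInvGlue y * Real.log g with ha
  have hR : 0 < crushSolve y g := div_pos hy p2
  have hφ := expNegInvGlue.pos_of_pos hy
  refine ⟨hR.le, ?_⟩
  have h3 : expNegInvGlue (crushSolve y g) = expNegInvGlue y / a := by
    rw [expNegInvGlue_of_pos hR, expNegInvGlue_of_pos hy]
    have : -(crushSolve y g)⁻¹ = -y⁻¹ - Real.log a := by
      rw [crushSolve, ← ha]
      field_simp
      ring
    rw [this, Real.exp_sub, Real.exp_log p1]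
  rw [crush, crush, h3, expNegInvGlue_of_pos (div_pos hφ p1), expNegInvGlue_of_pos hφ]
  have : -(expNegInvGlue y / a)⁻¹ = -(expNegInvGlue y)⁻¹ + Real.log g := by
    rw [ha, inv_div]
    field_simp
    ring
  rw [this, Real.exp_add, Real.exp_log p3]

/-! ### Collars and the construction of the crushing homeomorphism. -/

/-- A collar of a union `O` of boundary components: a retraction `r : W → O` of an open
neighbourhood and a function `h : W → [0, 1)`, which are the two components of a diffeomorphism near
`O`, with inverse `E : O × [0, 1) → M`. -/
structure BoundaryCollar (n : ℕ) [NeZero n] {M : Type*} [TopologicalSpace M]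
    [ChartedSpace (EuclideanHalfSpace n) M] (O : Set M) where
  isUnion : IsUnionOfBoundaryComponents n O
  W : Set M
  isOpen_W : IsOpen W
  subset_W : O ⊆ W
  r : M → M
  h : M → ℝ
  E : M × ℝ → M
  contMDiffOn_r : ContMDiffOn (𝓡∂ n) (𝓡∂ n) ∞ r W
  contMDiffOn_h : ContMDiffOn (𝓡∂ n) 𝓘(ℝ, ℝ) ∞ h W
  contMDiffOn_E : ContMDiffOn ((𝓡∂ n).prod 𝓘(ℝ, ℝ)) (𝓡∂ n) ∞ E (O ×ˢ Ico (0 : ℝ) 1)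
  r_mem : ∀ p ∈ W, r p ∈ O
  h_mem : ∀ p ∈ W, h p ∈ Ico (0 : ℝ) 1
  r_eq : ∀ x ∈ O, r x = x
  h_eq : ∀ x ∈ O, h x = 0
  E_rh : ∀ p ∈ W, E (r p, h p) = p
  rh_E : ∀ x ∈ O, ∀ᶠ z in 𝓝[O ×ˢ Ico (0 : ℝ) 1] (x, 0), r (E z) = z.1 ∧ h (E z) = z.2

namespace BoundaryCollar

variable {n : ℕ} [NeZero n] {M : Type*} [TopologicalSpace M]
  [ChartedSpace (EuclideanHalfSpace n) M] {O : Set M} (κ : BoundaryCollar n O)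

theorem E_zero {x : M} (hx : x ∈ O) : κ.E (x, 0) = x := by
  have := κ.E_rh x (κ.subset_W hx)
  rwa [κ.r_eq x hx, κ.h_eq x hx] at this

theorem h_pos {p : M} (hp : p ∈ κ.W) (hpO : p ∉ O) : 0 < κ.h p := by
  refine (κ.h_mem p hp).1.lt_of_ne fun h0 => hpO ?_
  have h1 := κ.E_rh p hp
  rw [← h0, κ.E_zero (κ.r_mem p hp)] at h1
  exact h1 ▸ κ.r_mem p hp

theorem eventually_E_mem {x : M} (hx : x ∈ O) {V : Set M} (hV : V ∈ 𝓝 x) :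
    ∀ᶠ z in 𝓝[O ×ˢ Ico (0 : ℝ) 1] (x, 0), κ.E z ∈ V := by
  have h1 := (κ.contMDiffOn_E.continuousOn (x, 0) ⟨hx, by simp⟩)
  rw [ContinuousWithinAt, κ.E_zero hx] at h1
  exact h1 hV

/-- The inverse relations between `E` and (`r`, `h`) hold only near each point of `O`. A partition
of unity turns local constant widths into a smooth positive width, since the admissible widths at a
point form an interval. Closedness of the tube allows extending by the identity outside it. -/
theorem exists_width [T2Space M] [SecondCountableTopology M] [IsManifold (𝓡∂ n) ∞ M] :
    ∃ e : C^∞⟮𝓡∂ n, M; 𝓘(ℝ, ℝ), ℝ⟯, (∀ x ∈ O, 0 < e x ∧ e x < 1) ∧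
      (∀ x ∈ O, ∀ y ∈ Icc 0 (e x), κ.E (x, y) ∈ κ.W ∧ κ.r (κ.E (x, y)) = x ∧
        κ.h (κ.E (x, y)) = y) ∧
      IsClosed {p | p ∈ κ.W ∧ κ.h p ≤ e (κ.r p)} := by
  have := (𝓡∂ n).locallyCompactSpace
  have := ChartedSpace.locallyCompactSpace (EuclideanHalfSpace n) M
  have := Manifold.metrizableSpace (𝓡∂ n) M
  have hO : IsClosed O := κ.isUnion.isClosed
  obtain ⟨V, hVo, hOV, hVW⟩ := normal_exists_closure_subset hO κ.isOpen_W κ.subset_W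
  let t : M → Set ℝ := fun x => {δ | x ∈ O → 0 < δ ∧ δ < 1 ∧ ∀ y ∈ Icc 0 δ,
    κ.E (x, y) ∈ V ∧ κ.r (κ.E (x, y)) = x ∧ κ.h (κ.E (x, y)) = y}
  have ht (x : M) : Convex ℝ (t x) := by
    rw [convex_iff_ordConnected]
    refine ⟨fun a ha b hb c hc hx => ⟨(ha hx).1.trans_le hc.1, hc.2.trans_lt (hb hx).2.1, ?_⟩⟩
    exact fun y hy => (hb hx).2.2 y ⟨hy.1, hy.2.trans hc.2⟩
  obtain ⟨e, he⟩ := exists_contMDiffMap_forall_mem_convex_of_local_const (n := (⊤ : ℕ∞)) (𝓡∂ n) ht (by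
    intro x
    by_cases hx : x ∈ O
    · have h1 := (κ.eventually_E_mem hx (hVo.mem_nhds (hOV hx))).and (κ.rh_E x hx)
      rw [eventually_nhdsWithin_iff, nhds_prod_eq, Filter.eventually_prod_iff] at h1
      obtain ⟨pa, hpa, pb, hpb, h1⟩ := h1
      obtain ⟨ε, hε, hball⟩ := Metric.eventually_nhds_iff.1 hpb
      have hm : 0 < min (ε / 2) (1 / 2) := by positivity
      refine ⟨min (ε / 2) (1 / 2), ?_⟩
      filter_upwards [hpa] with x' hx' hxO
      refine ⟨hm, (min_le_right _ _).trans_lt (by norm_num), fun y hy => ?_⟩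
      have hy1 := hy.2.trans (min_le_left _ _)
      have hy2 := hy.2.trans (min_le_right _ _)
      refine h1 hx' (hball ?_) ⟨hxO, hy.1, by linarith⟩
      rw [dist_zero_right, Real.norm_of_nonneg hy.1]
      linarith
    · refine ⟨0, ?_⟩
      filter_upwards [hO.isOpen_compl.mem_nhds hx] with x' hx' h
      exact absurd h hx')
  refine ⟨e, fun x hx => ⟨(he x hx).1, (he x hx).2.1⟩, fun x hx y hy => ?_, ?_⟩
  · obtain ⟨h1, h2⟩ := (he x hx).2.2 y hy
    exact ⟨hVW (subset_closure h1), h2⟩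
  · set S : Set M := {p | p ∈ κ.W ∧ κ.h p ≤ e (κ.r p)} with hS
    -- The tube lies in V, and the closure of V lies in `W`. A limit of points of the tube thus
    -- stays in `W`, where `h` and `e ∘ r` are continuous.
    have hSV : S ⊆ V := fun p hp => by
      have := ((he _ (κ.r_mem p hp.1)).2.2 (κ.h p) ⟨(κ.h_mem p hp.1).1, hp.2⟩).1
      rwa [κ.E_rh p hp.1] at this
    rw [← closure_subset_iff_isClosed]
    intro p hp
    have hpW : p ∈ κ.W := hVW (closure_mono hSV hp)
    refine ⟨hpW, not_lt.1 fun hlt => ?_⟩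
    have hW := κ.isOpen_W.mem_nhds hpW
    have h1 : ContinuousAt κ.h p := κ.contMDiffOn_h.continuousOn.continuousAt hW
    have h2 : ContinuousAt (fun p => e (κ.r p)) p :=
      e.contMDiff.continuous.continuousAt.comp (κ.contMDiffOn_r.continuousOn.continuousAt hW)
    obtain ⟨q, hq1, hq2⟩ := mem_closure_iff_nhds.1 hp _ (h2.eventually_lt h1 hlt)
    exact not_le.2 hq1 hq2.2

section

variable (e : C^∞⟮𝓡∂ n, M; 𝓘(ℝ, ℝ), ℝ⟯) (k : ℝ → ℝ → ℝ)

open Classical in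
/-- The map which is `(x, y) ↦ (x, k (e x) y)` in the collar and the identity elsewhere. -/
noncomputable def fiberMap (p : M) : M :=
  if p ∈ κ.W then κ.E (κ.r p, k (e (κ.r p)) (κ.h p)) else p

/-- Profiles `k δ` which map `[0, δ]` to itself, are the identity on `[δ, ∞)`, and are smooth away
from `0`. -/
structure IsProfile (k : ℝ → ℝ → ℝ) : Prop where
  nonneg : ∀ {δ z : ℝ}, 0 < δ → 0 ≤ z → 0 ≤ k δ z
  le : ∀ {δ z : ℝ}, 0 < δ → 0 ≤ z → z ≤ δ → k δ z ≤ δ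
  of_ge : ∀ {δ z : ℝ}, 0 < δ → δ ≤ z → k δ z = z
  zero : ∀ {δ : ℝ}, 0 < δ → k δ 0 = 0
  continuousWithinAt : ∀ {δ z : ℝ}, 0 < δ → 0 ≤ z →
    ContinuousWithinAt (fun p : ℝ × ℝ => k p.1 p.2) (univ ×ˢ Ici 0) (δ, z)
  contDiffAt : ∀ {δ z : ℝ}, 0 < δ → 0 < z → ContDiffAt ℝ ∞ (fun p : ℝ × ℝ => k p.1 p.2) (δ, z)

theorem isProfile_cutCrush : IsProfile cutCrush where
  nonneg := cutCrush_nonneg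
  le hδ hz h := (cutCrush_le_iff hδ hz).2 h
  of_ge := cutCrush_of_ge
  zero _ := cutCrush_zero
  continuousWithinAt hδ _ := (contDiffAt_cutCrush hδ _).continuousAt.continuousWithinAt
  contDiffAt hδ _ := contDiffAt_cutCrush hδ _

theorem isProfile_cutCrushInv : IsProfile cutCrushInv where
  nonneg := cutCrushInv_nonneg
  le hδ hz h := (cutCrushInv_le_iff hδ hz).2 h
  of_ge := cutCrushInv_of_ge
  zero := cutCrushInv_zero
  continuousWithinAt := continuousWithinAt_cutCrushInv
  contDiffAt := contDiffAt_cutCrushInv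

variable {e k}

theorem fiberMap_of_notMem (he : ∀ x ∈ O, 0 < e x ∧ e x < 1) (hk : IsProfile k) {p : M}
    (hp : ¬ (p ∈ κ.W ∧ κ.h p ≤ e (κ.r p))) : κ.fiberMap e k p = p := by
  by_cases hW : p ∈ κ.W
  · have h1 : e (κ.r p) ≤ κ.h p := (not_le.1 fun h => hp ⟨hW, h⟩).le
    rw [fiberMap, if_pos hW, hk.of_ge (he _ (κ.r_mem p hW)).1 h1, κ.E_rh p hW]
  · rw [fiberMap, if_neg hW]

/-- A profile maps [0, e x] to itself, so over the tube the image stays where `E` and (`r`, `h`) are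
mutually inverse, and the composition can be computed fibre by fibre. Outside the tube both maps are
the identity. -/
theorem fiberMap_fiberMap (he : ∀ x ∈ O, 0 < e x ∧ e x < 1)
    (he' : ∀ x ∈ O, ∀ y ∈ Icc 0 (e x), κ.E (x, y) ∈ κ.W ∧ κ.r (κ.E (x, y)) = x ∧
        κ.h (κ.E (x, y)) = y) (hk : IsProfile k) {k' : ℝ → ℝ → ℝ} (hk' : IsProfile k')
    (hkk : ∀ {δ z : ℝ}, 0 < δ → 0 ≤ z → k' δ (k δ z) = z) (p : M) :
    κ.fiberMap e k' (κ.fiberMap e k p) = p := by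
  by_cases hp : p ∈ κ.W ∧ κ.h p ≤ e (κ.r p)
  · have hr := κ.r_mem p hp.1
    have hh := (κ.h_mem p hp.1).1
    have hδ := (he _ hr).1
    obtain ⟨h1, h2, h3⟩ := he' _ hr (k (e (κ.r p)) (κ.h p)) ⟨hk.nonneg hδ hh, hk.le hδ hh hp.2⟩
    have h4 : κ.fiberMap e k p = κ.E (κ.r p, k (e (κ.r p)) (κ.h p)) := if_pos hp.1
    rw [h4, fiberMap, if_pos h1, h2, h3, hkk hδ hh, κ.E_rh p hp.1]
  · rw [κ.fiberMap_of_notMem he hk hp, κ.fiberMap_of_notMem he hk' hp]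

theorem fiberMap_mapsTo (he : ∀ x ∈ O, 0 < e x ∧ e x < 1) (hk : IsProfile k) {p : M}
    (hp : p ∈ κ.W) : (κ.r p, k (e (κ.r p)) (κ.h p)) ∈ O ×ˢ Ico (0 : ℝ) 1 := by
  have hr := κ.r_mem p hp
  have hh := κ.h_mem p hp
  have hδ := he _ hr
  refine ⟨hr, hk.nonneg hδ.1 hh.1, ?_⟩
  obtain h | h := le_total (κ.h p) (e (κ.r p))
  · exact (hk.le hδ.1 hh.1 h).trans_lt hδ.2
  · simpa only [hk.of_ge hδ.1 h] using hh.2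

/-- `W` and the complement of the closed tube are open and cover `M`. On the first the map is given
by the collar formula, on the second it is the identity. The same cover serves for smoothness away
from `O`, where `h` is positive and profiles are smooth. -/
theorem continuous_fiberMap (he : ∀ x ∈ O, 0 < e x ∧ e x < 1) (hk : IsProfile k)
    (hS : IsClosed {p | p ∈ κ.W ∧ κ.h p ≤ e (κ.r p)}) : Continuous (κ.fiberMap e k) := by
  rw [continuous_iff_continuousAt]
  intro p
  by_cases hW : p ∈ κ.W
  · have hWn := κ.isOpen_W.mem_nhds hW
    have h3 : ContinuousOn (fun p => (κ.r p, k (e (κ.r p)) (κ.h p))) κ.W := by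
      refine κ.contMDiffOn_r.continuousOn.prodMk fun q hq => ?_
      refine ContinuousWithinAt.comp (t := univ ×ˢ Ici 0) (f := fun q => (e (κ.r q), κ.h q))
        (hk.continuousWithinAt (he _ (κ.r_mem q hq)).1 (κ.h_mem q hq).1) ?_
        fun q hq => ⟨mem_univ _, (κ.h_mem q hq).1⟩
      exact ((e.contMDiff.continuous.comp_continuousOn κ.contMDiffOn_r.continuousOn) q hq).prodMk
        (κ.contMDiffOn_h.continuousOn q hq)
    have h4 := κ.contMDiffOn_E.continuousOn.comp h3 fun q hq => κ.fiberMap_mapsTo he hk hq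
    exact (h4.congr fun q hq => if_pos hq).continuousAt hWn
  · refine continuousAt_id.congr ?_
    filter_upwards [hS.isOpen_compl.mem_nhds fun h => hW h.1] with q hq
    exact (κ.fiberMap_of_notMem he hk hq).symm

theorem contMDiffAt_fiberMap (he : ∀ x ∈ O, 0 < e x ∧ e x < 1) (hk : IsProfile k)
    (hS : IsClosed {p | p ∈ κ.W ∧ κ.h p ≤ e (κ.r p)}) {p : M} (hp : p ∉ O) :
    ContMDiffAt (𝓡∂ n) (𝓡∂ n) ∞ (κ.fiberMap e k) p := by
  by_cases hW : p ∈ κ.W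
  · have hWn := κ.isOpen_W.mem_nhds hW
    have hr := κ.contMDiffOn_r.contMDiffAt hWn
    have hh := κ.contMDiffOn_h.contMDiffAt hWn
    have hk1 := (hk.contDiffAt (he _ (κ.r_mem p hW)).1 (κ.h_pos hW hp)).contMDiffAt
    have h1 : ContMDiffAt (𝓡∂ n) 𝓘(ℝ, ℝ × ℝ) ∞ (fun q => (e (κ.r q), κ.h q)) p :=
      (e.contMDiff.contMDiffAt.comp p hr).prodMk_space hh
    have h2 : ContMDiffAt (𝓡∂ n) ((𝓡∂ n).prod 𝓘(ℝ, ℝ)) ∞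
        (fun q => (κ.r q, k (e (κ.r q)) (κ.h q))) p :=
      hr.prodMk (ContMDiffAt.comp p (g := fun p : ℝ × ℝ => k p.1 p.2) hk1 h1)
    have h3 := (κ.contMDiffOn_E _ (κ.fiberMap_mapsTo he hk hW)).comp p
      h2.contMDiffWithinAt (fun q hq => κ.fiberMap_mapsTo he hk hq)
    refine (h3.contMDiffAt hWn).congr_of_eventuallyEq ?_
    filter_upwards [hWn] with q hq using if_pos hq
  · refine contMDiffAt_id.congr_of_eventuallyEq ?_
    filter_upwards [hS.isOpen_compl.mem_nhds fun h => hW h.1] with q hq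
    exact κ.fiberMap_of_notMem he hk hq

end

/-- `Ψ` is the crushing map in the collar coordinates near `O`, and a diffeomorphism away
from `O`. -/
structure IsCrushing (Ψ : M ≃ₜ M) : Prop where
  near : ∃ V : Set M, IsOpen V ∧ O ⊆ V ∧ V ⊆ κ.W ∧ ∀ p ∈ V, Ψ p ∈ κ.W ∧ κ.r (Ψ p) = κ.r p ∧
    κ.h (Ψ p) = crush (κ.h p)
  contMDiffAt : ∀ p ∉ O, ContMDiffAt (𝓡∂ n) (𝓡∂ n) ∞ Ψ p ∧ ContMDiffAt (𝓡∂ n) (𝓡∂ n) ∞ Ψ.symm p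
  apply_eq : ∀ x ∈ O, Ψ x = x

theorem exists_isCrushing [T2Space M] [SecondCountableTopology M] [IsManifold (𝓡∂ n) ∞ M] :
    ∃ Ψ : M ≃ₜ M, κ.IsCrushing Ψ := by
  obtain ⟨e, he, he', hS⟩ := κ.exists_width
  have h1 := κ.fiberMap_fiberMap he he' isProfile_cutCrush isProfile_cutCrushInv
    cutCrushInv_cutCrush
  have h2 := κ.fiberMap_fiberMap he he' isProfile_cutCrushInv isProfile_cutCrush
    cutCrush_cutCrushInv
  refine ⟨{ toFun := κ.fiberMap e cutCrush
            invFun := κ.fiberMap e cutCrushInv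
            left_inv := h1
            right_inv := h2
            continuous_toFun := κ.continuous_fiberMap he isProfile_cutCrush hS
            continuous_invFun := κ.continuous_fiberMap he isProfile_cutCrushInv hS }, ?_, ?_, ?_⟩
  · refine ⟨{p | p ∈ κ.W ∧ κ.h p < e (κ.r p) / 2}, ?_, ?_, fun p hp => hp.1, ?_⟩
    · rw [isOpen_iff_mem_nhds]
      intro p hp
      have hW := κ.isOpen_W.mem_nhds hp.1
      have c1 : ContinuousAt κ.h p := κ.contMDiffOn_h.continuousOn.continuousAt hW
      have c2 : ContinuousAt (fun p => e (κ.r p) / 2) p :=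
        (e.contMDiff.continuous.continuousAt.comp
          (κ.contMDiffOn_r.continuousOn.continuousAt hW)).div_const 2
      exact Filter.inter_mem hW (c1.eventually_lt c2 hp.2)
    · intro x hx
      refine ⟨κ.subset_W hx, ?_⟩
      rw [κ.h_eq x hx, κ.r_eq x hx]
      exact half_pos (he x hx).1
    · intro p hp
      have hr := κ.r_mem p hp.1
      have hh := (κ.h_mem p hp.1).1
      have hδ := (he _ hr).1
      have h4 : κ.fiberMap e cutCrush p = κ.E (κ.r p, crush (κ.h p)) := by
        rw [fiberMap, if_pos hp.1, cutCrush_of_le_half hδ hp.2.le]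
      change κ.fiberMap e cutCrush p ∈ κ.W ∧ κ.r (κ.fiberMap e cutCrush p) = κ.r p ∧
        κ.h (κ.fiberMap e cutCrush p) = crush (κ.h p)
      rw [h4]
      exact he' _ hr _ ⟨crush_nonneg _, (crush_le_self hh).trans (by linarith [hp.2])⟩
  · exact fun p hp => ⟨κ.contMDiffAt_fiberMap he isProfile_cutCrush hS hp,
      κ.contMDiffAt_fiberMap he isProfile_cutCrushInv hS hp⟩
  · intro x hx
    change κ.fiberMap e cutCrush x = x
    rw [fiberMap, if_pos (κ.subset_W hx), κ.r_eq x hx, κ.h_eq x hx, cutCrush_zero, κ.E_zero hx]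

end BoundaryCollar

/-! ### The boundary in charts, and division along it. -/

section

variable {n : ℕ} [NeZero n] {M : Type*} [TopologicalSpace M]
  [ChartedSpace (EuclideanHalfSpace n) M] [IsManifold (𝓡∂ n) ∞ M]

/-- Being an interior point can be tested in any chart of the atlas, so the chart at `x` decides it
for every point of its source. -/
theorem mem_boundary_iff_extChartAt (x : M) {y : M} (hy : y ∈ (extChartAt (𝓡∂ n) x).source) :
    y ∈ (𝓡∂ n).boundary M ↔ (extChartAt (𝓡∂ n) x y) 0 = 0 := by
  set e := extChartAt (𝓡∂ n) x with he
  have h1 := (𝓡∂ n).isInteriorPoint_iff_of_mem_atlas (n := ∞) (by simp)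
    (chart_mem_atlas (EuclideanHalfSpace n) x) (x := y) (by simpa [he] using hy)
  have h2 : (𝓡∂ n).IsInteriorPoint y ↔ 0 < (e y) 0 := by
    rw [h1]
    constructor
    · intro h
      have h3 := interior_mono (OpenPartialHomeomorph.extend_target_subset_range _) h
      rwa [interior_range_modelWithCornersEuclideanHalfSpace] at h3
    · intro h
      refine OpenPartialHomeomorph.mem_interior_extend_target _
        ((chartAt (EuclideanHalfSpace n) x).map_source (by simpa [he] using hy)) ?_
      rw [interior_range_modelWithCornersEuclideanHalfSpace]
      exact h
  have h4 : 0 ≤ (e y) 0 := by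
    have : e y ∈ range (𝓡∂ n) := extChartAt_target_subset_range x (e.map_source hy)
    rwa [range_modelWithCornersEuclideanHalfSpace] at this
  have h5 : y ∈ (𝓡∂ n).boundary M ↔ ¬ (𝓡∂ n).IsInteriorPoint y :=
    (𝓡∂ n).isBoundaryPoint_iff_not_isInteriorPoint y
  rw [h5, h2, not_lt]
  exact ⟨fun h => le_antisymm h h4, fun h => h.le⟩

/-- In the chart at a boundary point `x`, a flat disc parametrizes the boundary near `x`, and is
contained in a single boundary component. -/
theorem exists_ball_boundary {x : M} (hx : x ∈ (𝓡∂ n).boundary M) :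
    ∃ r > 0, (∀ y ∈ Metric.ball (extChartAt (𝓡∂ n) x x) r, y 0 = 0 →
      y ∈ (extChartAt (𝓡∂ n) x).target ∧
      (extChartAt (𝓡∂ n) x).symm y ∈ connectedComponentIn ((𝓡∂ n).boundary M) x) := by
  set e := extChartAt (𝓡∂ n) x with he
  have ht : e.target ∈ 𝓝[range (𝓡∂ n)] (e x) := extChartAt_target_mem_nhdsWithin x
  obtain ⟨r, hr, hball⟩ := Metric.mem_nhdsWithin_iff.1 ht
  let S : Set (EuclideanSpace ℝ (Fin n)) := Metric.ball (e x) r ∩ {y | y 0 = 0}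
  have hS : Convex ℝ S := by
    refine (convex_ball _ _).inter ?_
    intro a ha b hb s t _ _ _
    simp only [mem_ofPred_eq] at ha hb
    simp [ha, hb]
  have hSt : S ⊆ e.target := by
    intro y hy
    refine hball ⟨hy.1, ?_⟩
    rw [range_modelWithCornersEuclideanHalfSpace]
    exact le_of_eq hy.2.symm
  have hT : IsPreconnected (e.symm '' S) :=
    hS.isPreconnected.image _ ((continuousOn_extChartAt_symm x).mono hSt)
  have hTb : e.symm '' S ⊆ (𝓡∂ n).boundary M := by
    rintro _ ⟨y, hy, rfl⟩
    rw [mem_boundary_iff_extChartAt x (e.map_target (hSt hy))]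
    rw [← he, e.right_inv (hSt hy)]
    exact hy.2
  have hxs : x ∈ e.source := mem_extChartAt_source x
  have hxT : x ∈ e.symm '' S :=
    ⟨e x, ⟨Metric.mem_ball_self hr, (mem_boundary_iff_extChartAt x hxs).1 hx⟩, e.left_inv hxs⟩
  exact ⟨r, hr, fun y hy hy0 => ⟨hSt ⟨hy, hy0⟩,
    hT.subset_connectedComponentIn hxT hTb ⟨y, ⟨hy, hy0⟩, rfl⟩⟩⟩

/-- Boundary components are open in the boundary. This makes any choice that depends only on the
component locally constant. -/
theorem eventually_mem_connectedComponentIn_boundary {x : M} (hx : x ∈ (𝓡∂ n).boundary M) :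
    ∀ᶠ y in 𝓝 x, y ∈ (𝓡∂ n).boundary M → y ∈ connectedComponentIn ((𝓡∂ n).boundary M) x := by
  obtain ⟨r, hr, h⟩ := exists_ball_boundary hx
  filter_upwards [extChartAt_source_mem_nhds (I := 𝓡∂ n) x,
    (continuousAt_extChartAt (I := 𝓡∂ n) x).preimage_mem_nhds (Metric.ball_mem_nhds _ hr)]
    with y hy1 hy2 hy3
  have := (h _ hy2 ((mem_boundary_iff_extChartAt x hy1).1 hy3)).2
  rwa [(extChartAt (𝓡∂ n) x).left_inv hy1] at this

/-- A local parametrization of a union of boundary components by an open subset of a vector space,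
with redundant normal coordinate. -/
theorem IsUnionOfBoundaryComponents.exists_parametrization {O : Set M}
    (hO : IsUnionOfBoundaryComponents n O) {x : M} (hx : x ∈ O) :
    ∃ (B : Set (EuclideanSpace ℝ (Fin n))) (s : EuclideanSpace ℝ (Fin n) → M), IsOpen B ∧
      extChartAt (𝓡∂ n) x x ∈ B ∧ ContMDiffOn 𝓘(ℝ, EuclideanSpace ℝ (Fin n)) (𝓡∂ n) ∞ s B ∧
      (∀ u ∈ B, s u ∈ O) ∧ ∀ᶠ y in 𝓝[O] x, s (extChartAt (𝓡∂ n) x y) = y := by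
  obtain ⟨r, hr, h⟩ := exists_ball_boundary (hO.1 hx)
  set e := extChartAt (𝓡∂ n) x with he
  -- Projecting away the normal coordinate replaces the boundary piece, which is thin in the model
  -- space, by an open set of parameters, as `_root_.exists_eq_crush_mul` requires.
  let π : EuclideanSpace ℝ (Fin n) → EuclideanSpace ℝ (Fin n) :=
    fun u => u - u 0 • EuclideanSpace.single 0 (1 : ℝ)
  have hπ : ContDiff ℝ ∞ π := by
    have h1 : ContDiff ℝ ∞ fun u : EuclideanSpace ℝ (Fin n) => u 0 :=
      (EuclideanSpace.proj (0 : Fin n) : EuclideanSpace ℝ (Fin n) →L[ℝ] ℝ).contDiff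
    exact contDiff_id.sub (h1.smul contDiff_const)
  have hπ0 (u) : π u 0 = 0 := by simp [π]
  have hπe {u : EuclideanSpace ℝ (Fin n)} (hu : u 0 = 0) : π u = u := by simp [π, hu]
  have hxs : x ∈ e.source := mem_extChartAt_source x
  refine ⟨π ⁻¹' Metric.ball (e x) r, e.symm ∘ π, Metric.isOpen_ball.preimage hπ.continuous, ?_, ?_,
    ?_, ?_⟩
  · rw [mem_preimage, hπe ((mem_boundary_iff_extChartAt x hxs).1 (hO.1 hx))]
    exact Metric.mem_ball_self hr
  · exact (contMDiffOn_extChartAt_symm x).comp hπ.contMDiff.contMDiffOn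
      fun u hu => (h _ hu (hπ0 u)).1
  · exact fun u hu => hO.2 x hx (h _ hu (hπ0 u)).2
  · rw [eventually_nhdsWithin_iff]
    filter_upwards [extChartAt_source_mem_nhds (I := 𝓡∂ n) x] with y hy hyO
    rw [Function.comp_apply, hπe ((mem_boundary_iff_extChartAt x hy).1 (hO.1 hyO)), e.left_inv hy]

/-- The division property `exists_eq_crush_mul` for functions on `O × [0, ε)`, where `O` is a union
of boundary components. -/
theorem IsUnionOfBoundaryComponents.exists_eq_crush_mul {O : Set M}
    (hO : IsUnionOfBoundaryComponents n O) {x : M} (hx : x ∈ O) {N : Set M} (hN : N ∈ 𝓝 x) {ε : ℝ}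
    (hε : 0 < ε) {H : M × ℝ → ℝ}
    (hH : ContMDiffOn ((𝓡∂ n).prod 𝓘(ℝ, ℝ)) 𝓘(ℝ, ℝ) ∞ H ((O ∩ N) ×ˢ Ico 0 ε))
    (h0 : ∀ y ∈ O ∩ N, H (y, 0) = 0) :
    ∃ g : M × ℝ → ℝ,
      ContMDiffAt ((𝓡∂ n).prod 𝓘(ℝ, ℝ)) 𝓘(ℝ, ℝ) ∞ g (x, 0) ∧
      ∀ᶠ z in 𝓝[O ×ˢ univ] (x, (0 : ℝ)), H (z.1, crush z.2) = crush z.2 * g z := by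
  obtain ⟨B, s, hB, hxB, hs, hsO, hsy⟩ := hO.exists_parametrization hx
  set c := extChartAt (𝓡∂ n) x with hc
  have hsx : s (c x) = x := hsy.self_of_nhdsWithin hx
  obtain ⟨N', hN'N, hN'o, hxN'⟩ := mem_nhds_iff.1 hN
  set B' := B ∩ s ⁻¹' N' with hB'
  have hB'o : IsOpen B' := hs.continuousOn.isOpen_inter_preimage hB hN'o
  have hxB' : c x ∈ B' := ⟨hxB, by rwa [mem_preimage, hsx]⟩
  have hHs : ContDiffOn ℝ ∞ (fun p : EuclideanSpace ℝ (Fin n) × ℝ => H (s p.1, p.2))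
      (B' ×ˢ Ico 0 ε) := by
    rw [← contMDiffOn_iff_contDiffOn]
    refine hH.comp (f := fun p : EuclideanSpace ℝ (Fin n) × ℝ => (s p.1, p.2)) ?_
      (fun p hp => ⟨⟨hsO _ hp.1.1, hN'N hp.1.2⟩, hp.2⟩)
    exact (hs.comp (contDiff_fst (E := EuclideanSpace ℝ (Fin n)) (F := ℝ)).contMDiff.contMDiffOn
      (fun p hp => hp.1.1)).prodMk contDiff_snd.contMDiff.contMDiffOn
  obtain ⟨g, hg, hgH⟩ := _root_.exists_eq_crush_mul hB'o hε hHs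
    (fun u hu => h0 _ ⟨hsO u hu.1, hN'N hu.2⟩)
  refine ⟨fun z => g (c z.1, z.2), ?_, ?_⟩
  · have h1 : ContDiffAt ℝ ∞ g (c x, 0) :=
      hg.contDiffAt ((hB'o.prod isOpen_Iio).mem_nhds ⟨hxB', hε⟩)
    have h2 : ContMDiffAt ((𝓡∂ n).prod 𝓘(ℝ, ℝ)) 𝓘(ℝ, EuclideanSpace ℝ (Fin n) × ℝ) ∞
        (fun z : M × ℝ => (c z.1, z.2)) (x, 0) :=
      ((contMDiffAt_extChartAt (I := 𝓡∂ n) (x := x)).comp (x, (0 : ℝ))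
        contMDiffAt_fst).prodMk_space contMDiffAt_snd
    exact ContMDiffAt.comp (x, (0 : ℝ)) (g := g) (f := fun z : M × ℝ => (c z.1, z.2))
      h1.contMDiffAt h2
  · rw [nhdsWithin_prod_eq, nhdsWithin_univ]
    have e1 : ∀ᶠ y in 𝓝[O] x, c y ∈ B' :=
      nhdsWithin_le_nhds ((continuousAt_extChartAt (I := 𝓡∂ n) x).preimage_mem_nhds
        (hB'o.mem_nhds hxB'))
    filter_upwards [(e1.and hsy).prod_mk (gt_mem_nhds hε)] with z hz
    have := hgH _ hz.1.1 _ hz.2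
    simpa only [hz.1.2] using this

end

/-! ### Conjugation of diffeomorphisms by the crushing map. -/

theorem Diffeomorph.coe_symm_eq {n : ℕ} [NeZero n] {M : Type*} [TopologicalSpace M]
    [ChartedSpace (EuclideanHalfSpace n) M] (F : M ≃ₘ⟮𝓡∂ n, 𝓡∂ n⟯ M) {f : M ≃ₜ M}
    (hF : ⇑F = f) : ⇑F.symm = f.symm := by
  ext p
  apply f.injective
  rw [f.apply_symm_apply, ← hF, F.apply_symm_apply]

namespace BoundaryCollar

theorem mapsTo_crush {X : Type*} {O : Set X} :
    MapsTo (fun z : X × ℝ => (z.1, crush z.2)) (O ×ˢ Iio (1 : ℝ)) (O ×ˢ Ico (0 : ℝ) 1) := by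
  rintro ⟨x, y⟩ ⟨hx, hy⟩
  refine ⟨hx, crush_nonneg _, ?_⟩
  change crush y < 1
  obtain h | h := le_total y 0
  · rw [crush_of_nonpos h]; exact one_pos
  · exact (crush_le_self h).trans_lt hy

section

variable {n : ℕ} [NeZero n] {M : Type*} [TopologicalSpace M]
  [ChartedSpace (EuclideanHalfSpace n) M] {O : Set M} (κ : BoundaryCollar n O)

theorem mem_nhdsWithin_prod_Iio (x : M) :
    O ×ˢ Iio (1 : ℝ) ∈ 𝓝[O ×ˢ univ] (x, (0 : ℝ)) := by
  rw [nhdsWithin_prod_eq, nhdsWithin_univ]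
  exact Filter.prod_mem_prod self_mem_nhdsWithin (Iio_mem_nhds one_pos)

/-- `crush` is smooth on the line and nonnegative, so the substitution t ↦ crush t turns a map
defined on one side of the collar into one smooth on both sides. -/
theorem contMDiffWithinAt_E_crush {x : M} (hx : x ∈ O) :
    ContMDiffWithinAt ((𝓡∂ n).prod 𝓘(ℝ, ℝ)) (𝓡∂ n) ∞ (fun z => κ.E (z.1, crush z.2))
      (O ×ˢ univ) (x, (0 : ℝ)) := by
  have h1 : ContMDiff ((𝓡∂ n).prod 𝓘(ℝ, ℝ)) ((𝓡∂ n).prod 𝓘(ℝ, ℝ)) ∞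
      (fun z : M × ℝ => (z.1, crush z.2)) :=
    contMDiff_fst.prodMk (contDiff_crush.contMDiff.comp contMDiff_snd)
  exact ((κ.contMDiffOn_E.comp h1.contMDiffOn mapsTo_crush) (x, 0) ⟨hx, (one_pos : (0 : ℝ) < 1)⟩).mono_of_mem_nhdsWithin
    (mem_nhdsWithin_prod_Iio x)

theorem tendsto_E_crush {x : M} (hx : x ∈ O) :
    Filter.Tendsto (fun z => κ.E (z.1, crush z.2)) (𝓝[O ×ˢ univ] (x, (0 : ℝ))) (𝓝 x) := by
  have h := (κ.contMDiffWithinAt_E_crush hx).continuousWithinAt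
  rwa [ContinuousWithinAt, crush_zero, κ.E_zero hx] at h

theorem tendsto_crush (x : M) :
    Filter.Tendsto (fun z : M × ℝ => (z.1, crush z.2)) (𝓝[O ×ˢ univ] (x, (0 : ℝ)))
      (𝓝[O ×ˢ Ico (0 : ℝ) 1] (x, (0 : ℝ))) := by
  refine tendsto_nhdsWithin_of_tendsto_nhds_of_eventually_within _ ?_ ?_
  · have : Continuous (fun z : M × ℝ => (z.1, crush z.2)) :=
      continuous_fst.prodMk (continuous_crush.comp continuous_snd)
    have h := (this.tendsto (x, 0)).mono_left (nhdsWithin_le_nhds (s := O ×ˢ univ))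
    rwa [crush_zero] at h
  · filter_upwards [mem_nhdsWithin_prod_Iio x] with z hz using mapsTo_crush hz

end

variable {n : ℕ} [NeZero n] {M : Type*} [TopologicalSpace M]
  [ChartedSpace (EuclideanHalfSpace n) M] [IsManifold (𝓡∂ n) ∞ M] {O : Set M}
  (κ : BoundaryCollar n O)

/-- The function to be divided is the height of `f (E z)`. It vanishes at height 0 because `f` maps
`O` to itself and `h` is zero on `O`. -/
theorem exists_h_eq_crush_mul {f : M → M} (hf : ContMDiff (𝓡∂ n) (𝓡∂ n) ∞ f) (hfO : MapsTo f O O)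
    {x : M} (hx : x ∈ O) :
    ∃ g : M × ℝ → ℝ,
      ContMDiffAt ((𝓡∂ n).prod 𝓘(ℝ, ℝ)) 𝓘(ℝ, ℝ) ∞ g (x, 0) ∧
      ∀ᶠ z in 𝓝[O ×ˢ univ] (x, (0 : ℝ)), κ.h (f (κ.E (z.1, crush z.2))) = crush z.2 * g z := by
  have hfW : f ⁻¹' κ.W ∈ 𝓝 x :=
    hf.continuous.continuousAt.preimage_mem_nhds (κ.isOpen_W.mem_nhds (κ.subset_W (hfO hx)))
  have h1 := κ.eventually_E_mem hx hfW
  rw [eventually_nhdsWithin_iff, nhds_prod_eq, Filter.eventually_prod_iff] at h1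
  obtain ⟨pa, hpa, pb, hpb, h1⟩ := h1
  obtain ⟨ε, hε, hball⟩ := Metric.eventually_nhds_iff.1 hpb
  have key : ∀ z ∈ (O ∩ {y | pa y}) ×ˢ Ico (0 : ℝ) (min ε 1),
      z ∈ O ×ˢ Ico (0 : ℝ) 1 ∧ f (κ.E z) ∈ κ.W := by
    rintro ⟨y, t⟩ ⟨⟨hy, hya⟩, ht0, ht⟩
    have h2 : (y, t) ∈ O ×ˢ Ico (0 : ℝ) 1 := ⟨hy, ht0, ht.trans_le (min_le_right _ _)⟩
    refine ⟨h2, h1 hya (hball ?_) h2⟩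
    rw [dist_zero_right, Real.norm_of_nonneg ht0]
    exact ht.trans_le (min_le_left _ _)
  refine κ.isUnion.exists_eq_crush_mul hx hpa (lt_min hε one_pos)
    (H := fun z => κ.h (f (κ.E z))) ?_ ?_
  · exact κ.contMDiffOn_h.comp (hf.comp_contMDiffOn (κ.contMDiffOn_E.mono fun z hz => (key z hz).1))
      fun z hz => (key z hz).2
  · intro y hy
    rw [κ.E_zero hy.1, κ.h_eq _ (hfO hy.1)]

/-- Applied to the inverse of a diffeomorphism, this linear bound forces the factor g of the
diffeomorphism itself to be positive. -/
theorem exists_h_le_mul {f : M → M} (hf : ContMDiff (𝓡∂ n) (𝓡∂ n) ∞ f) (hfO : MapsTo f O O)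
    {x : M} (hx : x ∈ O) : ∃ C > 0, ∀ᶠ p in 𝓝 x, κ.h (f p) ≤ C * κ.h p := by
  obtain ⟨g, hg, hgh⟩ := κ.exists_h_eq_crush_mul hf hfO hx
  have hW := κ.isOpen_W.mem_nhds (κ.subset_W hx)
  -- Near 0, `cutCrushInv 1` inverts `crush`, because `cutCrush 1` is `crush` on [0, 1/2]. Thus
  -- every p near x is `E (y, crush t)` for some (y, t) near (x, 0), and the divided form applies to
  -- it.
  have ht : Filter.Tendsto (fun p => (κ.r p, cutCrushInv 1 (κ.h p))) (𝓝 x)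
      (𝓝[O ×ˢ univ] (x, (0 : ℝ))) := by
    refine tendsto_nhdsWithin_of_tendsto_nhds_of_eventually_within _ ?_ ?_
    · have h1 : ContinuousAt κ.r x := κ.contMDiffOn_r.continuousOn.continuousAt hW
      have h2 : ContinuousAt κ.h x := κ.contMDiffOn_h.continuousOn.continuousAt hW
      have h3 := continuousWithinAt_cutCrushInv one_pos le_rfl
      rw [ContinuousWithinAt, cutCrushInv_zero one_pos] at h3
      rw [ContinuousAt, κ.r_eq x hx] at h1
      rw [ContinuousAt, κ.h_eq x hx] at h2
      rw [nhds_prod_eq]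
      refine h1.prodMk (h3.comp (f := fun p => ((1 : ℝ), κ.h p)) ?_)
      refine tendsto_nhdsWithin_of_tendsto_nhds_of_eventually_within _
        (Filter.Tendsto.prodMk_nhds tendsto_const_nhds h2) ?_
      filter_upwards [hW] with p hp using ⟨mem_univ _, (κ.h_mem p hp).1⟩
    · filter_upwards [hW] with p hp using ⟨κ.r_mem p hp, mem_univ _⟩
  have hb : ∀ᶠ z in 𝓝[O ×ˢ univ] (x, (0 : ℝ)), g z < |g (x, 0)| + 1 ∧ z.2 < 1 / 2 :=
    nhdsWithin_le_nhds ((hg.continuousAt.eventually (gt_mem_nhds (by linarith [le_abs_self (g (x, 0))]))).and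
      (continuousAt_snd.eventually (gt_mem_nhds (by norm_num))))
  refine ⟨|g (x, 0)| + 1, by positivity, ?_⟩
  filter_upwards [hW, ht.eventually (hgh.and hb)] with p hp ⟨h1, h2, h3⟩
  have h4 : crush (cutCrushInv 1 (κ.h p)) = κ.h p := by
    rw [← cutCrush_of_le_half one_pos (by simpa using h3.le)]
    exact cutCrush_cutCrushInv one_pos (κ.h_mem p hp).1
  simp only [h4, κ.E_rh p hp] at h1
  rw [h1, mul_comm]
  exact mul_le_mul_of_nonneg_right h2.le (κ.h_mem p hp).1

/-- A diffeomorphism which preserves `O` becomes, after conjugation by the crushing map, a map whose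
normal component `R` in the collar coordinates extends smoothly by the identity to the other side. -/
theorem exists_normal_component (f : M ≃ₘ⟮𝓡∂ n, 𝓡∂ n⟯ M) (hfO : MapsTo f O O)
    (hfO' : MapsTo f.symm O O) {x : M} (hx : x ∈ O) :
    ∃ R : M × ℝ → ℝ,
      ContMDiffAt ((𝓡∂ n).prod 𝓘(ℝ, ℝ)) 𝓘(ℝ, ℝ) ∞ R (x, 0) ∧
      (∀ z, z.2 ≤ 0 → R z = z.2) ∧
      ∀ᶠ z in 𝓝[O ×ˢ univ] (x, (0 : ℝ)), 0 ≤ z.2 → 0 ≤ R z ∧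
        crush (R z) = κ.h (f (κ.E (z.1, crush z.2))) := by
  obtain ⟨g, hg, hgh⟩ := κ.exists_h_eq_crush_mul f.contMDiff hfO hx
  obtain ⟨C, hC, hCh⟩ := κ.exists_h_le_mul f.symm.contMDiff hfO' (hfO hx)
  -- Apply the bound for `f.symm` to the point `f (E (x, crush y))`, whose image has height crush y:
  -- this gives crush y ≤ C · crush y · g(x, y). Hence g ≥ 1/C for small y > 0, and g(x, 0) ≥ 1/C in
  -- the limit.
  have hg0 : 0 < g (x, 0) := by
    have ht : Filter.Tendsto (fun y : ℝ => (x, y)) (𝓝[>] 0) (𝓝[O ×ˢ univ] (x, (0 : ℝ))) := by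
      refine tendsto_nhdsWithin_of_tendsto_nhds_of_eventually_within _ ?_ ?_
      · exact ((Continuous.prodMk_right x).tendsto 0).mono_left nhdsWithin_le_nhds
      · exact Filter.Eventually.of_forall fun y => ⟨hx, mem_univ _⟩
    have hgt : Filter.Tendsto (fun y : ℝ => g (x, y)) (𝓝[>] 0) (𝓝 (g (x, 0))) :=
      hg.continuousAt.tendsto.comp (ht.mono_right nhdsWithin_le_nhds)
    refine (inv_pos.2 hC).trans_le (ge_of_tendsto hgt ?_)
    have h1 := ht.eventually hgh
    have h2 := ht.eventually ((f.continuous.continuousAt.tendsto.comp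
      (κ.tendsto_E_crush hx)).eventually hCh)
    have h3 := ht.eventually ((tendsto_crush x).eventually (κ.rh_E x hx))
    filter_upwards [h1, h2, h3, self_mem_nhdsWithin] with y h1 h2 h3 hy
    simp only [Function.comp_apply, Diffeomorph.symm_apply_apply, h3.2, h1] at h2
    have hc := crush_pos hy
    rw [inv_le_iff_one_le_mul₀ hC]
    have : crush y * 1 ≤ crush y * (g (x, y) * C) := by linarith
    exact le_of_mul_le_mul_left this hc
  refine ⟨fun z => crushSolve z.2 (g z), ?_, fun z hz => crushSolve_of_nonpos hz _, ?_⟩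
  · have h1 : ContMDiffAt ((𝓡∂ n).prod 𝓘(ℝ, ℝ)) 𝓘(ℝ, ℝ × ℝ) ∞
        (fun z : M × ℝ => (z.2, g z)) (x, (0 : ℝ)) := contMDiffAt_snd.prodMk_space hg
    exact ContMDiffAt.comp (x, (0 : ℝ)) (g := fun p : ℝ × ℝ => crushSolve p.1 p.2)
      (f := fun z : M × ℝ => (z.2, g z)) (contDiffAt_crushSolve hg0).contMDiffAt h1
  · have h1 : ContinuousAt (fun z : M × ℝ => (z.2, g z)) (x, (0 : ℝ)) :=
      continuousAt_snd.prodMk hg.continuousAt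
    filter_upwards [hgh, nhdsWithin_le_nhds (h1.eventually (eventually_crushSolve hg0))]
      with z hz1 hz2 hz3
    exact ⟨(hz2 hz3).1, (hz2 hz3).2.trans hz1.symm⟩

variable {κ}

/-- The conjugate of a diffeomorphism by a crushing map, in the collar coordinates near a point of
`O`, extends to a smooth map `F` on both sides of `O`, which is a product on the other side. -/
theorem IsCrushing.exists_conj_extension {Ψ : M ≃ₜ M} (hΨ : κ.IsCrushing Ψ)
    (f : M ≃ₘ⟮𝓡∂ n, 𝓡∂ n⟯ M) (hfO : MapsTo f O O) (hfO' : MapsTo f.symm O O) {x : M} (hx : x ∈ O) :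
    ∃ F : M × ℝ → M × ℝ,
      ContMDiffWithinAt ((𝓡∂ n).prod 𝓘(ℝ, ℝ)) ((𝓡∂ n).prod 𝓘(ℝ, ℝ)) ∞ F (O ×ˢ univ) (x, (0 : ℝ)) ∧
      (∀ y ∈ O, ∀ t ≤ 0, F (y, t) = (f y, t)) ∧
      ∀ᶠ z in 𝓝[O ×ˢ univ] (x, (0 : ℝ)), (F z).1 ∈ O ∧
        (0 ≤ z.2 → 0 ≤ (F z).2 ∧ Ψ.symm (f (Ψ (κ.E z))) = κ.E (F z)) := by
  obtain ⟨R, hR, hR0, hRc⟩ := κ.exists_normal_component f hfO hfO' hx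
  obtain ⟨V, hVo, hOV, hVW, hV⟩ := hΨ.near
  set q : M × ℝ → M := fun z => f (κ.E (z.1, crush z.2)) with hq
  have hqt : Filter.Tendsto q (𝓝[O ×ˢ univ] (x, (0 : ℝ))) (𝓝 (f x)) :=
    f.continuous.continuousAt.tendsto.comp (κ.tendsto_E_crush hx)
  have hqx : q (x, 0) = f x := by rw [hq]; simp only [crush_zero, κ.E_zero hx]
  have hqW : ∀ᶠ z in 𝓝[O ×ˢ univ] (x, (0 : ℝ)), q z ∈ κ.W :=
    hqt (κ.isOpen_W.mem_nhds (κ.subset_W (hfO hx)))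
  have hqs : ContMDiffWithinAt ((𝓡∂ n).prod 𝓘(ℝ, ℝ)) (𝓡∂ n) ∞ q (O ×ˢ univ) (x, (0 : ℝ)) :=
    f.contMDiff.contMDiffAt.comp_contMDiffWithinAt _ (κ.contMDiffWithinAt_E_crush hx)
  have hrq : ContMDiffWithinAt ((𝓡∂ n).prod 𝓘(ℝ, ℝ)) (𝓡∂ n) ∞ (fun z => κ.r (q z)) (O ×ˢ univ)
      (x, (0 : ℝ)) := by
    refine ContMDiffAt.comp_contMDiffWithinAt (x, (0 : ℝ)) (g := κ.r) ?_ hqs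
    rw [hqx]
    exact κ.contMDiffOn_r.contMDiffAt (κ.isOpen_W.mem_nhds (κ.subset_W (hfO hx)))
  -- For t ≤ 0 one has crush t = 0, so q(y, t) = f y lies on `O` and is its own foot. Together with
  -- R(y, t) = t this makes F a product on the other side.
  set F : M × ℝ → M × ℝ := fun z => (κ.r (q z), R z) with hF
  have hFs : ContMDiffWithinAt ((𝓡∂ n).prod 𝓘(ℝ, ℝ)) ((𝓡∂ n).prod 𝓘(ℝ, ℝ)) ∞ F (O ×ˢ univ)
      (x, (0 : ℝ)) := hrq.prodMk hR.contMDiffWithinAt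
  have hF0 : ∀ y ∈ O, ∀ t ≤ 0, F (y, t) = (f y, t) := by
    intro y hy t ht
    simp only [hF, hq, crush_of_nonpos ht, κ.E_zero hy, κ.r_eq _ (hfO hy), hR0 (y, t) ht]
  refine ⟨F, hFs, hF0, ?_⟩
  have hs : O ×ˢ Ici (0 : ℝ) ⊆ O ×ˢ univ := prod_mono_right (subset_univ _)
  -- eventualities at `(x, 0)` and at `(f x, 0)`, within the closed side of the collar
  have hmono (y : M) : 𝓝[O ×ˢ Ici (0 : ℝ)] (y, (0 : ℝ)) ≤ 𝓝[O ×ˢ Ico (0 : ℝ) 1] (y, (0 : ℝ)) := by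
    rw [nhdsWithin_prod_eq, nhdsWithin_prod_eq, nhdsWithin_Ico_eq_nhdsGE one_pos]
  have hfar : ∀ᶠ z in 𝓝[O ×ˢ Ici (0 : ℝ)] (f x, (0 : ℝ)), κ.E z ∈ V ∧ κ.r (κ.E z) = z.1 ∧
      κ.h (κ.E z) = z.2 :=
    hmono _ ((κ.eventually_E_mem (hfO hx) (hVo.mem_nhds (hOV (hfO hx)))).and
      (κ.rh_E _ (hfO hx)))
  have hnear : ∀ᶠ z in 𝓝[O ×ˢ Ici (0 : ℝ)] (x, (0 : ℝ)), κ.E z ∈ V ∧ κ.r (κ.E z) = z.1 ∧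
      κ.h (κ.E z) = z.2 :=
    hmono _ ((κ.eventually_E_mem hx (hVo.mem_nhds (hOV hx))).and (κ.rh_E _ hx))
  have hFt : Filter.Tendsto F (𝓝[O ×ˢ Ici (0 : ℝ)] (x, (0 : ℝ)))
      (𝓝[O ×ˢ Ici (0 : ℝ)] (f x, (0 : ℝ))) := by
    refine tendsto_nhdsWithin_of_tendsto_nhds_of_eventually_within _ ?_ ?_
    · have := hFs.continuousWithinAt.tendsto.mono_left (nhdsWithin_mono _ hs)
      rwa [hF0 x hx 0 le_rfl] at this
    · filter_upwards [nhdsWithin_mono _ hs hqW, nhdsWithin_mono _ hs hRc, self_mem_nhdsWithin]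
        with z hz1 hz2 hz3
      exact ⟨κ.r_mem _ hz1, (hz2 hz3.2).1⟩
  have hconj : ∀ᶠ z in 𝓝[O ×ˢ Ici (0 : ℝ)] (x, (0 : ℝ)),
      Ψ.symm (f (Ψ (κ.E z))) = κ.E (F z) := by
    filter_upwards [hnear, hFt.eventually hfar, nhdsWithin_mono _ hs hqW,
      nhdsWithin_mono _ hs hRc, self_mem_nhdsWithin] with z hz1 hz2 hz3 hz4 hz5
    obtain ⟨a1, a2, a3⟩ := hV _ hz1.1
    have a4 : Ψ (κ.E z) = κ.E (z.1, crush z.2) := by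
      rw [← κ.E_rh _ a1, a2, a3, hz1.2.1, hz1.2.2]
    obtain ⟨b1, b2, b3⟩ := hV _ hz2.1
    -- Both sides have the same foot, and the same height since crush (R z) = h (q z) by the
    -- defining equation of R.
    have b4 : Ψ (κ.E (F z)) = q z := by
      rw [← κ.E_rh _ b1, b2, b3, hz2.2.1, hz2.2.2, ← κ.E_rh _ hz3, (hz4 hz5.2).2, κ.E_rh _ hz3]
    rw [a4, Homeomorph.symm_apply_eq, b4]
  rw [eventually_nhdsWithin_iff] at hconj
  filter_upwards [hqW, hRc, nhdsWithin_le_nhds hconj, self_mem_nhdsWithin] with z hz1 hz2 hz3 hz4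
  exact ⟨κ.r_mem _ hz1, fun hz => ⟨(hz2 hz).1, hz3 ⟨hz4.1, hz⟩⟩⟩

/-- At points of `O` the conjugate is `E ∘ F ∘ (r, h)` with the smooth extension F. Away from `O`
both `Ψ` and its inverse are smooth, and `Ψ` and `f` preserve the complement of `O`. -/
theorem IsCrushing.contMDiff_conj {Ψ : M ≃ₜ M} (hΨ : κ.IsCrushing Ψ)
    (f : M ≃ₘ⟮𝓡∂ n, 𝓡∂ n⟯ M) (hfO : MapsTo f O O) (hfO' : MapsTo f.symm O O) :
    ContMDiff (𝓡∂ n) (𝓡∂ n) ∞ fun p => Ψ.symm (f (Ψ p)) := by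
  intro p
  by_cases hp : p ∈ O
  · obtain ⟨F, hFs, hF0, hF⟩ := hΨ.exists_conj_extension f hfO hfO' hp
    have hW := κ.isOpen_W.mem_nhds (κ.subset_W hp)
    have h1 : ContMDiffAt (𝓡∂ n) ((𝓡∂ n).prod 𝓘(ℝ, ℝ)) ∞ (fun q => (κ.r q, κ.h q)) p :=
      (κ.contMDiffOn_r.contMDiffAt hW).prodMk (κ.contMDiffOn_h.contMDiffAt hW)
    have h1p : (κ.r p, κ.h p) = (p, 0) := by rw [κ.r_eq p hp, κ.h_eq p hp]
    have ht : Filter.Tendsto (fun q => (κ.r q, κ.h q)) (𝓝 p) (𝓝[O ×ˢ univ] (p, (0 : ℝ))) := by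
      refine tendsto_nhdsWithin_of_tendsto_nhds_of_eventually_within _ ?_ ?_
      · have := h1.continuousAt.tendsto
        rwa [h1p] at this
      · filter_upwards [hW] with q hq using ⟨κ.r_mem q hq, mem_univ _⟩
    have h2 : ContMDiffAt (𝓡∂ n) ((𝓡∂ n).prod 𝓘(ℝ, ℝ)) ∞ (fun q => F (κ.r q, κ.h q)) p := by
      have hFs' : ContMDiffWithinAt ((𝓡∂ n).prod 𝓘(ℝ, ℝ)) ((𝓡∂ n).prod 𝓘(ℝ, ℝ)) ∞ F
          (O ×ˢ univ) (κ.r p, κ.h p) := h1p ▸ hFs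
      have hm : MapsTo (fun q => (κ.r q, κ.h q)) κ.W (O ×ˢ univ) :=
        fun q hq => ⟨κ.r_mem q hq, mem_univ _⟩
      exact (ContMDiffWithinAt.comp p hFs' (h1.contMDiffWithinAt (s := κ.W)) hm).contMDiffAt hW
    have h2p : F (κ.r p, κ.h p) = (f p, 0) := by rw [h1p, hF0 p hp 0 le_rfl]
    have ht2 : ∀ᶠ q in 𝓝 p, F (κ.r q, κ.h q) ∈ O ×ˢ Ico (0 : ℝ) 1 := by
      have : ContinuousAt (fun q => (F (κ.r q, κ.h q)).2) p := h2.continuousAt.snd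
      filter_upwards [hW, ht.eventually hF, this.eventually (p := fun t => t < 1) (gt_mem_nhds (by
        simp only [h2p]; exact one_pos))] with q hq1 hq2 hq3
      exact ⟨hq2.1, (hq2.2 (κ.h_mem q hq1).1).1, hq3⟩
    have h3 : ContMDiffWithinAt ((𝓡∂ n).prod 𝓘(ℝ, ℝ)) (𝓡∂ n) ∞ κ.E (O ×ˢ Ico (0 : ℝ) 1)
        (F (κ.r p, κ.h p)) := κ.contMDiffOn_E _ ht2.self_of_nhds
    have h4 : ContMDiffAt (𝓡∂ n) (𝓡∂ n) ∞ (fun q => κ.E (F (κ.r q, κ.h q))) p :=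
      (ContMDiffWithinAt.comp p h3 (h2.contMDiffWithinAt
        (s := {q | F (κ.r q, κ.h q) ∈ O ×ˢ Ico (0 : ℝ) 1})) fun q hq => hq).contMDiffAt ht2
    refine h4.congr_of_eventuallyEq ?_
    filter_upwards [hW, ht.eventually hF] with q hq1 hq2
    have := (hq2.2 (κ.h_mem q hq1).1).2
    rwa [κ.E_rh q hq1] at this
  · have h1 : Ψ p ∉ O := fun h => by
      have := hΨ.apply_eq _ h
      exact hp (Ψ.injective this ▸ h)
    have h2 : f (Ψ p) ∉ O := fun h => h1 (by simpa using hfO' h)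
    exact ((hΨ.contMDiffAt _ h2).2.comp (Ψ p) f.contMDiff.contMDiffAt).comp p (hΨ.contMDiffAt p hp).1

theorem IsCrushing.isSmoothDiffeo_conj {Ψ : M ≃ₜ M} (hΨ : κ.IsCrushing Ψ)
    (hO : ∀ f : M ≃ₘ⟮𝓡∂ n, 𝓡∂ n⟯ M, MapsTo f O O) {f : M ≃ₜ M} (hf : IsSmoothDiffeo n f) :
    IsSmoothDiffeo n (conjHomeo Ψ f) := by
  obtain ⟨F, hF⟩ := hf
  have hF' : ⇑F.symm = f.symm := F.coe_symm_eq hF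
  refine ⟨{ toEquiv := (conjHomeo Ψ f).toEquiv
            contMDiff_toFun := ?_
            contMDiff_invFun := ?_ }, rfl⟩
  · have := hΨ.contMDiff_conj F (hO F) (hO F.symm)
    rwa [hF] at this
  · have := hΨ.contMDiff_conj F.symm (hO F.symm) (hO F.symm.symm)
    rwa [hF'] at this

end BoundaryCollar

/-! ### The orbit of `C` under diffeomorphisms and its collar. -/

/-- A locally constant function on a subset of a metrizable space extends to a function which is
locally constant on an open neighbourhood. -/
theorem exists_locallyConstant_extension {X T : Type*} [TopologicalSpace X]
    [TopologicalSpace.MetrizableSpace X] {O : Set X} (F : X → T)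
    (hF : ∀ x ∈ O, ∀ᶠ y in 𝓝[O] x, F y = F x) :
    ∃ (F' : X → T) (W : Set X), IsOpen W ∧ O ⊆ W ∧ EqOn F' F O ∧
      ∀ x ∈ W, ∀ᶠ y in 𝓝 x, F' y = F' x := by
  let := TopologicalSpace.metrizableSpaceMetric X
  -- The factor 2 ensures that if the balls of radii ρ x and ρ x′ meet, the distance of their
  -- centres is below twice the larger radius, so F takes the same value at both centres.
  have h1 (x : X) : ∃ ρ > 0, x ∈ O → ∀ y ∈ O, dist y x < 2 * ρ → F y = F x := by
    by_cases hx : x ∈ O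
    · obtain ⟨ε, hε, h⟩ := Metric.eventually_nhds_iff.1 (eventually_nhdsWithin_iff.1 (hF x hx))
      exact ⟨ε / 2, half_pos hε, fun _ y hy hd => h (by linarith) hy⟩
    · exact ⟨1, one_pos, fun h => absurd h hx⟩
  choose ρ hρ h1 using h1
  have key {x x' p : X} (hx : x ∈ O) (hx' : x' ∈ O) (hp : dist p x < ρ x) (hp' : dist p x' < ρ x') :
      F x = F x' := by
    have hd : dist x x' < ρ x + ρ x' := by
      have := dist_triangle_left x x' p
      linarith
    obtain h | h := le_total (ρ x) (ρ x')
    · exact h1 x' hx' x hx (by linarith)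
    · exact (h1 x hx x' hx' (by rw [dist_comm]; linarith)).symm
  have h2 (p : X) : ∃ t : T, ∀ x ∈ O, dist p x < ρ x → t = F x := by
    by_cases h : ∃ x ∈ O, dist p x < ρ x
    · obtain ⟨x, hx, hp⟩ := h
      exact ⟨F x, fun x' hx' hp' => key hx hx' hp hp'⟩
    · exact ⟨F p, fun x hx hp => absurd ⟨x, hx, hp⟩ h⟩
  choose F' hF' using h2
  refine ⟨F', ⋃ x ∈ O, Metric.ball x (ρ x), isOpen_biUnion fun _ _ => Metric.isOpen_ball,
    fun x hx => mem_biUnion hx (Metric.mem_ball_self (hρ x)), fun x hx => ?_, fun p hp => ?_⟩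
  · exact hF' x x hx (by simpa using hρ x)
  · obtain ⟨x, hx, hpx⟩ := mem_iUnion₂.1 hp
    filter_upwards [Metric.isOpen_ball.mem_nhds hpx] with q hq
    rw [hF' q x hx hq, hF' p x hx hpx]

/-- In the collar coordinates `η : U ≅ C × [0, 1)`, the map `g` has near `x ∈ C` a smooth extension
to both sides of `C` which is a product on the other side. -/
def ExtendsByProduct (n : ℕ) [NeZero n] {M : Type*} [TopologicalSpace M] [ChartedSpace (EuclideanHalfSpace n) M]
    (C : Set M) (ηinv : M × ℝ → M) (g : M → M) (x : M) : Prop :=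
  ∃ F : M × ℝ → M × ℝ,
    ContMDiffWithinAt ((𝓡∂ n).prod 𝓘(ℝ, ℝ)) ((𝓡∂ n).prod 𝓘(ℝ, ℝ)) ∞ F (C ×ˢ univ)
      (x, (0 : ℝ)) ∧
    (∀ y ∈ C, ∀ t ≤ 0, F (y, t) = (g y, t)) ∧
    ∀ᶠ z in 𝓝[C ×ˢ univ] (x, (0 : ℝ)), (F z).1 ∈ C ∧
      (0 ≤ z.2 → 0 ≤ (F z).2 ∧ g (ηinv z) = ηinv (F z))

/-- Crushing fixes `C` pointwise, so conjugation leaves the restriction to `C` unchanged;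
compatibility of pairs therefore survives. -/
theorem eqOn_conjHomeo {X : Type*} [TopologicalSpace X] {Ψ f : X ≃ₜ X} {C : Set X}
    (hΨ : ∀ x ∈ C, Ψ x = x) (hf : MapsTo f C C) : EqOn (conjHomeo Ψ f) f C := by
  intro x hx
  change Ψ.symm (f (Ψ x)) = f x
  rw [hΨ x hx, Homeomorph.symm_apply_eq, hΨ _ (hf hx)]

section

variable {n : ℕ} [NeZero n] {M : Type*} [TopologicalSpace M]
  [ChartedSpace (EuclideanHalfSpace n) M]

theorem Diffeomorph.mapsTo_boundary (f : M ≃ₘ⟮𝓡∂ n, 𝓡∂ n⟯ M) :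
    MapsTo f ((𝓡∂ n).boundary M) ((𝓡∂ n).boundary M) :=
  fun _ hx => (f.image_boundary (by simp)).subset (mem_image_of_mem f hx)

theorem Diffeomorph.mapsTo_connectedComponentIn_boundary (f : M ≃ₘ⟮𝓡∂ n, 𝓡∂ n⟯ M) {x : M}
    (hx : x ∈ (𝓡∂ n).boundary M) :
    MapsTo f (connectedComponentIn ((𝓡∂ n).boundary M) x)
      (connectedComponentIn ((𝓡∂ n).boundary M) (f x)) := by
  have h1 : IsPreconnected (f '' connectedComponentIn ((𝓡∂ n).boundary M) x) :=
    isPreconnected_connectedComponentIn.image _ f.continuous.continuousOn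
  have h2 := h1.subset_connectedComponentIn (mem_image_of_mem f (mem_connectedComponentIn hx))
    (F := (𝓡∂ n).boundary M) (by
      rintro _ ⟨y, hy, rfl⟩
      exact f.mapsTo_boundary (connectedComponentIn_subset _ _ hy))
  exact fun y hy => h2 (mem_image_of_mem f hy)

variable (n) in
/-- The union of the images of `C` under all diffeomorphisms. -/
def diffeoOrbit (C : Set M) : Set M := ⋃ f : M ≃ₘ⟮𝓡∂ n, 𝓡∂ n⟯ M, f '' C

variable {C : Set M}

theorem mem_diffeoOrbit {x : M} :
    x ∈ diffeoOrbit n C ↔ ∃ f : M ≃ₘ⟮𝓡∂ n, 𝓡∂ n⟯ M, f.symm x ∈ C := by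
  simp only [diffeoOrbit, mem_iUnion]
  refine exists_congr fun f => ⟨?_, fun h => ⟨_, h, f.apply_symm_apply x⟩⟩
  rintro ⟨y, hy, rfl⟩
  rwa [f.symm_apply_apply]

theorem subset_diffeoOrbit : C ⊆ diffeoOrbit n C :=
  fun _ hx => mem_diffeoOrbit.2 ⟨Diffeomorph.refl _ _ _, hx⟩

theorem mapsTo_diffeoOrbit (f : M ≃ₘ⟮𝓡∂ n, 𝓡∂ n⟯ M) :
    MapsTo f (diffeoOrbit n C) (diffeoOrbit n C) := by
  intro x hx
  obtain ⟨g, hg⟩ := mem_diffeoOrbit.1 hx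
  refine mem_diffeoOrbit.2 ⟨g.trans f, ?_⟩
  change g.symm (f.symm (f x)) ∈ C
  rwa [f.symm_apply_apply]

/-- A diffeomorphism that pulls one point of a boundary component back into `C` pulls the whole
component back into `C`. -/
theorem isUnionOfBoundaryComponents_diffeoOrbit (hC : IsUnionOfBoundaryComponents n C) :
    IsUnionOfBoundaryComponents n (diffeoOrbit n C) := by
  have h1 : diffeoOrbit n C ⊆ (𝓡∂ n).boundary M := by
    intro x hx
    obtain ⟨f, hf⟩ := mem_diffeoOrbit.1 hx
    have := f.mapsTo_boundary (hC.1 hf)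
    rwa [f.apply_symm_apply] at this
  refine ⟨h1, fun x hx y hy => ?_⟩
  obtain ⟨f, hf⟩ := mem_diffeoOrbit.1 hx
  exact mem_diffeoOrbit.2
    ⟨f, hC.2 _ hf (f.symm.mapsTo_connectedComponentIn_boundary (h1 hx) hy)⟩

variable [IsManifold (𝓡∂ n) ∞ M]

theorem IsUnionOfBoundaryComponents.eventually_mem {O : Set M} (hO : IsUnionOfBoundaryComponents n O)
    {x : M} (hx : x ∈ O) : ∀ᶠ y in 𝓝 x, y ∈ (𝓡∂ n).boundary M → y ∈ O := by
  filter_upwards [eventually_mem_connectedComponentIn_boundary (hO.1 hx)] with y hy hyb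
  exact hO.2 x hx (hy hyb)

/-- A locally constant choice of diffeomorphisms which move the orbit of `C` into `C`. -/
theorem IsUnionOfBoundaryComponents.exists_diffeo_choice (hC : IsUnionOfBoundaryComponents n C) :
    ∃ G : M → M ≃ₘ⟮𝓡∂ n, 𝓡∂ n⟯ M, (∀ x ∈ C, G x = Diffeomorph.refl _ _ _) ∧
      (∀ x ∈ diffeoOrbit n C, (G x).symm x ∈ C) ∧
      ∀ x ∈ diffeoOrbit n C, ∀ᶠ y in 𝓝[diffeoOrbit n C] x, G y = G x := by
  -- The diffeomorphism is chosen as a function of the component K, not of the point, so that it is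
  -- constant along components. The identity is forced when K lies in `C`, which keeps the given
  -- collar there.
  have h1 (K : Set M) : ∃ g : M ≃ₘ⟮𝓡∂ n, 𝓡∂ n⟯ M,
      (K ⊆ C → g = Diffeomorph.refl _ _ _) ∧
      ((∃ f : M ≃ₘ⟮𝓡∂ n, 𝓡∂ n⟯ M, MapsTo f.symm K C) → MapsTo g.symm K C) := by
    by_cases hK : K ⊆ C
    · exact ⟨Diffeomorph.refl _ _ _, fun _ => rfl, fun _ => hK⟩
    by_cases hf : ∃ f : M ≃ₘ⟮𝓡∂ n, 𝓡∂ n⟯ M, MapsTo f.symm K C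
    · obtain ⟨f, hf⟩ := hf
      exact ⟨f, fun h => absurd h hK, fun _ => hf⟩
    · exact ⟨Diffeomorph.refl _ _ _, fun _ => rfl, fun h => absurd h hf⟩
  choose γ hγ1 hγ2 using h1
  have hO := (isUnionOfBoundaryComponents_diffeoOrbit hC)
  refine ⟨fun x => γ (connectedComponentIn ((𝓡∂ n).boundary M) x), fun x hx => hγ1 _ (hC.2 x hx),
    fun x hx => ?_, fun x hx => ?_⟩
  · obtain ⟨f, hf⟩ := mem_diffeoOrbit.1 hx
    exact hγ2 _ ⟨f, fun y hy => hC.2 _ hf (f.symm.mapsTo_connectedComponentIn_boundary (hO.1 hx) hy)⟩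
      (mem_connectedComponentIn (hO.1 hx))
  · rw [eventually_nhdsWithin_iff]
    filter_upwards [eventually_mem_connectedComponentIn_boundary (hO.1 hx)] with y hy hyO
    rw [connectedComponentIn_eq (hy (hO.1 hyO))]

/-- A collar of `C` can be transported by diffeomorphisms to a collar of the orbit of `C`. -/
theorem IsUnionOfBoundaryComponents.exists_collar_diffeoOrbit [T2Space M]
    [SecondCountableTopology M] (hC : IsUnionOfBoundaryComponents n C) {U : Set M} (hU : IsOpen U)
    (hCU : C ⊆ U) (η : SubsetDiffeo (𝓡∂ n) ((𝓡∂ n).prod 𝓘(ℝ, ℝ)) U (C ×ˢ Ico (0 : ℝ) 1))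
    (hη : ∀ x ∈ C, η.toFun x = (x, 0)) :
    ∃ κ : BoundaryCollar n (diffeoOrbit n C),
      (∃ V : Set M, IsOpen V ∧ C ⊆ V ∧ V ⊆ U ∧ ∀ p ∈ V, (κ.r p, κ.h p) = η.toFun p) ∧
      ∀ x ∈ C, ∀ y, κ.E (x, y) = η.invFun (x, y) := by
  have := (𝓡∂ n).locallyCompactSpace
  have := ChartedSpace.locallyCompactSpace (EuclideanHalfSpace n) M
  have := Manifold.metrizableSpace (𝓡∂ n) M
  set O := diffeoOrbit n C with hOdef
  have hO : IsUnionOfBoundaryComponents n O := (isUnionOfBoundaryComponents_diffeoOrbit hC)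
  obtain ⟨G₀, hG₀C, hG₀O, hG₀⟩ := hC.exists_diffeo_choice
  -- The choice must be locally constant on an open neighbourhood of the orbit, not just along it,
  -- because r and h use it at points off the boundary.
  obtain ⟨G, W₀, hW₀, hOW₀, hGG, hG⟩ := exists_locallyConstant_extension G₀ hG₀
  have hGO (x) (hx : x ∈ O) : (G x).symm x ∈ C := by rw [hGG hx]; exact hG₀O x hx
  have hGC (x) (hx : x ∈ C) : G x = Diffeomorph.refl _ _ _ := by
    rw [hGG (subset_diffeoOrbit hx)]; exact hG₀C x hx
  have hηC (x) (hx : x ∈ C) : η.invFun (x, 0) = x := by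
    rw [← hη x hx]; exact η.left_inv x (hCU hx)
  set r : M → M := fun p => G p (η.toFun ((G p).symm p)).1 with hr
  set h : M → ℝ := fun p => (η.toFun ((G p).symm p)).2 with hh
  set E : M × ℝ → M := fun z => G z.1 (η.invFun ((G z.1).symm z.1, z.2)) with hE
  -- E uses the diffeomorphism chosen at the foot, whereas r and h use the one chosen at p. The last
  -- condition makes them equal, so that E inverts (r, h) on W.
  set W : Set M := {p | p ∈ W₀ ∧ (G p).symm p ∈ U ∧ G (r p) = G p} with hW
  have hηs (g : M ≃ₘ⟮𝓡∂ n, 𝓡∂ n⟯ M) (p : M) (hp : g.symm p ∈ U) :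
      ContMDiffAt (𝓡∂ n) ((𝓡∂ n).prod 𝓘(ℝ, ℝ)) ∞ (fun q => η.toFun (g.symm q)) p :=
    (η.contMDiffOn_toFun.contMDiffAt (hU.mem_nhds hp)).comp p g.symm.contMDiff.contMDiffAt
  have hρ (g : M ≃ₘ⟮𝓡∂ n, 𝓡∂ n⟯ M) (p : M) (hp : g.symm p ∈ U) :
      ContMDiffAt (𝓡∂ n) (𝓡∂ n) ∞ (fun q => g (η.toFun (g.symm q)).1) p :=
    g.contMDiff.contMDiffAt.comp p (hηs g p hp).fst
  have hrO (p) (hp : (G p).symm p ∈ U) : r p ∈ O :=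
    mem_diffeoOrbit.2 ⟨G p, by rw [(G p).symm_apply_apply]; exact (η.mapsTo hp).1⟩
  have hrx (x) (hx : x ∈ O) : r x = x := by
    rw [hr]; simp only [hη _ (hGO x hx), Diffeomorph.apply_symm_apply]
  have hE0 (x) (hx : x ∈ O) : E (x, 0) = x := by
    rw [hE]; simp only [hηC _ (hGO x hx), Diffeomorph.apply_symm_apply]
  have hWo : IsOpen W := by
    rw [isOpen_iff_eventually]
    rintro p ⟨hp1, hp2, hp3⟩
    have e1 := hG p hp1
    have e2 := (G p).symm.continuous.continuousAt.preimage_mem_nhds (hU.mem_nhds hp2)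
    have e3 := (hρ (G p) p hp2).continuousAt.eventually (hG (r p) (hOW₀ (hrO p hp2)))
    filter_upwards [e1, e2, e3, hW₀.mem_nhds hp1] with q q1 q2 q3 q4
    refine ⟨q4, by rw [q1]; exact q2, ?_⟩
    have : r q = G p (η.toFun ((G p).symm q)).1 := by rw [hr]; simp only [q1]
    rw [this, q3, hp3, q1]
  have hOW : O ⊆ W := fun x hx => ⟨hOW₀ hx, hCU (hGO x hx), by rw [hrx x hx]⟩
  have hEs : ContMDiffOn ((𝓡∂ n).prod 𝓘(ℝ, ℝ)) (𝓡∂ n) ∞ E (O ×ˢ Ico (0 : ℝ) 1) := by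
    rintro ⟨x, t⟩ ⟨hx, ht⟩
    have e1 : ∀ᶠ z : M × ℝ in 𝓝 (x, t), G z.1 = G x :=
      (continuous_fst.tendsto (x, t)).eventually (p := fun y => G y = G x) (hG x (hOW₀ hx))
    set A : Set (M × ℝ) := {z | z ∈ O ×ˢ Ico (0 : ℝ) 1 ∧ G z.1 = G x} with hA
    have hAn : A ∈ 𝓝[O ×ˢ Ico (0 : ℝ) 1] (x, t) :=
      Filter.inter_mem self_mem_nhdsWithin (nhdsWithin_le_nhds e1)
    have h2 : ContMDiff ((𝓡∂ n).prod 𝓘(ℝ, ℝ)) ((𝓡∂ n).prod 𝓘(ℝ, ℝ)) ∞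
        (fun z : M × ℝ => ((G x).symm z.1, z.2)) :=
      ((G x).symm.contMDiff.comp contMDiff_fst).prodMk contMDiff_snd
    have h3 : ContMDiffOn ((𝓡∂ n).prod 𝓘(ℝ, ℝ)) (𝓡∂ n) ∞
        (fun z : M × ℝ => G x (η.invFun ((G x).symm z.1, z.2))) A := by
      refine (G x).contMDiff.comp_contMDiffOn (η.contMDiffOn_invFun.comp h2.contMDiffOn ?_)
      rintro z ⟨hz1, hz2⟩
      exact ⟨hz2 ▸ hGO z.1 hz1.1, hz1.2⟩
    refine ContMDiffWithinAt.mono_of_mem_nhdsWithin ?_ hAn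
    refine (h3.congr fun z hz => ?_) (x, t) ⟨⟨hx, ht⟩, rfl⟩
    rw [hE]
    simp only [hz.2]
  let κ : BoundaryCollar n O :=
    { isUnion := hO
      W := W
      isOpen_W := hWo
      subset_W := hOW
      r := r
      h := h
      E := E
      contMDiffOn_r := by
        rintro p ⟨hp1, hp2, -⟩
        refine (ContMDiffAt.congr_of_eventuallyEq (hρ (G p) p hp2) ?_).contMDiffWithinAt
        filter_upwards [hG p hp1] with q hq
        rw [hr]
        simp only [hq]
      contMDiffOn_h := by
        rintro p ⟨hp1, hp2, -⟩
        refine (ContMDiffAt.congr_of_eventuallyEq (hηs (G p) p hp2).snd ?_).contMDiffWithinAt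
        filter_upwards [hG p hp1] with q hq
        rw [hh]
        simp only [hq]
      contMDiffOn_E := hEs
      r_mem := fun p hp => hrO p hp.2.1
      h_mem := fun p hp => (η.mapsTo hp.2.1).2
      r_eq := hrx
      h_eq := fun x hx => by rw [hh]; simp only [hη _ (hGO x hx)]
      E_rh := fun p hp => by
        rw [hE]
        simp only [hp.2.2]
        rw [hr, hh]
        simp only [Diffeomorph.symm_apply_apply, Prod.mk.eta, η.left_inv _ hp.2.1,
          Diffeomorph.apply_symm_apply]
      rh_E := fun x hx => by
        have e1 : ∀ᶠ z : M × ℝ in 𝓝 (x, 0), G z.1 = G x :=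
          (continuous_fst.tendsto (x, (0 : ℝ))).eventually (p := fun y => G y = G x)
            (hG x (hOW₀ hx))
        have e2 : Filter.Tendsto E (𝓝[O ×ˢ Ico (0 : ℝ) 1] (x, 0)) (𝓝 x) := by
          have := hEs.continuousOn (x, 0) ⟨hx, by simp⟩
          rwa [ContinuousWithinAt, hE0 x hx] at this
        filter_upwards [nhdsWithin_le_nhds e1, e2.eventually (hG x (hOW₀ hx)),
          self_mem_nhdsWithin] with z z1 z2 z3
        have h1 : (G (E z)).symm (E z) = η.invFun ((G x).symm z.1, z.2) := by
          rw [z2, hE]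
          simp only [z1, Diffeomorph.symm_apply_apply]
        have h2 : η.toFun ((G (E z)).symm (E z)) = ((G x).symm z.1, z.2) := by
          have hz := hGO z.1 z3.1
          rw [z1] at hz
          rw [h1]
          exact η.right_inv ((G x).symm z.1, z.2) ⟨hz, z3.2⟩
        refine ⟨?_, ?_⟩
        · change G (E z) (η.toFun ((G (E z)).symm (E z))).1 = z.1
          rw [h2, z2, Diffeomorph.apply_symm_apply]
        · change (η.toFun ((G (E z)).symm (E z))).2 = z.2
          rw [h2] }
  refine ⟨κ, ⟨U ∩ interior {p | G p = Diffeomorph.refl _ _ _}, hU.inter isOpen_interior,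
    fun x hx => ⟨hCU hx, ?_⟩, inter_subset_left, fun p hp => ?_⟩, fun x hx y => ?_⟩
  · rw [mem_interior_iff_mem_nhds]
    filter_upwards [hG x (hOW₀ (subset_diffeoOrbit hx))] with y hy
    rw [hy, hGC x hx]
  · have hp := interior_subset hp.2
    change (G p (η.toFun ((G p).symm p)).1, (η.toFun ((G p).symm p)).2) = η.toFun p
    rw [mem_ofPred_eq] at hp
    rw [hp]
    rfl
  · change G x (η.invFun ((G x).symm x, y)) = _
    rw [hGC x hx]
    rfl

/-- The single manifold part of the theorem: near a collared union `C` of boundary components there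
is a crushing homeomorphism such that conjugation by it preserves smoothness of diffeomorphisms, and
the conjugates of diffeomorphisms which preserve `C` extend smoothly through `C` by products. -/
theorem IsUnionOfBoundaryComponents.exists_crushing [T2Space M] [SecondCountableTopology M]
    (hC : IsUnionOfBoundaryComponents n C) {U : Set M} (hU : IsOpen U)
    (hCU : C ⊆ U) (η : SubsetDiffeo (𝓡∂ n) ((𝓡∂ n).prod 𝓘(ℝ, ℝ)) U (C ×ˢ Ico (0 : ℝ) 1))
    (hη : ∀ x ∈ C, η.toFun x = (x, 0)) :
    ∃ Ψ : M ≃ₜ M,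
      (∃ V : Set M, IsOpen V ∧ C ⊆ V ∧ V ⊆ U ∧ ∀ p ∈ V, Ψ p ∈ U ∧
        η.toFun (Ψ p) = ((η.toFun p).1, crush (η.toFun p).2)) ∧
      (∀ x ∈ C, Ψ x = x) ∧
      (∀ f : M ≃ₜ M, IsSmoothDiffeo n f → IsSmoothDiffeo n (conjHomeo Ψ f)) ∧
      ∀ f : M ≃ₜ M, IsSmoothDiffeo n f → MapsTo f C C → MapsTo f.symm C C → ∀ x ∈ C,
        ExtendsByProduct n C η.invFun (conjHomeo Ψ f) x := by
  obtain ⟨κ, ⟨V, hV, hCV, hVU, hκ⟩, hE⟩ := hC.exists_collar_diffeoOrbit hU hCU η hη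
  obtain ⟨Ψ, hΨ⟩ := κ.exists_isCrushing
  have hCO : C ⊆ diffeoOrbit n C := subset_diffeoOrbit
  refine ⟨Ψ, ?_, fun x hx => hΨ.apply_eq x (hCO hx),
    fun f hf => hΨ.isSmoothDiffeo_conj mapsTo_diffeoOrbit hf, fun f hf hfC hfC' x hx => ?_⟩
  · obtain ⟨V', hV', hOV', -, hκ'⟩ := hΨ.near
    refine ⟨V ∩ V' ∩ Ψ ⁻¹' V, (hV.inter hV').inter (hV.preimage Ψ.continuous),
      fun x hx => ⟨⟨hCV hx, hOV' (hCO hx)⟩, ?_⟩, fun p hp => hVU hp.1.1, fun p hp => ?_⟩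
    · rw [mem_preimage, hΨ.apply_eq x (hCO hx)]
      exact hCV hx
    · refine ⟨hVU hp.2, ?_⟩
      rw [← hκ _ hp.2, ← hκ _ hp.1.1, (hκ' p hp.1.2).2.1, (hκ' p hp.1.2).2.2]
  · have hfix := eqOn_conjHomeo (f := f) (fun x hx => hΨ.apply_eq x (hCO hx)) hfC
    obtain ⟨Φ, hΦ⟩ := hf
    obtain ⟨F, hF1, hF2, hF3⟩ := hΨ.exists_conj_extension Φ (mapsTo_diffeoOrbit Φ)
      (mapsTo_diffeoOrbit Φ.symm) (hCO hx)
    have hsub : C ×ˢ (univ : Set ℝ) ⊆ diffeoOrbit n C ×ˢ univ := prod_mono_left hCO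
    refine ⟨F, hF1.mono hsub, fun y hy t ht => by rw [hF2 y (hCO hy) t ht, hfix hy, hΦ], ?_⟩
    have hFx : (F (x, 0)).1 = f x := by rw [hF2 x (hCO hx) 0 le_rfl, hΦ]
    -- The extension is only known to take values in the orbit of C. Near f x ∈ C every boundary
    -- point belongs to C, which places the first component in C.
    have e1 : ∀ᶠ z in 𝓝[C ×ˢ univ] (x, (0 : ℝ)), (F z).1 ∈ (𝓡∂ n).boundary M → (F z).1 ∈ C := by
      have hc : ContinuousWithinAt (fun z => (F z).1) (C ×ˢ univ) (x, (0 : ℝ)) :=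
        (hF1.mono hsub).continuousWithinAt.fst
      refine hc.eventually (p := fun y => y ∈ (𝓡∂ n).boundary M → y ∈ C) ?_
      simp only [hFx]
      exact hC.eventually_mem (hfC hx)
    filter_upwards [e1, nhdsWithin_mono _ hsub hF3, self_mem_nhdsWithin] with z z1 z2 z3
    refine ⟨z1 ((isUnionOfBoundaryComponents_diffeoOrbit hC).1 z2.1), fun hz => ⟨(z2.2 hz).1, ?_⟩⟩
    have hz1 := z1 ((isUnionOfBoundaryComponents_diffeoOrbit hC).1 z2.1)
    have := (z2.2 hz).2
    have a1 : κ.E z = η.invFun z := hE z.1 z3.1 z.2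
    have a2 : κ.E (F z) = η.invFun (F z) := hE _ hz1 _
    rwa [a1, a2, hΦ] at this

end

/-! ### Smoothness of the glued map. -/

theorem ContMDiffWithinAt.comp_of_eventually_mem {𝕜 : Type*} [NontriviallyNormedField 𝕜]
    {E₁ : Type*} [NormedAddCommGroup E₁] [NormedSpace 𝕜 E₁] {H₁ : Type*} [TopologicalSpace H₁]
    {I₁ : ModelWithCorners 𝕜 E₁ H₁} {X₁ : Type*} [TopologicalSpace X₁] [ChartedSpace H₁ X₁]
    {E₂ : Type*} [NormedAddCommGroup E₂] [NormedSpace 𝕜 E₂] {H₂ : Type*} [TopologicalSpace H₂]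
    {I₂ : ModelWithCorners 𝕜 E₂ H₂} {X₂ : Type*} [TopologicalSpace X₂] [ChartedSpace H₂ X₂]
    {E₃ : Type*} [NormedAddCommGroup E₃] [NormedSpace 𝕜 E₃] {H₃ : Type*} [TopologicalSpace H₃]
    {I₃ : ModelWithCorners 𝕜 E₃ H₃} {X₃ : Type*} [TopologicalSpace X₃] [ChartedSpace H₃ X₃]
    {k : ℕ∞ω} {g : X₂ → X₃} {f : X₁ → X₂} {s : Set X₁} {t : Set X₂} {x : X₁} {y : X₂}
    (hg : ContMDiffWithinAt I₂ I₃ k g t y) (hf : ContMDiffWithinAt I₁ I₂ k f s x) (hx : f x = y)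
    (hst : ∀ᶠ z in 𝓝[s] x, f z ∈ t) : ContMDiffWithinAt I₁ I₃ k (fun z => g (f z)) s x := by
  subst hx
  exact (hg.comp' x hf).mono_of_mem_nhdsWithin (Filter.inter_mem self_mem_nhdsWithin hst)

theorem tendsto_nhdsWithin_of_contMDiffWithinAt {𝕜 : Type*} [NontriviallyNormedField 𝕜]
    {E₁ : Type*} [NormedAddCommGroup E₁] [NormedSpace 𝕜 E₁] {H₁ : Type*} [TopologicalSpace H₁]
    {I₁ : ModelWithCorners 𝕜 E₁ H₁} {X₁ : Type*} [TopologicalSpace X₁] [ChartedSpace H₁ X₁]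
    {E₂ : Type*} [NormedAddCommGroup E₂] [NormedSpace 𝕜 E₂] {H₂ : Type*} [TopologicalSpace H₂]
    {I₂ : ModelWithCorners 𝕜 E₂ H₂} {X₂ : Type*} [TopologicalSpace X₂] [ChartedSpace H₂ X₂]
    {k : ℕ∞ω} {f : X₁ → X₂} {s : Set X₁} {t : Set X₂} {x : X₁} {y : X₂}
    (hf : ContMDiffWithinAt I₁ I₂ k f s x) (hx : f x = y)
    (hst : ∀ᶠ z in 𝓝[s] x, f z ∈ t) : Filter.Tendsto f (𝓝[s] x) (𝓝[t] y) :=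
  tendsto_nhdsWithin_of_tendsto_nhds_of_eventually_within _ (hx ▸ hf.continuousWithinAt) hst

namespace GluingData

variable {n : ℕ} [NeZero n]
  {M₁ : Type u} [TopologicalSpace M₁] [ChartedSpace (EuclideanHalfSpace n) M₁]
  {M₂ : Type v} [TopologicalSpace M₂] [ChartedSpace (EuclideanHalfSpace n) M₂]

/-- The collar `η₂` with the direction of the normal coordinate reversed. -/
def reflectedCollar₂ (G : GluingData n M₁ M₂) :
    SubsetDiffeo (𝓡∂ n) ((𝓡∂ n).prod 𝓘(ℝ, ℝ)) G.U₂ (G.C₂ ×ˢ Ico (0 : ℝ) 1) where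
  toFun x := ((G.η₂.toFun x).1, -(G.η₂.toFun x).2)
  invFun z := G.η₂.invFun (z.1, -z.2)
  mapsTo x hx := by
    obtain ⟨h1, h2, h3⟩ := G.η₂.mapsTo hx
    exact ⟨h1, by simpa using h3, by simp only; linarith⟩
  mapsTo_inv z hz := by
    obtain ⟨h1, h2, h3⟩ := hz
    exact G.η₂.mapsTo_inv ⟨h1, by simp only; linarith, by simpa using h2⟩
  left_inv x hx := by simp only [neg_neg, Prod.mk.eta, G.η₂.left_inv x hx]
  right_inv z hz := by
    obtain ⟨h1, h2, h3⟩ := hz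
    have : (z.1, -z.2) ∈ G.C₂ ×ˢ Ioc (-1 : ℝ) 0 :=
      ⟨h1, by simp only; linarith, by simpa using h2⟩
    simp only [G.η₂.right_inv _ this, neg_neg, Prod.mk.eta]
  contMDiffOn_toFun :=
    (contMDiff_fst.comp_contMDiffOn G.η₂.contMDiffOn_toFun).prodMk
      ((contDiff_neg.contMDiff.comp contMDiff_snd).comp_contMDiffOn G.η₂.contMDiffOn_toFun)
  contMDiffOn_invFun := by
    refine G.η₂.contMDiffOn_invFun.comp (f := fun z : M₂ × ℝ => (z.1, -z.2))
      (contMDiff_fst.prodMk (contDiff_neg.contMDiff.comp contMDiff_snd)).contMDiffOn ?_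
    rintro z ⟨h1, h2, h3⟩
    exact ⟨h1, by simp only; linarith, by simpa using h2⟩

theorem contMDiff_reflect {M : Type*} [TopologicalSpace M]
    [ChartedSpace (EuclideanHalfSpace n) M] :
    ContMDiff ((𝓡∂ n).prod 𝓘(ℝ, ℝ)) ((𝓡∂ n).prod 𝓘(ℝ, ℝ)) ∞ (fun z : M × ℝ => (z.1, -z.2)) :=
  contMDiff_fst.prodMk (contDiff_neg.contMDiff.comp contMDiff_snd)

/-- The glued map in collar coordinates. -/
theorem exists_gluedMap_collarInv (G : GluingData n M₁ M₂) {g₁ : M₁ ≃ₜ M₁} {g₂ : M₂ ≃ₜ M₂}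
    (h : G.IsCompatible g₁ g₂) (h₂ : IsSmoothDiffeo n g₂)
    (hC₂' : MapsTo g₂.symm G.C₂ G.C₂) {y : M₂} (hy : y ∈ G.C₂)
    (hF₁ : ExtendsByProduct n G.C₁ G.η₁.invFun g₁ (G.α.invFun y))
    (hF₂ : ExtendsByProduct n G.C₂ G.reflectedCollar₂.invFun g₂ y) :
    ∃ F : M₂ × ℝ → M₂ × ℝ,
      ContMDiffWithinAt ((𝓡∂ n).prod 𝓘(ℝ, ℝ)) ((𝓡∂ n).prod 𝓘(ℝ, ℝ)) ∞ F (G.C₂ ×ˢ univ)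
        (y, (0 : ℝ)) ∧ F (y, 0) = (g₂ y, 0) ∧
      ∀ᶠ z in 𝓝[G.C₂ ×ˢ univ] (y, (0 : ℝ)), (F z).1 ∈ G.C₂ ∧
        G.gluedMap g₁ g₂ h (G.collarInv z) = G.collarInv (F z) := by
  obtain ⟨F₁, hF₁s, hF₁0, hF₁e⟩ := hF₁
  obtain ⟨F₂, hF₂s, hF₂0, hF₂e⟩ := hF₂
  obtain ⟨Φ, hΦ⟩ := h₂
  have hΦs : ⇑Φ.symm = g₂.symm := Φ.coe_symm_eq hΦ
  -- the first map, in the coordinates of the second manifold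
  set P : M₂ × ℝ → M₁ × ℝ := fun z => (G.α.invFun z.1, z.2) with hP
  set Q : M₁ × ℝ → M₂ × ℝ := fun z => (G.α.toFun z.1, z.2) with hQ
  have hPs : ContMDiffOn ((𝓡∂ n).prod 𝓘(ℝ, ℝ)) ((𝓡∂ n).prod 𝓘(ℝ, ℝ)) ∞ P (G.C₂ ×ˢ univ) :=
    (G.α.contMDiffOn_invFun.comp contMDiff_fst.contMDiffOn fun z hz => hz.1).prodMk
      contMDiff_snd.contMDiffOn
  have hQs : ContMDiffOn ((𝓡∂ n).prod 𝓘(ℝ, ℝ)) ((𝓡∂ n).prod 𝓘(ℝ, ℝ)) ∞ Q (G.C₁ ×ˢ univ) :=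
    (G.α.contMDiffOn_toFun.comp contMDiff_fst.contMDiffOn fun z hz => hz.1).prodMk
      contMDiff_snd.contMDiffOn
  have hPm : MapsTo P (G.C₂ ×ˢ univ) (G.C₁ ×ˢ univ) := fun z hz => ⟨G.α.mapsTo_inv hz.1, hz.2⟩
  have hy0 : (y, (0 : ℝ)) ∈ G.C₂ ×ˢ univ := ⟨hy, mem_univ _⟩
  have hay := G.α.mapsTo_inv hy
  have hcomm (c : M₂) (hc : c ∈ G.C₂) : G.α.toFun (g₁ (G.α.invFun c)) = g₂ c := by
    rw [h.comm _ (G.α.mapsTo_inv hc), G.α.right_inv c hc]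
  have hF₁P0 : F₁ (P (y, 0)) = (g₁ (G.α.invFun y), 0) := hF₁0 _ hay 0 le_rfl
  have hPt : Filter.Tendsto P (𝓝[G.C₂ ×ˢ univ] (y, (0 : ℝ))) (𝓝[G.C₁ ×ˢ univ] (P (y, 0))) :=
    (hPs _ hy0).continuousWithinAt.tendsto_nhdsWithin hPm
  have hF₁Pe := hPt.eventually hF₁e
  have hF₁P : ContMDiffWithinAt ((𝓡∂ n).prod 𝓘(ℝ, ℝ)) ((𝓡∂ n).prod 𝓘(ℝ, ℝ)) ∞
      (fun z => F₁ (P z)) (G.C₂ ×ˢ univ) (y, (0 : ℝ)) := 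
    hF₁s.comp_of_eq (hPs _ hy0) hPm rfl
  set A : M₂ × ℝ → M₂ × ℝ := fun z => Q (F₁ (P z)) with hA
  have hAs : ContMDiffWithinAt ((𝓡∂ n).prod 𝓘(ℝ, ℝ)) ((𝓡∂ n).prod 𝓘(ℝ, ℝ)) ∞ A
      (G.C₂ ×ˢ univ) (y, (0 : ℝ)) :=
    (hQs _ (show F₁ (P (y, 0)) ∈ G.C₁ ×ˢ univ from
      ⟨(hF₁Pe.self_of_nhdsWithin hy0).1, mem_univ _⟩)).comp_of_eventually_mem hF₁P rfl
      (hF₁Pe.mono fun z hz => ⟨hz.1, mem_univ _⟩)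
  have hA0 (c : M₂) (hc : c ∈ G.C₂) (t : ℝ) (ht : t ≤ 0) : A (c, t) = (g₂ c, t) := by
    simp only [hA, hP, hQ, hF₁0 _ (G.α.mapsTo_inv hc) t ht, hcomm c hc]
  -- the second map
  set ν : M₂ × ℝ → M₂ × ℝ := fun z => (z.1, -z.2) with hν
  have hνs : ContMDiff ((𝓡∂ n).prod 𝓘(ℝ, ℝ)) ((𝓡∂ n).prod 𝓘(ℝ, ℝ)) ∞ ν := contMDiff_reflect
  have hνm : MapsTo ν (G.C₂ ×ˢ univ) (G.C₂ ×ˢ univ) := fun z hz => ⟨hz.1, mem_univ _⟩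
  have hν0 : ν (y, 0) = (y, 0) := by simp [hν]
  have hνt : Filter.Tendsto ν (𝓝[G.C₂ ×ˢ univ] (y, (0 : ℝ))) (𝓝[G.C₂ ×ˢ univ] (y, (0 : ℝ))) := by
    have := (hνs.continuous.continuousWithinAt (x := (y, (0 : ℝ)))).tendsto_nhdsWithin
      hνm
    rwa [hν0] at this
  have hF₂e' := hνt.eventually hF₂e
  set B : M₂ × ℝ → M₂ × ℝ := fun z => ν (F₂ (ν z)) with hB
  have hBs : ContMDiffWithinAt ((𝓡∂ n).prod 𝓘(ℝ, ℝ)) ((𝓡∂ n).prod 𝓘(ℝ, ℝ)) ∞ B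
      (G.C₂ ×ˢ univ) (y, (0 : ℝ)) :=
    hνs.contMDiffAt.comp_contMDiffWithinAt _
      (hF₂s.comp_of_eq hνs.contMDiffAt.contMDiffWithinAt hνm hν0)
  have hB0 (c : M₂) (hc : c ∈ G.C₂) (t : ℝ) (ht : 0 ≤ t) : B (c, t) = (g₂ c, t) := by
    simp only [hB, hν, hF₂0 c hc (-t) (by linarith), neg_neg]
  -- the product map `g₂⁻¹ × id`
  set D : M₂ × ℝ → M₂ × ℝ := fun z => (g₂.symm z.1, z.2) with hD
  have hDs : ContMDiff ((𝓡∂ n).prod 𝓘(ℝ, ℝ)) ((𝓡∂ n).prod 𝓘(ℝ, ℝ)) ∞ D := by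
    refine ContMDiff.prodMk ?_ contMDiff_snd
    rw [← hΦs]
    exact Φ.symm.contMDiff.comp contMDiff_fst
  have hDBs : ContMDiffWithinAt ((𝓡∂ n).prod 𝓘(ℝ, ℝ)) ((𝓡∂ n).prod 𝓘(ℝ, ℝ)) ∞ (fun z => D (B z))
      (G.C₂ ×ˢ univ) (y, (0 : ℝ)) := hDs.contMDiffAt.comp_contMDiffWithinAt _ hBs
  have hDB0 : D (B (y, 0)) = (y, 0) := by
    rw [hB0 y hy 0 le_rfl, hD]
    simp only [g₂.symm_apply_apply]
  have hDBe : ∀ᶠ z in 𝓝[G.C₂ ×ˢ univ] (y, (0 : ℝ)), D (B z) ∈ G.C₂ ×ˢ (univ : Set ℝ) :=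
    hF₂e'.mono fun z hz => ⟨hC₂' hz.1, mem_univ _⟩
  have hDBt := tendsto_nhdsWithin_of_contMDiffWithinAt hDBs hDB0 hDBe
  -- A is the glued map for t ≥ 0 and the product of g₂ with the identity for t ≤ 0, while for B the
  -- roles of the two sides are exchanged. With D the inverse product, A ∘ D ∘ B equals A for t ≥ 0
  -- and B for t ≤ 0. A composition of smooth maps thus replaces a piecewise definition, and no
  -- derivatives need to be matched at t = 0.
  refine ⟨fun z => A (D (B z)), hAs.comp_of_eventually_mem hDBs hDB0 hDBe, ?_, ?_⟩
  · simp only [hDB0, hA0 y hy 0 le_rfl]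
  · filter_upwards [hF₂e', hDBt.eventually hF₁Pe, hF₁Pe, self_mem_nhdsWithin] with z z1 z2 z3 z4
    obtain ⟨c, t⟩ := z
    have hc : c ∈ G.C₂ := z4.1
    refine ⟨G.α.mapsTo z2.1, ?_⟩
    obtain ht | ht := le_total t 0
    · obtain ⟨b1, b2⟩ := z1.2 (show 0 ≤ -t by linarith)
      have hBC : (B (c, t)).1 ∈ G.C₂ := z1.1
      have hBt : (B (c, t)).2 ≤ 0 := by simpa only [hB, hν, Left.neg_nonpos_iff] using b1
      have h1 : A (D (B (c, t))) = B (c, t) := by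
        rw [hD]
        simp only [hA0 _ (hC₂' hBC) _ hBt, g₂.apply_symm_apply, Prod.mk.eta]
      rw [h1, G.collarInv_of_nonpos ht hc, G.collarInv_of_nonpos hBt hBC]
      change G.proj (Sum.inr (g₂ _)) = _
      have b3 : g₂ (G.η₂.invFun (c, - -t)) = G.η₂.invFun (B (c, t)) := b2
      rw [neg_neg] at b3
      rw [b3]
    · have h1 : D (B (c, t)) = (c, t) := by
        rw [hB0 c hc t ht, hD]
        simp only [g₂.symm_apply_apply]
      rw [h1]
      obtain ⟨b1, b2⟩ := z3.2 ht
      have b4 : (A (c, t)).2 = (F₁ (P (c, t))).2 := rfl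
      rw [G.collarInv_of_nonneg ht, G.collarInv_of_nonneg (z := A (c, t)) b1]
      change G.proj (Sum.inl (g₁ (G.η₁.invFun (P (c, t))))) = _
      rw [b2]
      simp only [hA, hQ, G.α.left_inv _ z3.1, Prod.mk.eta]

section

variable [IsManifold (𝓡∂ n) ∞ M₁] [IsManifold (𝓡∂ n) ∞ M₂]

/-- Near the glued boundary the map is read in the collar coordinates of `N`, where
`exists_gluedMap_collarInv` describes it by a smooth F. -/
theorem contMDiffAt_gluedMap_of_mem (G : GluingData n M₁ M₂) {g₁ : M₁ ≃ₜ M₁} {g₂ : M₂ ≃ₜ M₂}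
    (h : G.IsCompatible g₁ g₂) (h₂ : IsSmoothDiffeo n g₂)
    (hC₂' : MapsTo g₂.symm G.C₂ G.C₂) {y : M₂} (hy : y ∈ G.C₂)
    (hF₁ : ExtendsByProduct n G.C₁ G.η₁.invFun g₁ (G.α.invFun y))
    (hF₂ : ExtendsByProduct n G.C₂ G.reflectedCollar₂.invFun g₂ y) :
    ContMDiffAt (𝓡∂ n) (𝓡∂ n) ∞ (G.gluedMap g₁ g₂ h) (G.proj (Sum.inr y)) := by
  obtain ⟨F, hFs, hF0, hF⟩ := G.exists_gluedMap_collarInv h h₂ hC₂' hy hF₁ hF₂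
  obtain ⟨e, he⟩ := G.isGluedStructure.collar
  -- The smooth structure prescribes only the forward map of the collar diffeomorphism; its inverse
  -- is then determined on the target.
  have hinv : EqOn G.collarInv e.invFun (G.C₂ ×ˢ Ioo (-1 : ℝ) 1) := by
    intro z hz
    have h1 := e.mapsTo_inv hz
    have h2 := e.right_inv z hz
    rw [he h1] at h2
    have h3 : G.collarInv (G.collarMap (e.invFun z)) = e.invFun z := G.collarEquiv.left_inv h1
    rwa [h2] at h3
  have hIs : ContMDiffOn ((𝓡∂ n).prod 𝓘(ℝ, ℝ)) (𝓡∂ n) ∞ G.collarInv (G.C₂ ×ˢ Ioo (-1 : ℝ) 1) :=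
    e.contMDiffOn_invFun.congr hinv
  have hMs : ContMDiffOn (𝓡∂ n) ((𝓡∂ n).prod 𝓘(ℝ, ℝ)) ∞ G.collarMap G.collarSet :=
    e.contMDiffOn_toFun.congr fun p hp => (he hp).symm
  set p := G.proj (Sum.inr y) with hp
  have hpS : p ∈ G.collarSet := G.inr_mem_collarSet.2 (G.C₂_subset hy)
  have hpn : G.collarSet ∈ 𝓝 p := G.isOpen_collarSet.mem_nhds hpS
  have hpy : G.collarMap p = (y, 0) := by rw [hp, G.collarMap_inr, G.η₂_apply y hy]
  have hMm : MapsTo G.collarMap G.collarSet (G.C₂ ×ˢ univ) :=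
    fun q hq => ⟨(G.collarEquiv.map_source hq).1, mem_univ _⟩
  have hMt : Filter.Tendsto G.collarMap (𝓝[G.collarSet] p) (𝓝[G.C₂ ×ˢ univ] (y, (0 : ℝ))) := by
    have := (hMs p hpS).continuousWithinAt.tendsto_nhdsWithin hMm
    rwa [hpy] at this
  have hFt : ∀ᶠ z in 𝓝[G.C₂ ×ˢ univ] (y, (0 : ℝ)), F z ∈ G.C₂ ×ˢ Ioo (-1 : ℝ) 1 := by
    have h1 : ContinuousWithinAt (fun z => (F z).2) (G.C₂ ×ˢ univ) (y, (0 : ℝ)) :=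
      hFs.continuousWithinAt.snd
    have h2 : ∀ᶠ z in 𝓝[G.C₂ ×ˢ univ] (y, (0 : ℝ)), (F z).2 ∈ Ioo (-1 : ℝ) 1 := by
      refine h1.eventually (p := fun t => t ∈ Ioo (-1 : ℝ) 1) ?_
      simp only [hF0]
      exact Ioo_mem_nhds (by norm_num) (by norm_num)
    filter_upwards [hF, h2] with z z1 z2 using ⟨z1.1, z2⟩
  have h1 : ContMDiffWithinAt ((𝓡∂ n).prod 𝓘(ℝ, ℝ)) (𝓡∂ n) ∞ (fun z => G.collarInv (F z))
      (G.C₂ ×ˢ univ) (y, (0 : ℝ)) :=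
    (hIs _ (hFt.self_of_nhdsWithin ⟨hy, mem_univ _⟩)).comp_of_eventually_mem hFs rfl hFt
  have h2 : ContMDiffAt (𝓡∂ n) (𝓡∂ n) ∞ (fun q => G.collarInv (F (G.collarMap q))) p :=
    (h1.comp_of_eq (hMs p hpS) hMm hpy).contMDiffAt hpn
  refine h2.congr_of_eventuallyEq ?_
  have h3 := hMt.eventually hF
  rw [nhdsWithin_eq_nhds.2 hpn] at h3
  filter_upwards [h3, hpn] with q hq1 hq2
  have h4 : G.collarInv (G.collarMap q) = q := G.collarEquiv.left_inv hq2
  rw [← hq1.2, h4]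

theorem contMDiffAt_of_isLocalDiffeomorphAt_comp {X Y : Type*} [TopologicalSpace X]
    [ChartedSpace (EuclideanHalfSpace n) X] [TopologicalSpace Y]
    [ChartedSpace (EuclideanHalfSpace n) Y] {j : X → Y} {f : Y → Y} {x : X}
    (hj : IsLocalDiffeomorphAt (𝓡∂ n) (𝓡∂ n) ∞ j x)
    (hf : ContMDiffAt (𝓡∂ n) (𝓡∂ n) ∞ (fun q => f (j q)) x) :
    ContMDiffAt (𝓡∂ n) (𝓡∂ n) ∞ f (j x) := by
  have h1 : hj.localInverse (j x) = x := hj.localInverse_left_inv hj.localInverse_mem_target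
  have h2 : ContMDiffAt (𝓡∂ n) (𝓡∂ n) ∞ (fun q => f (j (hj.localInverse q))) (j x) :=
    ContMDiffAt.comp_of_eq (g := fun q => f (j q)) hf hj.localInverse_contMDiffAt h1
  refine h2.congr_of_eventuallyEq ?_
  filter_upwards [hj.localInverse_eventuallyEq_right] with q hq
  have : j (hj.localInverse q) = q := hq
  rw [this]

/-- Away from the glued boundary the inclusions of `M₁` and `M₂` are local diffeomorphisms, so
smoothness of `g₁` and `g₂` suffices. Every point of `C₁` is identified with a point of `C₂`. -/
theorem contMDiff_gluedMap (G : GluingData n M₁ M₂) {g₁ : M₁ ≃ₜ M₁} {g₂ : M₂ ≃ₜ M₂}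
    (h : G.IsCompatible g₁ g₂) (h₁ : IsSmoothDiffeo n g₁) (h₂ : IsSmoothDiffeo n g₂)
    (hC₁' : MapsTo g₁.symm G.C₁ G.C₁)
    (hC₂' : MapsTo g₂.symm G.C₂ G.C₂)
    (hF₁ : ∀ x ∈ G.C₁, ExtendsByProduct n G.C₁ G.η₁.invFun g₁ x)
    (hF₂ : ∀ y ∈ G.C₂, ExtendsByProduct n G.C₂ G.reflectedCollar₂.invFun g₂ y) :
    ContMDiff (𝓡∂ n) (𝓡∂ n) ∞ (G.gluedMap g₁ g₂ h) := by
  obtain ⟨Φ₁, hΦ₁⟩ := h₁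
  obtain ⟨Φ₂, hΦ₂⟩ := id h₂
  have hs := G.isGluedStructure
  intro p
  rw [← G.proj_sec p]
  generalize G.sec p = q
  have hinr (y : M₂) : ContMDiffAt (𝓡∂ n) (𝓡∂ n) ∞ (G.gluedMap g₁ g₂ h) (G.proj (Sum.inr y)) := by
    by_cases hy : y ∈ G.C₂
    · exact G.contMDiffAt_gluedMap_of_mem h h₂ hC₂' hy (hF₁ _ (G.α.mapsTo_inv hy)) (hF₂ y hy)
    · have hgy : g₂ y ∈ G.C₂ᶜ := fun hg => hy (by simpa using hC₂' hg)
      refine contMDiffAt_of_isLocalDiffeomorphAt_comp (j := fun y => G.proj (Sum.inr y))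
        (hs.isLocalDiffeomorphOn_inr ⟨y, hy⟩) ?_
      have h1 := (hs.isLocalDiffeomorphOn_inr ⟨g₂ y, hgy⟩).contMDiffAt
      have h2 : ContMDiffAt (𝓡∂ n) (𝓡∂ n) ∞ g₂ y := hΦ₂ ▸ Φ₂.contMDiff.contMDiffAt
      exact h1.comp y h2
  obtain x | y := q
  · by_cases hx : x ∈ G.C₁
    · rw [G.proj_inl hx]
      exact hinr _
    · have hgx : g₁ x ∈ G.C₁ᶜ := fun hg => hx (by simpa using hC₁' hg)
      refine contMDiffAt_of_isLocalDiffeomorphAt_comp (j := fun x => G.proj (Sum.inl x))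
        (hs.isLocalDiffeomorphOn_inl ⟨x, hx⟩) ?_
      have h1 := (hs.isLocalDiffeomorphOn_inl ⟨g₁ x, hgx⟩).contMDiffAt
      have h2 : ContMDiffAt (𝓡∂ n) (𝓡∂ n) ∞ g₁ x := hΦ₁ ▸ Φ₁.contMDiff.contMDiffAt
      exact h1.comp x h2
  · exact hinr y

end

end GluingData

/-! ### Compatible pairs and the conclusion. -/

theorem IsSmoothDiffeo.symm {n : ℕ} [NeZero n] {X : Type*} [TopologicalSpace X]
    [ChartedSpace (EuclideanHalfSpace n) X] {f : X ≃ₜ X} (hf : IsSmoothDiffeo n f) :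
    IsSmoothDiffeo n f.symm := by
  obtain ⟨F, hF⟩ := hf
  exact ⟨F.symm, F.coe_symm_eq hF⟩

namespace GluingData

variable {n : ℕ} [NeZero n]
  {M₁ : Type u} [TopologicalSpace M₁] [ChartedSpace (EuclideanHalfSpace n) M₁]
  {M₂ : Type v} [TopologicalSpace M₂] [ChartedSpace (EuclideanHalfSpace n) M₂]

namespace IsCompatible

variable {G : GluingData n M₁ M₂} {f₁ : M₁ ≃ₜ M₁} {f₂ : M₂ ≃ₜ M₂}

theorem mapsTo₁ (h : G.IsCompatible f₁ f₂) : MapsTo f₁ G.C₁ G.C₁ :=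
  fun _ hx => h.image_C₁.subset (mem_image_of_mem f₁ hx)

theorem mapsTo₁_symm (h : G.IsCompatible f₁ f₂) : MapsTo f₁.symm G.C₁ G.C₁ := by
  intro x hx
  obtain ⟨y, hy, rfl⟩ := h.image_C₁.symm.subset hx
  rwa [f₁.symm_apply_apply]

theorem symm (h : G.IsCompatible f₁ f₂) : G.IsCompatible f₁.symm f₂.symm where
  image_C₁ := by
    refine Subset.antisymm (image_subset_iff.2 h.mapsTo₁_symm) fun x hx => ?_
    exact ⟨f₁ x, h.mapsTo₁ hx, f₁.symm_apply_apply x⟩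
  comm x hx := by
    rw [Homeomorph.eq_symm_apply, ← h.comm _ (h.mapsTo₁_symm hx), f₁.apply_symm_apply]

theorem mapsTo₂ (h : G.IsCompatible f₁ f₂) : MapsTo f₂ G.C₂ G.C₂ := by
  intro y hy
  rw [← G.α.right_inv y hy, ← h.comm _ (G.α.mapsTo_inv hy)]
  exact G.α.mapsTo (h.mapsTo₁ (G.α.mapsTo_inv hy))

theorem congr (h : G.IsCompatible f₁ f₂) {g₁ : M₁ ≃ₜ M₁} {g₂ : M₂ ≃ₜ M₂}
    (h₁ : EqOn g₁ f₁ G.C₁) (h₂ : EqOn g₂ f₂ G.C₂) : G.IsCompatible g₁ g₂ where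
  image_C₁ := by rw [h₁.image_eq, h.image_C₁]
  comm x hx := by rw [h₁ hx, h₂ (G.α.mapsTo hx), h.comm x hx]

end IsCompatible

theorem gluedMap_symm_gluedMap (G : GluingData n M₁ M₂) {g₁ : M₁ ≃ₜ M₁} {g₂ : M₂ ≃ₜ M₂}
    (h : G.IsCompatible g₁ g₂) (h' : G.IsCompatible g₁.symm g₂.symm) (p : G.Glued) :
    G.gluedMap g₁.symm g₂.symm h' (G.gluedMap g₁ g₂ h p) = p := by
  induction p using Quot.ind with
  | mk q =>
    obtain x | x := q
    · exact congrArg (fun y => G.proj (Sum.inl y)) (g₁.symm_apply_apply x)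
    · exact congrArg (fun y => G.proj (Sum.inr y)) (g₂.symm_apply_apply x)

theorem gluedMap_gluedMap_symm (G : GluingData n M₁ M₂) {g₁ : M₁ ≃ₜ M₁} {g₂ : M₂ ≃ₜ M₂}
    (h : G.IsCompatible g₁ g₂) (h' : G.IsCompatible g₁.symm g₂.symm) (p : G.Glued) :
    G.gluedMap g₁ g₂ h (G.gluedMap g₁.symm g₂.symm h' p) = p :=
  G.gluedMap_symm_gluedMap h' h p

end GluingData

theorem mainTheorem1 (n : ℕ) [NeZero n]
    {M₁ : Type u} [TopologicalSpace M₁] [T2Space M₁] [SecondCountableTopology M₁]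
    [ChartedSpace (EuclideanHalfSpace n) M₁] [IsManifold (𝓡∂ n) ∞ M₁]
    {M₂ : Type v} [TopologicalSpace M₂] [T2Space M₂] [SecondCountableTopology M₂]
    [ChartedSpace (EuclideanHalfSpace n) M₂] [IsManifold (𝓡∂ n) ∞ M₂]
    (G : GluingData n M₁ M₂) :
    ∃ (Ψ₁ : M₁ ≃ₜ M₁) (Ψ₂ : M₂ ≃ₜ M₂),
      G.IsCrushing₁ Ψ₁ ∧ G.IsCrushing₂ Ψ₂ ∧
      (∀ f₁ : M₁ ≃ₜ M₁, IsSmoothDiffeo n f₁ → IsSmoothDiffeo n (conjHomeo Ψ₁ f₁)) ∧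
      (∀ f₂ : M₂ ≃ₜ M₂, IsSmoothDiffeo n f₂ → IsSmoothDiffeo n (conjHomeo Ψ₂ f₂)) ∧
      (∀ (f₁ : M₁ ≃ₜ M₁) (f₂ : M₂ ≃ₜ M₂), IsSmoothDiffeo n f₁ → IsSmoothDiffeo n f₂ →
        G.IsCompatible f₁ f₂ →
        ∃ h : G.IsCompatible (conjHomeo Ψ₁ f₁) (conjHomeo Ψ₂ f₂),
          IsSmoothDiffeo n (G.gluedMap (conjHomeo Ψ₁ f₁) (conjHomeo Ψ₂ f₂) h)) := by
  obtain ⟨Ψ₁, hcr₁, hfix₁, hconj₁, hext₁⟩ :=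
    G.isUnion₁.exists_crushing G.isOpen_U₁ G.C₁_subset G.η₁ G.η₁_apply
  -- Reversing the normal coordinate of the second collar reduces `M₂` to the same one-manifold
  -- statement; undoing the reversal later produces the two minus signs in the crushing formula.
  obtain ⟨Ψ₂, hcr₂, hfix₂, hconj₂, hext₂⟩ :=
    G.isUnion₂.exists_crushing G.isOpen_U₂ G.C₂_subset G.reflectedCollar₂ fun x hx => by
      simp [GluingData.reflectedCollar₂, G.η₂_apply x hx]
  have compat {f₁ : M₁ ≃ₜ M₁} {f₂ : M₂ ≃ₜ M₂} (h : G.IsCompatible f₁ f₂) :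
      G.IsCompatible (conjHomeo Ψ₁ f₁) (conjHomeo Ψ₂ f₂) :=
    h.congr (eqOn_conjHomeo hfix₁ h.mapsTo₁) (eqOn_conjHomeo hfix₂ h.mapsTo₂)
  have smooth {f₁ : M₁ ≃ₜ M₁} {f₂ : M₂ ≃ₜ M₂} (h₁ : IsSmoothDiffeo n f₁)
      (h₂ : IsSmoothDiffeo n f₂) (h : G.IsCompatible f₁ f₂) :
      ContMDiff (𝓡∂ n) (𝓡∂ n) ∞ (G.gluedMap (conjHomeo Ψ₁ f₁) (conjHomeo Ψ₂ f₂) (compat h)) :=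
    G.contMDiff_gluedMap (compat h) (hconj₁ f₁ h₁) (hconj₂ f₂ h₂) (compat h).mapsTo₁_symm
      (compat h).symm.mapsTo₂
      (fun x hx => hext₁ f₁ h₁ h.mapsTo₁ h.mapsTo₁_symm x hx)
      (fun y hy => hext₂ f₂ h₂ h.mapsTo₂ h.symm.mapsTo₂ y hy)
  refine ⟨Ψ₁, Ψ₂, ?_, ?_, hconj₁, hconj₂, fun f₁ f₂ h₁ h₂ h => ⟨compat h, ?_⟩⟩
  · exact hcr₁
  · obtain ⟨V, hV, hCV, hVU, hΨ⟩ := hcr₂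
    refine ⟨V, hV, hCV, hVU, fun x hx => ⟨(hΨ x hx).1, ?_⟩⟩
    have h1 := (hΨ x hx).2
    refine Prod.ext (Prod.ext_iff.1 h1).1 ?_
    have h2 : -(G.η₂.toFun (Ψ₂ x)).2 = crush (-(G.η₂.toFun x).2) := (Prod.ext_iff.1 h1).2
    exact neg_eq_iff_eq_neg.1 h2
  · exact ⟨{ toFun := G.gluedMap (conjHomeo Ψ₁ f₁) (conjHomeo Ψ₂ f₂) (compat h)
             -- Conjugating an inverse gives the inverse of the conjugate, so the inverse of the
             -- glued map is again a glued map of the same kind and its smoothness is another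
             -- instance of `smooth`.
             invFun := G.gluedMap (conjHomeo Ψ₁ f₁.symm) (conjHomeo Ψ₂ f₂.symm) (compat h.symm)
             left_inv := G.gluedMap_symm_gluedMap (compat h) (compat h.symm)
             right_inv := G.gluedMap_gluedMap_symm (compat h) (compat h.symm)
             contMDiff_toFun := smooth h₁ h₂ h
             contMDiff_invFun := smooth h₁.symm h₂.symm h.symm }, rfl⟩
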